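/- Conventions. $\mathbf{RCA}_0$ is the theory in the language of second order arithmetic ($0,1,+,\cdot,<,\in$) with the basic axioms for the natural numbers, induction for $\Sigma^0_1$-formulas and comprehension for $\Delta^0_1$-formulas (number and set parameters allowed). Arithmetical comprehension is the scheme stating that $\{n\mid\varphi(n)\}$ exists as a set for every formula $\varphi$ without set quantifiers (parameters allowed). In $\mathbf{RCA}_0$, finite sets and finite functions are coded by natural numbers. A linear order consists of a set $X\subseteq\mathbb N$ and a set coding a strict linear order $<_X$ on $X$; it is a well-order if there is no strictly descending sequence $\mathbb N\to X$. Embeddings are strictly increasing functions. We write $n=\{0,\dots,n-1\}$ for the finite orders; the category of natural numbers consists of these orders and the embeddings between them. $[X]^{<\omega}$ is the set of finite subsets of $X$, and $|a|$ is the cardinality of a finite set $a$. All notions below are formulated in the language of second order arithmetic, with functors, families of functions and relations on $\mathbb N$ represented by subsets of $\mathbb N$. A prae-dilator consists of a functor $T$ from the category of natural numbers to linear orders with embeddings, with fields $T(n)\subseteq\mathbb N$, and a natural transformation $\operatorname{supp}:T\Rightarrow[\cdot]^{<\omega}$ such that each $\sigma\in T(n)$ lies in the range of $T(e)$, where $e:|\operatorname{supp}_n(\sigma)|\to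 n$ is the increasing enumeration of $\operatorname{supp}_n(\sigma)$. For a linear order $X$ put $$D^T(X)=\{\langle a,\sigma\rangle\mid a\in[X]^{<\omega},\ \sigma\in T(|a|),\ \operatorname{supp}_{|a|}(\sigma)=|a|\},$$ ordered by $\langle a_0,\sigma_0\rangle<\langle a_1,\sigma_1\rangle$ iff $T(|\iota_0|)(\sigma_0)<_{T(|a_0\cup a_1|)}T(|\iota_1|)(\sigma_1)$, where $|\iota_i|:|a_i|\to|a_0\cup a_1|$ corresponds to the inclusion $a_i\subseteq a_0\cup a_1$ via the increasing enumerations. $T$ is a dilator if $D^T(X)$ is well-founded for every well-order $X$. A normal (prae-)dilator is a (prae-)dilator $T$ together with a natural family of embeddings $\mu^T_n:n\to T(n)$ such that for all $m<n$ and $\sigma\in T(n)$ we have $\sigma<_{T(n)}\mu^T_n(m)$ iff $\operatorname{supp}_n(\sigma)\subseteq\{0,\dots,m-1\}$. For normal prae-dilators $T,S$ let $(T\circ S)(n)=D^T(S(n))$, with $(T\circ S)(f)(\langle a,\sigma\rangle)=\langle\{S(f)(s)\mid s\in a\},\sigma\rangle$ and $\mu^{T\circ S}_n(m)=\langle\{\mu^S_n(m)\},\mu^T_1(0)\rangle$.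 An upper derivative of a normal prae-dilator $T$ consists of a normal prae-dilator $S$ and a natural transformation $\xi:T\circ S\Rightarrow S$ (with embeddings $\xi_n:(T\circ S)(n)\to S(n)$ as components) such that $\xi\circ\mu^{T\circ S}=\mu^S$. Corollary 3.3. The following is provable in $\mathbf{RCA}_0$ (equivalently, it holds in every model of $\mathbf{RCA}_0$, including models with nonstandard first order part): If every normal dilator $T$ has an upper derivative $(S,\xi)$ such that $S$ is a dilator, then arithmetical comprehension holds. -/

import Mathlib

namespace SOA

/-! ## Structures for the language of second order arithmetic -/

/-- A structure for the (two-sorted) language of second order arithmetic: a first order part `M`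
with `0`, `1`, `+`, `·`, `<`, and a collection of subsets of `M` over which the set variables
range. Equality and elementhood are the actual ones. No axioms are imposed; in particular `M` may be
nonstandard. -/
class L2Structure (M : Type*) extends Zero M, One M, Add M, Mul M, LT M where
  sets : Set (Set M)

/-- `A` belongs to the second order part of the structure `M`. -/
def IsSet {M : Type*} [L2Structure M] (A : Set M) : Prop := A ∈ L2Structure.sets (M := M)

/-! ## Arithmetical formulas (with number and set parameters from the structure) -/

/-- Numerical terms with `n` free number variables and with number parameters from `M`. -/
inductive NumTerm (M : Type*) (n : ℕ)
  | var (i : Fin n)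
  | param (a : M)
  | zero
  | one
  | add (s t : NumTerm M n)
  | mul (s t : NumTerm M n)

/-- Arithmetical formulas with `n` free number variables, i.e. formulas of second order arithmetic
without set quantifiers. Number and set parameters from the structure are allowed. Bounded number
quantifiers `∀ x < t` and `∃ x < t` are primitive (the bound `t` does not contain `x`). -/
inductive Formula (M : Type*) [L2Structure M] : ℕ → Type _
  | eq {n : ℕ} (s t : NumTerm M n) : Formula M n
  | lt {n : ℕ} (s t : NumTerm M n) : Formula M n
  | mem {n : ℕ} (t : NumTerm M n) (A : {A : Set M // IsSet A}) : Formula M n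
  | not {n : ℕ} (φ : Formula M n) : Formula M n
  | and {n : ℕ} (φ ψ : Formula M n) : Formula M n
  | or {n : ℕ} (φ ψ : Formula M n) : Formula M n
  | ballLt {n : ℕ} (t : NumTerm M n) (φ : Formula M (n + 1)) : Formula M n
  | bexLt {n : ℕ} (t : NumTerm M n) (φ : Formula M (n + 1)) : Formula M n
  | all {n : ℕ} (φ : Formula M (n + 1)) : Formula M n
  | ex {n : ℕ} (φ : Formula M (n + 1)) : Formula M n

section Semantics

variable {M : Type*} [L2Structure M]

/-- The value of a term under an assignment. -/
def NumTerm.val {n : ℕ} (e : Fin n → M) : NumTerm M n → M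
  | .var i => e i
  | .param a => a
  | .zero => 0
  | .one => 1
  | .add s t => s.val e + t.val e
  | .mul s t => s.val e * t.val e

/-- Satisfaction; the variable bound by a quantifier becomes variable number `0`. -/
def Formula.Sat : {n : ℕ} → Formula M n → (Fin n → M) → Prop
  | _, .eq s t, e => s.val e = t.val e
  | _, .lt s t, e => s.val e < t.val e
  | _, .mem t A, e => t.val e ∈ A.1
  | _, .not φ, e => ¬ φ.Sat e
  | _, .and φ ψ, e => φ.Sat e ∧ ψ.Sat e
  | _, .or φ ψ, e => φ.Sat e ∨ ψ.Sat e
  | _, .ballLt t φ, e => ∀ a : M, a < t.val e → φ.Sat (Fin.cons a e)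
  | _, .bexLt t φ, e => ∃ a : M, a < t.val e ∧ φ.Sat (Fin.cons a e)
  | _, .all φ, e => ∀ a : M, φ.Sat (Fin.cons a e)
  | _, .ex φ, e => ∃ a : M, φ.Sat (Fin.cons a e)

/-- Bounded formulas: all quantifiers are bounded number quantifiers. -/
def Formula.IsBounded : {n : ℕ} → Formula M n → Prop
  | _, .eq _ _ => True
  | _, .lt _ _ => True
  | _, .mem _ _ => True
  | _, .not φ => φ.IsBounded
  | _, .and φ ψ => φ.IsBounded ∧ ψ.IsBounded
  | _, .or φ ψ => φ.IsBounded ∧ ψ.IsBounded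
  | _, .ballLt _ φ => φ.IsBounded
  | _, .bexLt _ φ => φ.IsBounded
  | _, .all _ => False
  | _, .ex _ => False

end Semantics

/-! ## The theories -/

/-- `M` is a model of `RCA₀`: basic axioms, `Σ⁰₁`-induction and `Δ⁰₁`-comprehension. In the two
schemes the variable number `0` is the one that is bound by the leading quantifier. -/
structure IsModelRCA0 (M : Type*) [L2Structure M] : Prop where
  succ_ne_zero : ∀ n : M, n + 1 ≠ 0
  succ_inj : ∀ m n : M, m + 1 = n + 1 → m = n
  add_zero : ∀ m : M, m + 0 = m
  add_succ : ∀ m n : M, m + (n + 1) = (m + n) + 1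
  mul_zero : ∀ m : M, m * 0 = 0
  mul_succ : ∀ m n : M, m * (n + 1) = m * n + m
  not_lt_zero : ∀ m : M, ¬ m < 0
  lt_succ : ∀ m n : M, m < n + 1 ↔ (m < n ∨ m = n)
  sigma_one_induction : ∀ θ : Formula M 2, θ.IsBounded →
    (∃ k : M, θ.Sat ![k, 0]) →
    (∀ n : M, (∃ k : M, θ.Sat ![k, n]) → ∃ k : M, θ.Sat ![k, n + 1]) →
    ∀ n : M, ∃ k : M, θ.Sat ![k, n]
  delta_one_comprehension : ∀ θ ψ : Formula M 2, θ.IsBounded → ψ.IsBounded →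
    (∀ n : M, (∃ k : M, θ.Sat ![k, n]) ↔ ∀ k : M, ψ.Sat ![k, n]) →
    IsSet {n : M | ∃ k : M, θ.Sat ![k, n]}

/-- Arithmetical comprehension holds in `M`. -/
def ArithmeticalComprehension (M : Type*) [L2Structure M] : Prop :=
  ∀ φ : Formula M 1, IsSet {n : M | φ.Sat ![n]}

/-! ## Coding of pairs, finite sets and finite functions by numbers -/

section Coding

variable {M : Type*} [L2Structure M]

/-- The pairing `(i, j) = (i + j)² + i`. -/
def pair (i j : M) : M := (i + j) * (i + j) + i

/-- `i` is an element of the finite set coded by `c = ((k, m), n)`, namely of the set of all `i < k`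
such that `m · (i + 1) + 1` divides `n`. -/
def InCode (i c : M) : Prop :=
  ∃ k m n : M, c = pair (pair k m) n ∧ i < k ∧ ∃ q : M, n = (m * (i + 1) + 1) * q

/-- `c` is the (canonical, i.e. least) code of a finite set. -/
def IsFinSet (c : M) : Prop :=
  ∀ c' : M, c' < c → ¬ ∀ i : M, InCode i c' ↔ InCode i c

/-- `f(i) = j` for a finite function `f`, coded as the finite set of pairs `(i, f(i))`. -/
def FinApp (f i j : M) : Prop := InCode (pair i j) f

end Coding

/-! ## Orders -/

/-- A field together with a binary relation, both subsets (of `M`, `M × M`) given externally. -/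
structure Order (M : Type*) where
  fld : Set M
  lt : M → M → Prop

section Orders

variable {M : Type*} [L2Structure M]

/-- The relation is a strict linear order on the field. -/
structure Order.IsLinear (X : Order M) : Prop where
  lt_mem : ∀ x y, X.lt x y → x ∈ X.fld ∧ y ∈ X.fld
  irrefl : ∀ x, ¬ X.lt x x
  trans : ∀ x y z, X.lt x y → X.lt y z → X.lt x z
  total : ∀ x ∈ X.fld, ∀ y ∈ X.fld, X.lt x y ∨ x = y ∨ X.lt y x

/-- The order belongs to the structure `M`: field and relation are sets of the second order part. -/
def Order.IsInternal (X : Order M) : Prop :=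
  IsSet X.fld ∧ IsSet {z : M | ∃ x y, z = pair x y ∧ X.lt x y}

/-- The order is well-founded in the sense of `M`: no function `g : ℕ → X` that belongs to `M` is
strictly descending. -/
def Order.IsWellFounded (X : Order M) : Prop :=
  ¬ ∃ g : Set M, IsSet g ∧
    (∀ n : M, ∃! x : M, pair n x ∈ g) ∧
    (∀ n x : M, pair n x ∈ g → x ∈ X.fld) ∧
    (∀ n x y : M, pair n x ∈ g → pair (n + 1) y ∈ g → X.lt y x)

/-- The finite order `n = {0, …, n - 1}` with the usual order relation. -/
def seg (n : M) : Order M where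
  fld := {i | i < n}
  lt i j := i < j ∧ j < n

/-- `R` is the graph of an embedding (strictly increasing function) of `X` into `Y`. -/
structure IsEmbedding (X Y : Order M) (R : M → M → Prop) : Prop where
  mem : ∀ x y, R x y → x ∈ X.fld ∧ y ∈ Y.fld
  exists_unique : ∀ x ∈ X.fld, ∃! y, R x y
  lt_of_lt : ∀ x x' y y', R x y → R x' y' → X.lt x x' → Y.lt y y'

/-- `f` codes an embedding of (a finite order) `X` into `Y`. -/
def IsFinEmbedding (X Y : Order M) (f : M) : Prop :=
  IsFinSet f ∧ (∀ z : M, InCode z f → ∃ i j : M, z = pair i j) ∧ IsEmbedding X Y (FinApp f)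

/-- `f : n → m` is a morphism in the category of natural numbers. -/
def IsMorphism (n m f : M) : Prop := IsFinEmbedding (seg n) (seg m) f

/-- `a` is a finite suborder of `X` with `k = |a|`, and `e : |a| → X` is the strictly increasing
enumeration of `a`. -/
def IsEnum (X : Order M) (a k e : M) : Prop :=
  IsFinSet a ∧ IsFinEmbedding (seg k) X e ∧ ∀ x : M, InCode x a ↔ ∃ i : M, FinApp e i x

end Orders

/-! ## Functors and prae-dilators -/

/-- The data of a functor from natural numbers to linear orders: `map n m f σ τ` expresses
`T(f)(σ) = τ` for `f : n → m`. -/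
structure FunctorData (M : Type*) where
  obj : M → Order M
  map : M → M → M → M → M → Prop

/-- The sets that represent a prae-dilator in second order arithmetic. -/
structure PraeDilatorData (M : Type*) where
  objSet : Set M
  ltSet : Set M
  mapSet : Set M
  suppSet : Set M

section PraeDilators

variable {M : Type*} [L2Structure M]

/-- `T` is a functor from the category of natural numbers to the category of linear orders. -/
structure FunctorData.IsFunctor (T : FunctorData M) : Prop where
  linear : ∀ n, (T.obj n).IsLinear
  embedding : ∀ n m f, IsMorphism n m f → IsEmbedding (T.obj n) (T.obj m) (T.map n m f)
  map_id : ∀ n f, IsMorphism n n f → (∀ i, i < n → FinApp f i i) →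
    ∀ σ ∈ (T.obj n).fld, T.map n n f σ σ
  map_comp : ∀ n m k f g h, IsMorphism n m f → IsMorphism m k g → IsMorphism n k h →
    (∀ i j l, FinApp f i j → FinApp g j l → FinApp h i l) →
    ∀ σ τ ρ, T.map n m f σ τ → T.map m k g τ ρ → T.map n k h σ ρ

/-- `ξ` is (the graph of) a natural transformation `A ⇒ B`, with `ξ_n(σ) = τ` expressed by
`(n, (σ, τ)) ∈ ξ`. Components are morphisms of linear orders, i.e. embeddings. -/
structure IsNatTrans (A B : FunctorData M) (ξ : Set M) : Prop where
  isSet : IsSet ξ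
  embedding : ∀ n, IsEmbedding (A.obj n) (B.obj n) (fun σ τ => pair n (pair σ τ) ∈ ξ)
  natural : ∀ n m f, IsMorphism n m f → ∀ σ σ' τ τ', A.map n m f σ σ' →
    pair n (pair σ τ) ∈ ξ → pair m (pair σ' τ') ∈ ξ → B.map n m f τ τ'

namespace PraeDilatorData

/-- The order `T(n)`. -/
def obj (T : PraeDilatorData M) (n : M) : Order M where
  fld := {σ | pair n σ ∈ T.objSet}
  lt σ τ := pair n (pair σ τ) ∈ T.ltSet

/-- `T(f)(σ) = τ` for `f : n → m`. -/
def Map (T : PraeDilatorData M) (n m f σ τ : M) : Prop :=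
  pair (pair n m) (pair f (pair σ τ)) ∈ T.mapSet

/-- `supp_n(σ) = a`. -/
def Supp (T : PraeDilatorData M) (n σ a : M) : Prop := pair n (pair σ a) ∈ T.suppSet

/-- The functor that underlies `T`. -/
def toFunctor (T : PraeDilatorData M) : FunctorData M where
  obj := T.obj
  map := T.Map

/-- `T` is a prae-dilator (that belongs to the structure `M`). -/
structure IsPraeDilator (T : PraeDilatorData M) : Prop where
  isSet_obj : IsSet T.objSet
  isSet_lt : IsSet T.ltSet
  isSet_map : IsSet T.mapSet
  isSet_supp : IsSet T.suppSet
  isFunctor : T.toFunctor.IsFunctor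
  supp_exists_unique : ∀ n, ∀ σ ∈ (T.obj n).fld, ∃! a, T.Supp n σ a
  supp_finite : ∀ n, ∀ σ ∈ (T.obj n).fld, ∀ a, T.Supp n σ a →
    IsFinSet a ∧ ∀ i, InCode i a → i < n
  supp_natural : ∀ n m f, IsMorphism n m f → ∀ σ τ a b, T.Map n m f σ τ →
    T.Supp n σ a → T.Supp m τ b → ∀ j, InCode j b ↔ ∃ i, InCode i a ∧ FinApp f i j
  /-- The support condition: `σ` lies in the image of `T(e)`, where `e : |a| → n` is the increasing
  enumeration of `a = supp_n(σ)`. -/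
  supp_condition : ∀ n, ∀ σ ∈ (T.obj n).fld, ∀ a, T.Supp n σ a →
    ∃ k e, IsEnum (seg n) a k e ∧ ∃ τ ∈ (T.obj k).fld, T.Map k n e τ σ

/-- `z = ⟨a, σ⟩` is an element of `D^T(X)`: `a` is a finite subset of `X`, and `σ ∈ T(|a|)` has
`supp_{|a|}(σ) = |a|`. -/
def DMem (T : PraeDilatorData M) (X : Order M) (z : M) : Prop :=
  ∃ a σ k e c : M, z = pair a σ ∧ IsEnum X a k e ∧ σ ∈ (T.obj k).fld ∧
    T.Supp k σ c ∧ ∀ i, InCode i c ↔ i < k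

/-- The order relation of `D^T(X)`: for `z₀ = ⟨a₀, σ₀⟩` and `z₁ = ⟨a₁, σ₁⟩` we compare
`T(|ι₀|)(σ₀)` and `T(|ι₁|)(σ₁)` in `T(|b|)`, where `b = a₀ ∪ a₁` and where `|ι_i| : |a_i| → |b|` is
induced by the inclusion `a_i ⊆ b`. -/
def DLt (T : PraeDilatorData M) (X : Order M) (z₀ z₁ : M) : Prop :=
  T.DMem X z₀ ∧ T.DMem X z₁ ∧
  ∃ a₀ σ₀ k₀ e₀ a₁ σ₁ k₁ e₁ b k e f₀ f₁ τ₀ τ₁ : M,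
    z₀ = pair a₀ σ₀ ∧ IsEnum X a₀ k₀ e₀ ∧
    z₁ = pair a₁ σ₁ ∧ IsEnum X a₁ k₁ e₁ ∧
    IsEnum X b k e ∧ (∀ x, InCode x b ↔ InCode x a₀ ∨ InCode x a₁) ∧
    IsMorphism k₀ k f₀ ∧ (∀ i j x, FinApp f₀ i j → FinApp e j x → FinApp e₀ i x) ∧
    IsMorphism k₁ k f₁ ∧ (∀ i j x, FinApp f₁ i j → FinApp e j x → FinApp e₁ i x) ∧
    T.Map k₀ k f₀ σ₀ τ₀ ∧ T.Map k₁ k f₁ σ₁ τ₁ ∧ (T.obj k).lt τ₀ τ₁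

/-- The order `D^T(X)`. -/
def D (T : PraeDilatorData M) (X : Order M) : Order M where
  fld := {z | T.DMem X z}
  lt := T.DLt X

/-- `T` preserves well-foundedness: `D^T(X)` is well-founded for any well-order `X` of `M`.
A prae-dilator with this property is a dilator. -/
def PreservesWellOrders (T : PraeDilatorData M) : Prop :=
  ∀ X : Order M, X.IsInternal → X.IsLinear → X.IsWellFounded → (T.D X).IsWellFounded

/-- The composition `T ∘ S`, with `(T ∘ S)(n) = D^T(S(n))` and
`(T ∘ S)(f)(⟨a, σ⟩) = D^T(S(f))(⟨a, σ⟩) = ⟨[S(f)](a), σ⟩`. -/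
def comp (T S : PraeDilatorData M) : FunctorData M where
  obj n := T.D (S.obj n)
  map n m f z w := T.DMem (S.obj n) z ∧ ∃ a σ b : M, z = pair a σ ∧ w = pair b σ ∧ IsFinSet b ∧
    ∀ y, InCode y b ↔ ∃ x, InCode x a ∧ S.Map n m f x y

end PraeDilatorData

end PraeDilators

/-! ## Normal prae-dilators and upper derivatives -/

/-- The sets that represent a normal prae-dilator. -/
structure NormalData (M : Type*) extends PraeDilatorData M where
  muSet : Set M

section Normal

variable {M : Type*} [L2Structure M]

namespace NormalData

/-- `μ_n(i) = σ`. -/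
def Mu (T : NormalData M) (n i σ : M) : Prop := pair n (pair i σ) ∈ T.muSet

/-- `T` is a normal prae-dilator. -/
structure IsNormalPraeDilator (T : NormalData M) : Prop where
  isPraeDilator : T.toPraeDilatorData.IsPraeDilator
  isSet_mu : IsSet T.muSet
  mu_embedding : ∀ n, IsEmbedding (seg n) (T.obj n) (T.Mu n)
  mu_natural : ∀ n m f, IsMorphism n m f → ∀ i j σ τ, FinApp f i j →
    T.Mu n i σ → T.Mu m j τ → T.Map n m f σ τ
  mu_lt_iff : ∀ n i, i < n → ∀ σ ∈ (T.obj n).fld, ∀ τ a, T.Mu n i τ → T.Supp n σ a →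
    ((T.obj n).lt σ τ ↔ ∀ j, InCode j a → j < i)

/-- `T` is a normal dilator. -/
def IsNormalDilator (T : NormalData M) : Prop :=
  T.IsNormalPraeDilator ∧ T.PreservesWellOrders

/-- `D^μ_X(x) = ⟨{x}, μ_1(0)⟩ = z`. -/
def DMu (T : NormalData M) (x z : M) : Prop :=
  ∃ c σ : M, z = pair c σ ∧ IsFinSet c ∧ (∀ y, InCode y c ↔ y = x) ∧ T.Mu 1 0 σ

/-- `μ^{T ∘ S}_n(i) = D^{μ^T}_{S(n)}(μ^S_n(i)) = z`. -/
def CompMu (T S : NormalData M) (n i z : M) : Prop :=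
  ∃ s : M, S.Mu n i s ∧ T.DMu s z

/-- `(S, ξ)` is an upper derivative of `T`: `S` is a normal prae-dilator, and `ξ : T ∘ S ⇒ S` is a
natural transformation (that belongs to `M`) with `ξ ∘ μ^{T ∘ S} = μ^S`. -/
structure IsUpperDerivative (T S : NormalData M) (ξ : Set M) : Prop where
  normal : S.IsNormalPraeDilator
  natTrans : IsNatTrans (T.comp S.toPraeDilatorData) S.toFunctor ξ
  comp_mu : ∀ n i z s, i < n → T.CompMu S n i z → S.Mu n i s → pair n (pair z s) ∈ ξ

end NormalData

end Normal

end SOA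

/-!
Arithmetical comprehension follows from a single instance of the hypothesis, for the normal
dilator `quadDilator` with `T(n) = {(i, j) | j ≤ i < n}`. Its order compares first components,
then puts `(i, i)` before all `(i, j)` with `j < i`, and compares second components otherwise. It
preserves well-orders in `RCA₀`, by `quad_isNormalDilator`.

An upper derivative `(S, ξ)` of `T` amounts to elements `ξ(u, v) ∈ S(n)` for `v ≤ u` in `S(n)`.
These are lexicographically ordered, with `ξ(μ(i), μ(i)) = μ(i)`, hence with `μ(i) < ξ(μ(i), v)`
for `v < μ(i)`. A finite set `a = {x₀ < … < x_t} ⊆ n` thus yields an element of `S(n)`, namely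
`ξ(μ(x_t), ξ(μ(x_{t-1}), … μ(x₀)))`. These elements are compared like the sets `a`, by the largest
element of the symmetric difference (`TowerAt.lt_of_diff`). All of them are images of single
elements `G(t) ∈ S(t + 1)` with full support (`IsTower`, `IsTower.supp_eq`). By `IsTower.dLt`, the
order `D^S(Y)` contains the exponential order of nonempty finite subsets of `Y`, for every linear
order `Y`. If `S` is a dilator, this order is well-founded when `Y` is. It is enough to compare
sets such that the smaller one has an element below the largest difference.

To compute the range of an injection `f` one considers the linear order `stageOrder f` that is
generated by approximations to the true stages of `f`, i.e. to the numbers `n` with `f(n) < f(k)`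
for all `k > n`. Its exponential has an explicit descending sequence (`exists_branch_diff`), so
that `stageOrder f` itself has a descending sequence. The latter consists of true stages, from
which the range of `f` can be computed (`isSet_range_of_descending`). The existence of ranges of
injections entails `Σ⁰₁`-comprehension (`isSet_of_sig`) and then arithmetical comprehension, by
induction over formulas.

All this takes place in a possibly nonstandard model `M` of `RCA₀`. To work there, one needs that
`M` is an ordered semiring, that finite sets are coded, and that the schemes of induction and
comprehension apply. Definability is expressed by the classes `Bdd`, `Sig` and `Pi1` of relations
on `M` and by the class `Fn` of functions with `Σ⁰₁`-graph; their closure properties are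
instances, so that the complexity of a relation can be read off from its shape by instance
resolution.
-/

namespace SOA

/-! ### Definability -/

section Definability

variable {M : Type*} [L2Structure M] {n : ℕ}

/-- `t` is given by a term (with number parameters). -/
class TermFn (t : (Fin n → M) → M) : Prop where
  out : ∃ s : NumTerm M n, ∀ e, s.val e = t e

/-- `P` is given by a bounded formula (with number and set parameters). -/
class Bdd (P : (Fin n → M) → Prop) : Prop where
  out : ∃ θ : Formula M n, θ.IsBounded ∧ ∀ e, θ.Sat e ↔ P e

/-- `P` is given by a `Σ⁰₁`-formula. -/
class Sig (P : (Fin n → M) → Prop) : Prop where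
  out : ∃ Q : (Fin (n + 1) → M) → Prop, Bdd Q ∧ ∀ e, P e ↔ ∃ k, Q (Fin.cons k e)

/-- `P` is given by a `Π⁰₁`-formula. -/
class Pi1 (P : (Fin n → M) → Prop) : Prop where
  out : Sig (fun e => ¬ P e)

/-- `t` has a `Σ⁰₁`-definable graph; the value is variable number `0`. -/
class Fn (t : (Fin n → M) → M) : Prop where
  out : Sig (fun e : Fin (n + 1) → M => e 0 = t (fun i => e i.succ))

instance (i : Fin n) : TermFn (fun e : Fin n → M => e i) := ⟨.var i, fun _ => rfl⟩
instance (a : M) : TermFn (fun _ : Fin n → M => a) := ⟨.param a, fun _ => rfl⟩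
instance (s t : (Fin n → M) → M) [hs : TermFn s] [ht : TermFn t] :
    TermFn (fun e => s e + t e) := by
  obtain ⟨u, hu⟩ := hs; obtain ⟨v, hv⟩ := ht
  exact ⟨.add u v, fun e => by simp [NumTerm.val, hu, hv]⟩
instance (s t : (Fin n → M) → M) [hs : TermFn s] [ht : TermFn t] :
    TermFn (fun e => s e * t e) := by
  obtain ⟨u, hu⟩ := hs; obtain ⟨v, hv⟩ := ht
  exact ⟨.mul u v, fun e => by simp [NumTerm.val, hu, hv]⟩
instance (s t : (Fin n → M) → M) [hs : TermFn s] [ht : TermFn t] :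
    TermFn (fun e => pair (s e) (t e)) := by
  unfold pair; infer_instance

theorem NumTerm.exists_subst {m : ℕ} (s : NumTerm M n) (t : Fin n → NumTerm M m) :
    ∃ u : NumTerm M m, ∀ e, u.val e = s.val (fun i => (t i).val e) := by
  induction s with
  | var i => exact ⟨t i, fun _ => rfl⟩
  | param a => exact ⟨.param a, fun _ => rfl⟩
  | zero => exact ⟨.zero, fun _ => rfl⟩
  | one => exact ⟨.one, fun _ => rfl⟩
  | add s₁ s₂ h₁ h₂ =>
    obtain ⟨u, hu⟩ := h₁; obtain ⟨v, hv⟩ := h₂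
    exact ⟨.add u v, fun e => by simp [NumTerm.val, hu, hv]⟩
  | mul s₁ s₂ h₁ h₂ =>
    obtain ⟨u, hu⟩ := h₁; obtain ⟨v, hv⟩ := h₂
    exact ⟨.mul u v, fun e => by simp [NumTerm.val, hu, hv]⟩

theorem exists_lift {m : ℕ} (t : Fin n → NumTerm M m) :
    ∃ t' : Fin (n + 1) → NumTerm M (m + 1), ∀ (a : M) (e : Fin m → M),
      (fun i => (t' i).val (Fin.cons a e)) = Fin.cons a (fun i => (t i).val e) := by
  choose u hu using fun i => (t i).exists_subst (fun j => NumTerm.var j.succ)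
  refine ⟨Fin.cons (.var 0) u, fun a e => ?_⟩
  funext i
  refine Fin.cases ?_ (fun j => ?_) i
  · simp [NumTerm.val]
  · simp [hu, NumTerm.val]

theorem Formula.exists_subst (θ : Formula M n) : θ.IsBounded → ∀ {m : ℕ} (t : Fin n → NumTerm M m),
    ∃ θ' : Formula M m, θ'.IsBounded ∧ ∀ e, θ'.Sat e ↔ θ.Sat (fun i => (t i).val e) := by
  induction θ with
  | eq s₁ s₂ =>
    intro _ m t
    obtain ⟨u, hu⟩ := s₁.exists_subst t; obtain ⟨v, hv⟩ := s₂.exists_subst t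
    exact ⟨.eq u v, trivial, fun e => by simp [Formula.Sat, hu, hv]⟩
  | lt s₁ s₂ =>
    intro _ m t
    obtain ⟨u, hu⟩ := s₁.exists_subst t; obtain ⟨v, hv⟩ := s₂.exists_subst t
    exact ⟨.lt u v, trivial, fun e => by simp [Formula.Sat, hu, hv]⟩
  | mem s A =>
    intro _ m t
    obtain ⟨u, hu⟩ := s.exists_subst t
    exact ⟨.mem u A, trivial, fun e => by simp [Formula.Sat, hu]⟩
  | not φ h =>
    intro hb m t
    obtain ⟨φ', hb', h'⟩ := h hb t
    exact ⟨.not φ', hb', fun e => by simp [Formula.Sat, h']⟩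
  | and φ ψ h₁ h₂ =>
    intro hb m t
    obtain ⟨φ', hb', h'⟩ := h₁ hb.1 t
    obtain ⟨ψ', hc', k'⟩ := h₂ hb.2 t
    exact ⟨.and φ' ψ', ⟨hb', hc'⟩, fun e => by simp [Formula.Sat, h', k']⟩
  | or φ ψ h₁ h₂ =>
    intro hb m t
    obtain ⟨φ', hb', h'⟩ := h₁ hb.1 t
    obtain ⟨ψ', hc', k'⟩ := h₂ hb.2 t
    exact ⟨.or φ' ψ', ⟨hb', hc'⟩, fun e => by simp [Formula.Sat, h', k']⟩
  | ballLt s φ h =>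
    intro hb m t
    obtain ⟨u, hu⟩ := s.exists_subst t
    obtain ⟨t', ht'⟩ := exists_lift t
    obtain ⟨φ', hb', h'⟩ := h hb t'
    exact ⟨.ballLt u φ', hb', fun e => by simp [Formula.Sat, h', hu, ht']⟩
  | bexLt s φ h =>
    intro hb m t
    obtain ⟨u, hu⟩ := s.exists_subst t
    obtain ⟨t', ht'⟩ := exists_lift t
    obtain ⟨φ', hb', h'⟩ := h hb t'
    exact ⟨.bexLt u φ', hb', fun e => by simp [Formula.Sat, h', hu, ht']⟩
  | all φ h => intro hb; exact hb.elim
  | ex φ h => intro hb; exact hb.elim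

theorem Bdd.subst {m : ℕ} {P : (Fin n → M) → Prop} (hP : Bdd P) (t : Fin n → (Fin m → M) → M)
    (ht : ∀ i, TermFn (t i)) : Bdd (fun e => P (fun i => t i e)) := by
  obtain ⟨θ, hb, h⟩ := hP
  choose u hu using fun i => (ht i).out
  obtain ⟨θ', hb', h'⟩ := θ.exists_subst hb u
  exact ⟨θ', hb', fun e => by rw [h', h]; simp [hu]⟩

theorem Bdd.congr {P Q : (Fin n → M) → Prop} (hP : Bdd P) (h : ∀ e, P e ↔ Q e) : Bdd Q := by
  rwa [← show P = Q from funext fun e => propext (h e)]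

theorem Sig.congr {P Q : (Fin n → M) → Prop} (hP : Sig P) (h : ∀ e, P e ↔ Q e) : Sig Q := by
  rwa [← show P = Q from funext fun e => propext (h e)]

theorem Pi1.congr {P Q : (Fin n → M) → Prop} (hP : Pi1 P) (h : ∀ e, P e ↔ Q e) : Pi1 Q := by
  rwa [← show P = Q from funext fun e => propext (h e)]

namespace Bdd

variable (P Q : (Fin n → M) → Prop) (s t : (Fin n → M) → M)

instance eq [hs : TermFn s] [ht : TermFn t] : Bdd (fun e => s e = t e) := by
  obtain ⟨u, hu⟩ := hs; obtain ⟨v, hv⟩ := ht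
  exact ⟨.eq u v, trivial, fun e => by simp [Formula.Sat, hu, hv]⟩
instance lt [hs : TermFn s] [ht : TermFn t] : Bdd (fun e => s e < t e) := by
  obtain ⟨u, hu⟩ := hs; obtain ⟨v, hv⟩ := ht
  exact ⟨.lt u v, trivial, fun e => by simp [Formula.Sat, hu, hv]⟩
instance mem (A : Set M) [hA : Fact (IsSet A)] [hs : TermFn s] : Bdd (fun e => s e ∈ A) := by
  obtain ⟨u, hu⟩ := hs
  exact ⟨.mem u ⟨A, hA.out⟩, trivial, fun e => by simp [Formula.Sat, hu]⟩
instance not [hP : Bdd P] : Bdd (fun e => ¬ P e) := by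
  obtain ⟨θ, hb, h⟩ := hP
  exact ⟨.not θ, hb, fun e => by simp [Formula.Sat, h]⟩
instance and [hP : Bdd P] [hQ : Bdd Q] : Bdd (fun e => P e ∧ Q e) := by
  obtain ⟨θ, hb, h⟩ := hP; obtain ⟨η, hc, k⟩ := hQ
  exact ⟨.and θ η, ⟨hb, hc⟩, fun e => by simp [Formula.Sat, h, k]⟩
instance or [hP : Bdd P] [hQ : Bdd Q] : Bdd (fun e => P e ∨ Q e) := by
  obtain ⟨θ, hb, h⟩ := hP; obtain ⟨η, hc, k⟩ := hQ
  exact ⟨.or θ η, ⟨hb, hc⟩, fun e => by simp [Formula.Sat, h, k]⟩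
instance imp [Bdd P] [Bdd Q] : Bdd (fun e => P e → Q e) :=
  (inferInstance : Bdd (fun e => ¬ P e ∨ Q e)).congr fun e => by tauto
instance ball (R : (Fin n → M) → M → Prop) [ht : TermFn t]
    [hR : Bdd (fun e : Fin (n + 1) → M => R (fun i => e i.succ) (e 0))] :
    Bdd (fun e => ∀ a, a < t e → R e a) := by
  obtain ⟨v, hv⟩ := ht; obtain ⟨θ, hb, h⟩ := hR
  exact ⟨.ballLt v θ, hb, fun e => by simp [Formula.Sat, h, hv]⟩
instance bex (R : (Fin n → M) → M → Prop) [ht : TermFn t]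
    [hR : Bdd (fun e : Fin (n + 1) → M => R (fun i => e i.succ) (e 0))] :
    Bdd (fun e => ∃ a, a < t e ∧ R e a) := by
  obtain ⟨v, hv⟩ := ht; obtain ⟨θ, hb, h⟩ := hR
  exact ⟨.bexLt v θ, hb, fun e => by simp [Formula.Sat, h, hv]⟩

end Bdd

theorem Sig.ex_bdd (R : (Fin n → M) → M → Prop)
    [hR : Bdd (fun e : Fin (n + 1) → M => R (fun i => e i.succ) (e 0))] :
    Sig (fun e => ∃ a, R e a) := ⟨_, hR, fun e => by simp⟩

instance (priority := 2000) Sig.of_bdd (P : (Fin n → M) → Prop) [hP : Bdd P] : Sig P :=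
  ⟨fun e => P (fun i => e i.succ), hP.subst _ fun i => inferInstance, fun e => by simp⟩

instance (priority := 2000) Pi1.of_bdd (P : (Fin n → M) → Prop) [hP : Bdd P] : Pi1 P :=
  ⟨inferInstance⟩

/-- `Σ⁰₁`-induction for a semantically given predicate. -/
theorem sigma_induction [hM : Fact (IsModelRCA0 M)] (P : M → Prop)
    [hP : Sig (fun e : Fin 1 → M => P (e 0))]
    (h0 : P 0) (hs : ∀ n, P n → P (n + 1)) (n : M) : P n := by
  obtain ⟨Q, ⟨θ, hb, h⟩, hQ⟩ := hP
  have key : ∀ n, P n ↔ ∃ k, θ.Sat ![k, n] := fun n => by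
    have := hQ ![n]
    simp only [Matrix.cons_val_fin_one] at this
    rw [this]; exact exists_congr fun k => (h _).symm
  simp only [key] at h0 hs ⊢
  exact hM.out.sigma_one_induction θ hb h0 hs n

end Definability

/-! ### Arithmetic -/

section Arithmetic

variable {M : Type*} [L2Structure M] [hM : Fact (IsModelRCA0 M)]

namespace Arith

theorem add_zero (a : M) : a + 0 = a := hM.out.add_zero a
theorem add_succ (a b : M) : a + (b + 1) = a + b + 1 := hM.out.add_succ a b
theorem mul_zero (a : M) : a * 0 = 0 := hM.out.mul_zero a
theorem mul_succ (a b : M) : a * (b + 1) = a * b + a := hM.out.mul_succ a b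

theorem zero_add (a : M) : 0 + a = a :=
  sigma_induction (fun a : M => 0 + a = a) (add_zero 0) (fun n h => by rw [add_succ, h]) a

theorem add_assoc (a b c : M) : a + b + c = a + (b + c) :=
  sigma_induction (fun c : M => a + b + c = a + (b + c)) (by simp only [add_zero])
    (fun n h => by simp only [add_succ, h]) c

theorem one_add (a : M) : 1 + a = a + 1 :=
  sigma_induction (fun a : M => 1 + a = a + 1) (by rw [add_zero, zero_add])
    (fun n h => by rw [add_succ, h]) a

theorem add_comm (a b : M) : a + b = b + a :=
  sigma_induction (fun b : M => a + b = b + a) (by rw [add_zero, zero_add])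
    (fun n h => by rw [add_succ, h, add_assoc n 1 a, one_add, add_succ]) b

theorem zero_mul (a : M) : 0 * a = 0 :=
  sigma_induction (fun a : M => 0 * a = 0) (mul_zero 0)
    (fun n h => by rw [mul_succ, h, add_zero]) a

theorem mul_add (a b c : M) : a * (b + c) = a * b + a * c :=
  sigma_induction (fun c : M => a * (b + c) = a * b + a * c) (by simp only [add_zero, mul_zero])
    (fun n h => by rw [add_succ, mul_succ, h, mul_succ, add_assoc]) c

theorem mul_assoc (a b c : M) : a * b * c = a * (b * c) :=
  sigma_induction (fun c : M => a * b * c = a * (b * c)) (by simp only [mul_zero])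
    (fun n h => by rw [mul_succ, mul_succ, mul_add, h]) c

theorem succ_mul (a b : M) : (a + 1) * b = a * b + b :=
  sigma_induction (fun b : M => (a + 1) * b = a * b + b) (by simp only [mul_zero, add_zero])
    (fun n h => by
      simp only [mul_succ, h, add_succ]
      rw [add_assoc (a * n) n a, add_assoc (a * n) a n, add_comm n a]) b

theorem mul_comm (a b : M) : a * b = b * a :=
  sigma_induction (fun b : M => a * b = b * a) (by rw [mul_zero, zero_mul])
    (fun n h => by rw [mul_succ, h, succ_mul]) b

theorem mul_one (a : M) : a * 1 = a := by
  rw [← zero_add (1 : M), mul_succ, mul_zero, zero_add]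

theorem add_right_cancel (a b c : M) : a + c = b + c → a = b :=
  sigma_induction (fun c : M => a + c = b + c → a = b) (by simp only [add_zero]; exact id)
    (fun n h h' => h (hM.out.succ_inj _ _ (by simpa only [add_succ] using h'))) c

theorem lt_add_succ (a c : M) : a < a + (c + 1) :=
  sigma_induction (fun c : M => a < a + (c + 1))
    (by rw [zero_add]; exact (hM.out.lt_succ _ _).2 (.inr rfl))
    (fun n h => by rw [add_succ]; exact (hM.out.lt_succ _ _).2 (.inl h)) c

theorem lt_iff (a b : M) : a < b ↔ ∃ c, b = a + (c + 1) := by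
  refine ⟨?_, fun ⟨c, hc⟩ => hc ▸ lt_add_succ a c⟩
  have h : ∃ c, a < b → b = a + (c + 1) := by
    have : Sig fun e : Fin 1 → M => ∃ c, a < e 0 → e 0 = a + (c + 1) := Sig.ex_bdd _
    refine sigma_induction (fun b : M => ∃ c, a < b → b = a + (c + 1))
      ⟨0, fun h => (hM.out.not_lt_zero _ h).elim⟩ (fun n ⟨c, hc⟩ => ?_) b
    rcases Classical.em (a < n) with h | h
    · exact ⟨c + 1, fun _ => (congrArg (· + 1) (hc h)).trans (add_succ a (c + 1)).symm⟩
    · exact ⟨0, fun h' => by rw [((hM.out.lt_succ _ _).1 h').resolve_left h, zero_add]⟩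
  exact fun hab => h.imp fun c hc => hc hab

theorem eq_zero_or_succ (a : M) : a = 0 ∨ ∃ b, a = b + 1 := by
  have h : ∃ b, a = 0 ∨ a = b + 1 := by
    have : Sig fun e : Fin 1 → M => ∃ b, e 0 = 0 ∨ e 0 = b + 1 := Sig.ex_bdd _
    exact sigma_induction (fun a : M => ∃ b, a = 0 ∨ a = b + 1) ⟨0, .inl rfl⟩
      (fun n _ => ⟨n, .inr rfl⟩) a
  obtain ⟨b, h | h⟩ := h
  exacts [.inl h, .inr ⟨b, h⟩]

theorem lt_irrefl (a : M) : ¬ a < a := by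
  rw [lt_iff]; rintro ⟨c, hc⟩
  refine hM.out.succ_ne_zero c (add_right_cancel _ _ a ?_)
  rw [zero_add, add_comm, ← hc]

theorem lt_trans (a b c : M) : a < b → b < c → a < c := by
  rw [lt_iff, lt_iff b c]; rintro ⟨x, rfl⟩ ⟨y, rfl⟩
  rw [add_assoc, add_succ]; exact lt_add_succ _ _

theorem trichotomy (a b : M) : a < b ∨ a = b ∨ b < a := by
  refine sigma_induction (fun b : M => a < b ∨ a = b ∨ b < a) ?_ (fun n h => ?_) b
  · rcases eq_zero_or_succ a with h | ⟨b, h⟩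
    · exact .inr (.inl h)
    · refine .inr (.inr ((lt_iff _ _).2 ⟨b, by rw [h, zero_add]⟩))
  · rcases h with h | h | h
    · exact .inl ((hM.out.lt_succ _ _).2 (.inl h))
    · exact .inl ((hM.out.lt_succ _ _).2 (.inr h))
    · obtain ⟨c, rfl⟩ := (lt_iff _ _).1 h
      rcases eq_zero_or_succ c with rfl | ⟨d, rfl⟩
      · rw [zero_add]; exact .inr (.inl rfl)
      · refine .inr (.inr ((lt_iff _ _).2 ⟨d, ?_⟩))
        simp only [add_succ]
        rw [add_assoc n 1, add_comm 1 d, add_succ]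

end Arith

instance : CommSemiring M where
  add_assoc := Arith.add_assoc
  zero_add := Arith.zero_add
  add_zero := Arith.add_zero
  add_comm := Arith.add_comm
  mul_assoc := Arith.mul_assoc
  one_mul a := by rw [Arith.mul_comm, Arith.mul_one]
  mul_one := Arith.mul_one
  mul_comm := Arith.mul_comm
  zero_mul := Arith.zero_mul
  mul_zero := Arith.mul_zero
  left_distrib := Arith.mul_add
  right_distrib a b c := by
    rw [Arith.mul_comm, Arith.mul_add, Arith.mul_comm c a, Arith.mul_comm c b]
  nsmul := nsmulRec
  npow := npowRec

noncomputable instance : LinearOrder M where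
  lt := (· < ·)
  le a b := a < b ∨ a = b
  le_refl a := .inr rfl
  le_trans a b c := by
    rintro (h | rfl) (h' | rfl)
    exacts [.inl (Arith.lt_trans _ _ _ h h'), .inl h, .inl h', .inr rfl]
  le_antisymm a b := by
    rintro (h | h) (h' | h')
    · exact (Arith.lt_irrefl _ (Arith.lt_trans _ _ _ h h')).elim
    all_goals simp_all
  lt_iff_le_not_ge a b := by
    constructor
    · refine fun h => ⟨.inl h, ?_⟩
      rintro (h' | rfl)
      exacts [Arith.lt_irrefl _ (Arith.lt_trans _ _ _ h h'), Arith.lt_irrefl _ h]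
    · rintro ⟨h | rfl, h'⟩
      exacts [h, (h' (.inr rfl)).elim]
  le_total a b := by
    rcases Arith.trichotomy a b with h | h | h
    exacts [.inl (.inl h), .inl (.inr h), .inr (.inl h)]
  toDecidableLE := Classical.decRel _

theorem le_iff_lt_or_eq' (a b : M) : a ≤ b ↔ a < b ∨ a = b := Iff.rfl

theorem lt_succ_iff {a b : M} : a < b + 1 ↔ a ≤ b := hM.out.lt_succ a b

theorem le_iff_exists_add' {a b : M} : a ≤ b ↔ ∃ c, b = a + c := by
  rw [← lt_succ_iff, Arith.lt_iff]
  refine exists_congr fun c => ?_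
  rw [← add_assoc]
  exact ⟨fun h => Arith.add_right_cancel _ _ _ h, fun h => by rw [h]⟩

instance : IsStrictOrderedRing M := by
  have hc : ∀ a b c : M, a + b ≤ a + c ↔ b ≤ c := fun a b c => by
    simp only [le_iff_exists_add', add_assoc]
    refine exists_congr fun d => ?_
    rw [add_comm a, add_comm a]
    exact ⟨fun h => Arith.add_right_cancel _ _ _ h, fun h => by rw [h]⟩
  have hpos : ∀ a b : M, a < b ↔ ∃ c, b = a + (c + 1) := Arith.lt_iff
  have hmul : ∀ a b c : M, 0 < a → b < c → a * b < a * c := by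
    intro a b c ha hb
    rw [hpos] at ha hb
    obtain ⟨x, rfl⟩ := ha; obtain ⟨y, rfl⟩ := hb
    rw [hpos]
    exact ⟨x * y + x + y, by ring⟩
  exact
  { add_le_add_left := fun a b h c => by rw [add_comm a, add_comm b]; exact (hc _ _ _).2 h
    le_of_add_le_add_left := fun a b c h => (hc _ _ _).1 h
    zero_le_one := by rw [le_iff_exists_add']; exact ⟨1, by ring⟩
    mul_lt_mul_of_pos_left := fun a ha b c h => hmul a b c ha h
    mul_lt_mul_of_pos_right := fun a ha b c h => by
      show b * a < c * a
      rw [mul_comm b, mul_comm c]; exact hmul a b c ha h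
    exists_pair_ne := ⟨0, 1, fun h => hM.out.succ_ne_zero 0 (by rw [zero_add, h])⟩ }

instance : CanonicallyOrderedAdd M where
  exists_add_of_le h := le_iff_exists_add'.1 h
  le_self_add _ b := le_iff_exists_add'.2 ⟨b, rfl⟩
  le_add_self _ b := le_iff_exists_add'.2 ⟨b, add_comm _ _⟩

instance : SuccOrder M where
  succ a := a + 1
  le_succ a := (lt_succ_iff.2 le_rfl).le
  max_of_succ_le {a} h := absurd (lt_succ_iff.2 (le_refl a)) (not_lt.2 h)
  succ_le_of_lt {a b} h := by
    rw [Arith.lt_iff] at h; obtain ⟨c, rfl⟩ := h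
    rw [le_iff_exists_add']; exact ⟨c, by ring⟩

instance : SuccAddOrder M := ⟨fun _ => rfl⟩

theorem pair_lt_of_add_lt {i j i' j' : M} (h : i + j < i' + j') : pair i j < pair i' j' := by
  unfold pair
  have h1 : i + j + 1 ≤ i' + j' := Order.add_one_le_iff.2 h
  have h2 : (i + j + 1) * (i + j + 1) ≤ (i' + j') * (i' + j') := by gcongr
  have h3 : (i + j) * (i + j) + i < (i + j + 1) * (i + j + 1) := by
    rw [show (i + j + 1) * (i + j + 1) = (i + j) * (i + j) + i + (i + j + j + 1) by ring]
    exact lt_add_of_pos_right _ (add_pos_of_nonneg_of_pos zero_le zero_lt_one)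
  exact (h3.trans_le h2).trans_le (self_le_add_right _ _)

theorem pair_inj {i j i' j' : M} : pair i j = pair i' j' ↔ i = i' ∧ j = j' := by
  refine ⟨fun h => ?_, fun ⟨h, h'⟩ => by rw [h, h']⟩
  rcases lt_trichotomy (i + j) (i' + j') with h1 | h1 | h1
  · exact ((pair_lt_of_add_lt h1).ne h).elim
  · unfold pair at h
    rw [h1] at h
    have h2 := add_left_cancel h
    subst h2
    exact ⟨rfl, add_left_cancel h1⟩
  · exact ((pair_lt_of_add_lt h1).ne' h).elim

theorem le_mul_self' (a : M) : a ≤ a * a := by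
  rcases eq_or_ne a 0 with rfl | h
  · simp
  · have : 1 ≤ a := Order.one_le_iff_pos.2 (pos_iff_ne_zero.2 h)
    simpa using mul_le_mul_right this a

theorem add_le_pair (i j : M) : i + j ≤ pair i j :=
  (le_mul_self' _).trans (self_le_add_right _ _)

theorem left_le_pair (i j : M) : i ≤ pair i j := (self_le_add_right _ _).trans (add_le_pair i j)

theorem right_le_pair (i j : M) : j ≤ pair i j := (self_le_add_left _ _).trans (add_le_pair i j)

end Arithmetic

/-! ### Closure properties of definable predicates and functions -/

section Closure

variable {M : Type*} [L2Structure M] [hM : Fact (IsModelRCA0 M)] {n : ℕ}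

omit hM in
theorem Bdd.subst_cons {m : ℕ} {R : (Fin n → M) → M → Prop}
    (hR : Bdd (fun e : Fin (n + 1) → M => R (fun i => e i.succ) (e 0)))
    (s : Fin n → (Fin m → M) → M) (u : (Fin m → M) → M) [hs : ∀ i, TermFn (s i)] [hu : TermFn u] :
    Bdd (fun e => R (fun i => s i e) (u e)) := by
  have := hR.subst (Fin.cons u s : Fin (n + 1) → (Fin m → M) → M)
    (by intro i; refine Fin.cases ?_ (fun j => ?_) i <;> simp [hu, hs])
  simpa using this

omit hM in
/-- The defining property of `Sig`, with the witness as a separate argument. -/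
theorem sig_iff {P : (Fin n → M) → Prop} : Sig P ↔ ∃ R : (Fin n → M) → M → Prop,
    Bdd (fun e : Fin (n + 1) → M => R (fun i => e i.succ) (e 0)) ∧ ∀ e, P e ↔ ∃ k, R e k := by
  constructor
  · rintro ⟨Q, hQ, h⟩
    refine ⟨fun e k => Q (Fin.cons k e), ?_, h⟩
    refine hQ.congr fun e => ?_
    show Q e ↔ Q (Fin.cons (e 0) fun i => e i.succ)
    rw [show (Fin.cons (e 0) fun i => e i.succ) = e from Fin.cons_self_tail e]
  · rintro ⟨R, hR, h⟩
    exact (Sig.ex_bdd R).congr fun e => (h e).symm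

omit hM in
theorem Sig.subst {m : ℕ} {P : (Fin n → M) → Prop} (hP : Sig P) (t : Fin n → (Fin m → M) → M)
    [ht : ∀ i, TermFn (t i)] : Sig (fun e => P (fun i => t i e)) := by
  obtain ⟨R, hR, h⟩ := sig_iff.1 hP
  refine sig_iff.2 ⟨fun e k => R (fun i => t i e) k, ?_, fun e => h _⟩
  have : ∀ i, TermFn (fun e : Fin (m + 1) → M => t i (fun j => e j.succ)) := fun i => by
    obtain ⟨s, hs⟩ := ht i
    obtain ⟨u, hu⟩ := s.exists_subst (fun j : Fin m => NumTerm.var j.succ)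
    exact ⟨u, fun e => by rw [hu, hs]; rfl⟩
  exact hR.subst_cons (fun i e => t i (fun j => e j.succ)) (fun e => e 0)

omit hM in
theorem Sig.subst_cons {m : ℕ} {R : (Fin n → M) → M → Prop}
    (hR : Sig (fun e : Fin (n + 1) → M => R (fun i => e i.succ) (e 0)))
    (s : Fin n → (Fin m → M) → M) (u : (Fin m → M) → M) [hs : ∀ i, TermFn (s i)] [hu : TermFn u] :
    Sig (fun e => R (fun i => s i e) (u e)) := by
  have : ∀ i, TermFn ((Fin.cons u s : Fin (n + 1) → (Fin m → M) → M) i) := by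
    intro i; refine Fin.cases ?_ (fun j => ?_) i <;> simp [hu, hs]
  simpa using hR.subst (Fin.cons u s : Fin (n + 1) → (Fin m → M) → M)

namespace Sig

variable (P Q : (Fin n → M) → Prop) (s t : (Fin n → M) → M) (R : (Fin n → M) → M → Prop)

instance and [hP : Sig P] [hQ : Sig Q] : Sig (fun e => P e ∧ Q e) := by
  obtain ⟨R, hR, h⟩ := sig_iff.1 hP
  obtain ⟨S, hS, k⟩ := sig_iff.1 hQ
  have hR' := hR.subst_cons (m := n + 2) (fun i e => e i.succ.succ) (fun e => e 0)
  have hS' := hS.subst_cons (m := n + 2) (fun i e => e i.succ.succ) (fun e => e 0)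
  refine (Sig.ex_bdd (fun e K => (∃ k, k < K ∧ R e k) ∧ (∃ k, k < K ∧ S e k))).congr fun e => ?_
  rw [h, k]
  constructor
  · rintro ⟨K, ⟨a, -, ha⟩, ⟨b, -, hb⟩⟩
    exact ⟨⟨a, ha⟩, ⟨b, hb⟩⟩
  · rintro ⟨⟨a, ha⟩, ⟨b, hb⟩⟩
    exact ⟨a + b + 1, ⟨a, lt_succ_iff.2 (self_le_add_right _ _), ha⟩,
      ⟨b, lt_succ_iff.2 (self_le_add_left _ _), hb⟩⟩

instance or [hP : Sig P] [hQ : Sig Q] : Sig (fun e => P e ∨ Q e) := by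
  obtain ⟨R, hR, h⟩ := sig_iff.1 hP
  obtain ⟨S, hS, k⟩ := sig_iff.1 hQ
  refine (Sig.ex_bdd (fun e K => R e K ∨ S e K)).congr fun e => ?_
  rw [h, k, exists_or]

instance ex [hR : Sig (fun e : Fin (n + 1) → M => R (fun i => e i.succ) (e 0))] :
    Sig (fun e => ∃ a, R e a) := by
  obtain ⟨S, hS, h⟩ := sig_iff.1 hR
  have hS' := hS.subst_cons (m := n + 3) (Fin.cons (fun e => e 1) (fun i e => e i.succ.succ.succ))
    (fun e => e 0)
    (hs := by intro i; refine Fin.cases ?_ (fun j => ?_) i <;> simp <;> infer_instance)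
  have h' : ∀ e a, R e a ↔ ∃ k, S (Fin.cons a e) k := fun e a => by
    have := h (Fin.cons a e)
    simpa using this
  refine (sig_iff.2 ⟨fun e K => ∃ a, a < K ∧ ∃ k, k < K ∧ S (Fin.cons a e) k, ?_, fun e => Iff.rfl⟩
    ).congr fun e => ?_
  · have : Bdd fun e : Fin (n + 3) → M =>
        S (Fin.cons (e (Fin.succ 0)) (fun i => e i.succ.succ.succ)) (e 0) := by
      refine hS'.congr fun e => ?_
      rw [show (fun i => (Fin.cons (fun e => e 1) (fun i e => e i.succ.succ.succ) :
        Fin (n + 1) → (Fin (n + 3) → M) → M) i e) =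
          (Fin.cons (e (Fin.succ 0)) (fun i => e i.succ.succ.succ)) from ?_]
      funext i
      refine Fin.cases rfl (fun j => rfl) i
    infer_instance
  · simp only [h']
    constructor
    · rintro ⟨K, a, -, k, -, ha⟩
      exact ⟨a, k, ha⟩
    · rintro ⟨a, k, ha⟩
      exact ⟨a + k + 1, a, lt_succ_iff.2 (self_le_add_right _ _), k,
        lt_succ_iff.2 (self_le_add_left _ _), ha⟩

theorem ball_term [ht : TermFn t]
    [hR : Sig (fun e : Fin (n + 1) → M => R (fun i => e i.succ) (e 0))] :
    Sig (fun e => ∀ a, a < t e → R e a) := by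
  obtain ⟨S, hS, h⟩ := sig_iff.1 hR
  have h' : ∀ e a, R e a ↔ ∃ k, S (Fin.cons a e) k := fun e a => by
    have := h (Fin.cons a e)
    simpa using this
  have hS' {m : ℕ} (s : Fin n → (Fin m → M) → M) (a k : (Fin m → M) → M) [hs : ∀ i, TermFn (s i)]
      [hu : TermFn a] [TermFn k] :
      Bdd fun e : Fin m → M => S (Fin.cons (a e) (fun i => s i e)) (k e) := by
    have := hS.subst_cons (m := m) (Fin.cons a s) k
      (hs := by intro i; refine Fin.cases ?_ (fun j => ?_) i <;> simp <;> infer_instance)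
    refine this.congr fun e => ?_
    rw [show (fun i => (Fin.cons a s : Fin (n + 1) → (Fin m → M) → M) i e) =
          (Fin.cons (a e) (fun i => s i e)) from ?_]
    funext i
    refine Fin.cases rfl (fun j => rfl) i
  have ht' : TermFn (fun e : Fin (n + 1) → M => t (fun i => e i.succ)) := by
    obtain ⟨s, hs⟩ := ht
    obtain ⟨u, hu⟩ := s.exists_subst (fun j : Fin n => NumTerm.var j.succ)
    exact ⟨u, fun e => by rw [hu, hs]; rfl⟩
  have b1 : Bdd fun e : Fin (n + 3) → M =>
        S (Fin.cons (e (Fin.succ 0)) (fun i => e i.succ.succ.succ)) (e 0) := hS' _ _ _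
  refine (sig_iff.2 ⟨fun e K => ∀ a, a < t e → ∃ k, k < K ∧ S (Fin.cons a e) k, inferInstance,
    fun e => Iff.rfl⟩).congr fun e => ?_
  simp only [h']
  refine ⟨fun ⟨K, hK⟩ a ha => (hK a ha).imp fun k hk => hk.2, fun hall => ?_⟩
  have b2 : Bdd fun e' : Fin 4 → M => S (Fin.cons (e' (Fin.succ 0)) e) (e' 0) :=
    hS' (fun i _ => e i) _ _
  have b3 : Sig fun e' : Fin 1 → M => ∃ K, ∀ a, a < e' 0 → a < t e → ∃ k, k < K ∧
      S (Fin.cons a e) k := Sig.ex_bdd _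
  have := sigma_induction (fun j => ∃ K, ∀ a, a < j → a < t e → ∃ k, k < K ∧ S (Fin.cons a e) k)
    ⟨0, fun a ha => (not_lt_zero ha).elim⟩ (fun j ⟨K, hK⟩ => ?_) (t e)
  · exact this.imp fun K hK a ha => hK a ha ha
  · by_cases hj : j < t e
    · obtain ⟨k, hk⟩ := hall j hj
      refine ⟨K + k + 1, fun a ha hat => ?_⟩
      rcases (lt_succ_iff.1 ha).lt_or_eq with h1 | rfl
      · obtain ⟨k', h2, h3⟩ := hK a h1 hat
        exact ⟨k', h2.trans (lt_succ_iff.2 (self_le_add_right _ _)), h3⟩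
      · exact ⟨k, lt_succ_iff.2 (self_le_add_left _ _), hk⟩
    · refine ⟨K, fun a ha hat => ?_⟩
      rcases (lt_succ_iff.1 ha).lt_or_eq with h1 | rfl
      · exact hK a h1 hat
      · exact (hj hat).elim

end Sig

instance (priority := 2000) Fn.of_termFn (t : (Fin n → M) → M) [ht : TermFn t] : Fn t := by
  have : TermFn (fun e : Fin (n + 1) → M => t (fun i => e i.succ)) := by
    obtain ⟨s, hs⟩ := ht
    obtain ⟨u, hu⟩ := s.exists_subst (fun j : Fin n => NumTerm.var j.succ)
    exact ⟨u, fun e => by rw [hu, hs]; rfl⟩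
  exact ⟨inferInstance⟩

namespace Sig

variable (P Q : (Fin n → M) → Prop) (s t u v : (Fin n → M) → M) (R : (Fin n → M) → M → Prop)

theorem comp1 (P : M → Prop) [hP : Sig (fun e : Fin 1 → M => P (e 0))] [ht : Fn t] :
    Sig (fun e => P (t e)) := by
  have h1 := ht.out
  have h2 : Sig (fun e : Fin (n + 1) → M => P (e 0)) := hP.subst (fun _ e => e 0)
  exact (inferInstance : Sig fun e => ∃ y, y = t e ∧ P y).congr fun e => by simp

theorem comp2 (P : M → M → Prop) [hP : Sig (fun e : Fin 2 → M => P (e 0) (e 1))] [hs : Fn s]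
    [ht : Fn t] : Sig (fun e => P (s e) (t e)) := by
  have h1 := hs.out
  have h2 : Sig fun e : Fin (n + 2) → M => e 0 = t (fun i => e i.succ.succ) :=
    ht.out.subst_cons (R := fun e a => a = t e) (m := n + 2) (fun i e => e i.succ.succ)
      (fun e => e 0)
  have h3 : Sig (fun e : Fin (n + 2) → M => P (e (Fin.succ 0)) (e 0)) :=
    hP.subst (fun i e => if i = 0 then e (Fin.succ 0) else e 0) (ht := by
      intro i; by_cases h : i = 0 <;> simp only [h, if_true, if_false] <;> infer_instance)
  exact (inferInstance : Sig fun e => ∃ y, y = s e ∧ ∃ z, z = t e ∧ P y z).congr fun e => by simp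

instance eq [Fn s] [Fn t] : Sig (fun e => s e = t e) := comp2 s t (· = ·)
instance lt [Fn s] [Fn t] : Sig (fun e => s e < t e) := comp2 s t (· < ·)
instance not_lt [Fn s] [Fn t] : Sig (fun e => ¬ s e < t e) := comp2 s t (¬ · < ·)
instance le [Fn s] [Fn t] : Sig (fun e => s e ≤ t e) :=
  (inferInstance : Sig fun e => ¬ t e < s e).congr fun e => by simp
instance mem (A : Set M) [Fact (IsSet A)] [Fn t] : Sig (fun e => t e ∈ A) := comp1 t (· ∈ A)
instance not [hP : Pi1 P] : Sig (fun e => ¬ P e) := hP.out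

instance ball [ht : Fn t] [hR : Sig (fun e : Fin (n + 1) → M => R (fun i => e i.succ) (e 0))] :
    Sig (fun e => ∀ a, a < t e → R e a) := by
  have h1 := ht.out
  have h2 : Sig (fun e : Fin (n + 2) → M => R (fun i => e i.succ.succ) (e 0)) :=
    hR.subst_cons (m := n + 2) (fun i e => e i.succ.succ) (fun e => e 0)
  have h3 : Sig (fun e : Fin (n + 1) → M => ∀ a, a < e 0 → R (fun i => e i.succ) a) :=
    ball_term (n := n + 1) (fun e => e 0) (fun e a => R (fun i => e i.succ) a)
  exact (inferInstance : Sig fun e => ∃ y, y = t e ∧ ∀ a, a < y → R e a).congr fun e => by simp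

end Sig

namespace Pi1

variable (P Q : (Fin n → M) → Prop) (s t u v : (Fin n → M) → M) (R : (Fin n → M) → M → Prop)

theorem comp1 (P : M → Prop) [hP : Pi1 (fun e : Fin 1 → M => P (e 0))] [ht : Fn t] :
    Pi1 (fun e => P (t e)) := ⟨Sig.comp1 t (fun x => ¬ P x) (hP := hP.out)⟩

theorem comp2 (P : M → M → Prop) [hP : Pi1 (fun e : Fin 2 → M => P (e 0) (e 1))] [hs : Fn s]
    [ht : Fn t] : Pi1 (fun e => P (s e) (t e)) :=
  ⟨Sig.comp2 s t (fun x y => ¬ P x y) (hP := hP.out)⟩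

instance eq [Fn s] [Fn t] : Pi1 (fun e => s e = t e) := comp2 s t (· = ·)
instance lt [Fn s] [Fn t] : Pi1 (fun e => s e < t e) := comp2 s t (· < ·)
instance mem (A : Set M) [Fact (IsSet A)] [Fn t] : Pi1 (fun e => t e ∈ A) := comp1 t (· ∈ A)
instance not [hP : Sig P] : Pi1 (fun e => ¬ P e) := ⟨hP.congr fun e => by simp⟩
instance and [hP : Pi1 P] [hQ : Pi1 Q] : Pi1 (fun e => P e ∧ Q e) :=
  have := hP.out; have := hQ.out
  ⟨(inferInstance : Sig fun e => ¬ P e ∨ ¬ Q e).congr fun e => by tauto⟩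
instance or [hP : Pi1 P] [hQ : Pi1 Q] : Pi1 (fun e => P e ∨ Q e) :=
  have := hP.out; have := hQ.out
  ⟨(inferInstance : Sig fun e => ¬ P e ∧ ¬ Q e).congr fun e => by tauto⟩
instance imp [hP : Sig P] [hQ : Pi1 Q] : Pi1 (fun e => P e → Q e) :=
  have := hQ.out
  ⟨(inferInstance : Sig fun e => P e ∧ ¬ Q e).congr fun e => by tauto⟩
instance iff [Sig P] [Pi1 P] [Sig Q] [Pi1 Q] : Pi1 (fun e => P e ↔ Q e) :=
  (inferInstance : Pi1 (fun e => (P e → Q e) ∧ (Q e → P e))).congr fun e => by tauto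
instance all [hR : Pi1 (fun e : Fin (n + 1) → M => R (fun i => e i.succ) (e 0))] :
    Pi1 (fun e => ∀ a, R e a) :=
  have := hR.out
  ⟨(inferInstance : Sig fun e => ∃ a, ¬ R e a).congr fun e => by simp⟩
instance bex [ht : Fn t] [hR : Pi1 (fun e : Fin (n + 1) → M => R (fun i => e i.succ) (e 0))] :
    Pi1 (fun e => ∃ a, a < t e ∧ R e a) :=
  have := hR.out
  ⟨(inferInstance : Sig fun e => ∀ a, a < t e → ¬ R e a).congr fun e => by simp⟩

end Pi1

instance Sig.imp (P Q : (Fin n → M) → Prop) [hP : Pi1 P] [hQ : Sig Q] : Sig (fun e => P e → Q e) :=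
  have := hP.out
  (inferInstance : Sig fun e => ¬ P e ∨ Q e).congr fun e => by tauto
instance Sig.iff (P Q : (Fin n → M) → Prop) [Sig P] [Pi1 P] [Sig Q] [Pi1 Q] :
    Sig (fun e => P e ↔ Q e) :=
  (inferInstance : Sig (fun e => (P e → Q e) ∧ (Q e → P e))).congr fun e => by tauto

namespace Fn

variable (s t : (Fin n → M) → M)

omit hM in
theorem subst {m : ℕ} {f : (Fin n → M) → M} (hf : Fn f) (t : Fin n → (Fin m → M) → M)
    [ht : ∀ i, TermFn (t i)] : Fn (fun e => f (fun i => t i e)) := by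
  have : ∀ i, TermFn (fun e : Fin (m + 1) → M => t i (fun j => e j.succ)) := fun i => by
    obtain ⟨s, hs⟩ := ht i
    obtain ⟨u, hu⟩ := s.exists_subst (fun j : Fin m => NumTerm.var j.succ)
    exact ⟨u, fun e => by rw [hu, hs]; rfl⟩
  exact ⟨hf.out.subst_cons (R := fun e a => a = f e) (fun i e => t i (fun j => e j.succ))
    (fun e => e 0)⟩

theorem comp1 (f : M → M) [hf : Fn (fun e : Fin 1 → M => f (e 0))] [ht : Fn t] :
    Fn (fun e => f (t e)) := by
  refine ⟨?_⟩
  have h1 : Fn fun e : Fin (n + 1) → M => t (fun i => e i.succ) := ht.subst _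
  have h2 : Sig fun e : Fin 2 → M => e 0 = f (e 1) := hf.out
  exact Sig.comp2 _ _ (fun x y => x = f y)

theorem comp2 (f : M → M → M) [hf : Fn (fun e : Fin 2 → M => f (e 0) (e 1))] [hs : Fn s]
    [ht : Fn t] : Fn (fun e => f (s e) (t e)) := by
  refine ⟨?_⟩
  have h1 : Fn fun e : Fin (n + 3) → M => t (fun i => e i.succ.succ.succ) := ht.subst _
  have h1' : Fn fun e : Fin (n + 2) → M => s (fun i => e i.succ.succ) := hs.subst _
  have h3 (i : Fin (n + 3)) : Sig fun e : Fin (n + 3) → M => e i = f (e (Fin.succ 0)) (e 0) :=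
    hf.out.subst
      (Fin.cons (fun e => e i) fun j e => if j = 0 then e (Fin.succ 0) else e 0) (ht := by
      intro i; refine Fin.cases ?_ (fun j => ?_) i
      · simp only [Fin.cons_zero]; infer_instance
      · by_cases h : j = 0 <;> simp only [Fin.cons_succ, h, if_true, if_false] <;> infer_instance)
  exact (inferInstance : Sig fun e : Fin (n + 1) → M => ∃ y, y = s (fun i => e i.succ) ∧
    ∃ z, z = t (fun i => e i.succ) ∧ e 0 = f y z).congr fun e => by simp

instance add [Fn s] [Fn t] : Fn (fun e => s e + t e) := comp2 s t (· + ·)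
instance pair [Fn s] [Fn t] : Fn (fun e => SOA.pair (s e) (t e)) := comp2 s t SOA.pair

end Fn

theorem Sig.comp3 (s t u : (Fin n → M) → M) (P : M → M → M → Prop)
    [hP : Sig (fun e : Fin 3 → M => P (e 0) (e 1) (e 2))] [hs : Fn s]
    [ht : Fn t] [hu : Fn u] : Sig (fun e => P (s e) (t e) (u e)) := by
  have h2 : Fn fun e : Fin (n + 2) → M => t (fun i => e i.succ.succ) := ht.subst _
  have h3 : Fn fun e : Fin (n + 3) → M => u (fun i => e i.succ.succ.succ) := hu.subst _
  have h1 := hs.out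
  have h3 : Sig (fun e : Fin (n + 3) → M => P (e (Fin.succ (Fin.succ 0))) (e (Fin.succ 0)) (e 0)) :=
    hP.subst ![fun e => e (Fin.succ (Fin.succ 0)), fun e => e (Fin.succ 0), fun e => e 0] (ht := by
      intro i; fin_cases i <;> simp <;> infer_instance)
  exact (inferInstance : Sig fun e => ∃ y, y = s e ∧ ∃ z, z = t e ∧ ∃ w, w = u e ∧ P y z w).congr
    fun e => by simp

theorem Pi1.comp3 (s t u : (Fin n → M) → M) (P : M → M → M → Prop)
    [hP : Pi1 (fun e : Fin 3 → M => P (e 0) (e 1) (e 2))] [hs : Fn s]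
    [ht : Fn t] [hu : Fn u] : Pi1 (fun e => P (s e) (t e) (u e)) :=
  ⟨Sig.comp3 s t u (fun x y z => ¬ P x y z) (hP := hP.out)⟩

/-! The next lemmas turn a definability hypothesis into one that instance resolution can use in
every context. -/

theorem Sig.at1 {P : M → Prop} (hP : Sig (fun e : Fin 1 → M => P (e 0))) (m : ℕ)
    (s : (Fin m → M) → M) [Fn s] : Sig (fun e => P (s e)) := Sig.comp1 s P

theorem Sig.at2 {P : M → M → Prop} (hP : Sig (fun e : Fin 2 → M => P (e 0) (e 1))) (m : ℕ)
    (s t : (Fin m → M) → M) [Fn s] [Fn t] : Sig (fun e => P (s e) (t e)) := Sig.comp2 s t P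

theorem Sig.at3 {P : M → M → M → Prop} (hP : Sig (fun e : Fin 3 → M => P (e 0) (e 1) (e 2)))
    (m : ℕ) (s t u : (Fin m → M) → M) [Fn s] [Fn t] [Fn u] :
    Sig (fun e => P (s e) (t e) (u e)) := Sig.comp3 s t u P

theorem Pi1.at1 {P : M → Prop} (hP : Pi1 (fun e : Fin 1 → M => P (e 0))) (m : ℕ)
    (s : (Fin m → M) → M) [Fn s] : Pi1 (fun e => P (s e)) := Pi1.comp1 s P

theorem Pi1.at2 {P : M → M → Prop} (hP : Pi1 (fun e : Fin 2 → M => P (e 0) (e 1))) (m : ℕ)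
    (s t : (Fin m → M) → M) [Fn s] [Fn t] : Pi1 (fun e => P (s e) (t e)) := Pi1.comp2 s t P

theorem Pi1.at3 {P : M → M → M → Prop} (hP : Pi1 (fun e : Fin 3 → M => P (e 0) (e 1) (e 2)))
    (m : ℕ) (s t u : (Fin m → M) → M) [Fn s] [Fn t] [Fn u] :
    Pi1 (fun e => P (s e) (t e) (u e)) := Pi1.comp3 s t u P

theorem Fn.at1 {f : M → M} (hf : Fn (fun e : Fin 1 → M => f (e 0))) (m : ℕ)
    (s : (Fin m → M) → M) [Fn s] : Fn (fun e => f (s e)) := Fn.comp1 s f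

/-- `Δ⁰₁`-comprehension for a semantically given predicate. -/
theorem isSet_of_delta (P : M → Prop) [hS : Sig (fun e : Fin 1 → M => P (e 0))]
    [hP : Pi1 (fun e : Fin 1 → M => P (e 0))] : IsSet {x | P x} := by
  obtain ⟨Q, ⟨θ, hb, h⟩, hQ⟩ := hS
  obtain ⟨Q', ⟨η, hc, k⟩, hQ'⟩ := hP.out
  have key : ∀ n, P n ↔ ∃ k, θ.Sat ![k, n] := fun n => by
    have := hQ ![n]
    simp only [Matrix.cons_val_fin_one] at this
    rw [this]; exact exists_congr fun k => (h _).symm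
  have key' : ∀ n, ¬ P n ↔ ∃ k, η.Sat ![k, n] := fun n => by
    have := hQ' ![n]
    simp only [Matrix.cons_val_fin_one] at this
    rw [this]; exact exists_congr fun l => (k _).symm
  have := hM.out.delta_one_comprehension θ (.not η) hb hc fun n => by
    rw [← key, ← not_iff_not, key']; simp [Formula.Sat]
  simpa only [← key] using this

theorem pi_induction (P : M → Prop) [hP : Pi1 (fun e : Fin 1 → M => P (e 0))]
    (h0 : P 0) (hs : ∀ n, P n → P (n + 1)) (n : M) : P n := by
  by_contra hn
  have : Sig fun e : Fin 1 → M => ∃ m, e 0 + m = n ∧ ¬ P m := by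
    have := hP.at1
    infer_instance
  have := sigma_induction (fun k => k ≤ n → ∃ m, k + m = n ∧ ¬ P m) (fun _ => ⟨n, by simp, hn⟩)
    (fun k ih hk => ?_) n le_rfl
  · obtain ⟨m, hm, h⟩ := this
    have : m = 0 := by simpa using hm
    exact h (this ▸ h0)
  · obtain ⟨m, hm, h⟩ := ih ((lt_succ_iff.2 le_rfl).le.trans hk)
    rcases Arith.eq_zero_or_succ m with rfl | ⟨m, rfl⟩
    · exact (h h0).elim
    · exact ⟨m, by rw [← hm]; ring, fun h' => h (hs _ h')⟩

/-- The least number principle for `Σ⁰₁`-predicates. -/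
theorem exists_least (P : M → Prop) [hP : Sig (fun e : Fin 1 → M => P (e 0))]
    {a : M} (ha : P a) : ∃ m, P m ∧ ∀ k, k < m → ¬ P k := by
  by_contra hcon
  push Not at hcon
  have h1 := hP.at1
  have : ∀ n, ∀ k, k < n → ¬ P k := pi_induction (fun n => ∀ k, k < n → ¬ P k)
    (fun k hk => (not_lt_zero hk).elim) (fun n ih k hk hPk => by
      obtain ⟨j, hj, hPj⟩ := hcon k hPk
      exact ih j (hj.trans_le (lt_succ_iff.1 hk)) hPj)
  exact this (a + 1) a (lt_succ_iff.2 le_rfl) ha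

theorem exists_least_pi (P : M → Prop) [hP : Pi1 (fun e : Fin 1 → M => P (e 0))]
    {a : M} (ha : P a) : ∃ m, P m ∧ ∀ k, k < m → ¬ P k := by
  by_contra hcon
  push Not at hcon
  have h1 := hP.at1
  have : ∀ n, ∀ k, k < n → ¬ P k := sigma_induction (fun n => ∀ k, k < n → ¬ P k)
    (fun k hk => (not_lt_zero hk).elim) (fun n ih k hk hPk => by
      obtain ⟨j, hj, hPj⟩ := hcon k hPk
      exact ih j (hj.trans_le (lt_succ_iff.1 hk)) hPj)
  exact this (a + 1) a (lt_succ_iff.2 le_rfl) ha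

end Closure

/-! ### Finite sets and finite functions -/

section Codes

variable {M : Type*} [L2Structure M] [hM : Fact (IsModelRCA0 M)] {n : ℕ}

theorem lt_succ_self' (a : M) : a < a + 1 := lt_succ_iff.2 le_rfl

theorem inCode_iff (i c : M) : InCode i c ↔ ∃ k, k < c + 1 ∧ ∃ m, m < c + 1 ∧ ∃ n, n < c + 1 ∧
    c = pair (pair k m) n ∧ i < k ∧ ∃ q, q < c + 1 ∧ n = (m * (i + 1) + 1) * q := by
  constructor
  · rintro ⟨k, m, n, hc, hi, q, hq⟩
    have h1 : n ≤ c := hc ▸ right_le_pair _ _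
    have h2 : pair k m ≤ c := hc ▸ left_le_pair _ _
    refine ⟨k, lt_succ_iff.2 ((left_le_pair _ _).trans h2), m,
      lt_succ_iff.2 ((right_le_pair _ _).trans h2), n, lt_succ_iff.2 h1, hc, hi, q,
      lt_succ_iff.2 (le_trans ?_ h1), hq⟩
    rw [hq, add_mul, one_mul]
    exact self_le_add_left _ _
  · rintro ⟨k, -, m, -, n, -, hc, hi, q, -, hq⟩
    exact ⟨k, m, n, hc, hi, q, hq⟩

theorem InCode.lt {i c : M} (h : InCode i c) : i < c := by
  obtain ⟨k, m, n, rfl, hi, -⟩ := h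
  exact hi.trans_le ((left_le_pair _ _).trans (left_le_pair _ _))

section
variable (s t u : (Fin n → M) → M) (R : (Fin n → M) → M → Prop)
  (R₂ : (Fin n → M) → M → M → Prop) [ht : Fn t] [hs : Fn s] [hu : Fn u]

instance Sig.inCode : Sig (fun e => InCode (s e) (t e)) :=
  have : Sig (fun e : Fin 2 → M => InCode (e 0) (e 1)) :=
    Sig.congr inferInstance fun e => (inCode_iff (e 0) (e 1)).symm
  Sig.comp2 s t InCode

instance Pi1.inCode : Pi1 (fun e => InCode (s e) (t e)) :=
  have : Pi1 (fun e : Fin 2 → M => InCode (e 0) (e 1)) :=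
    Pi1.congr inferInstance fun e => (inCode_iff (e 0) (e 1)).symm
  Pi1.comp2 s t InCode

instance Sig.ball_code [Sig (fun e : Fin (n + 1) → M => R (fun i => e i.succ) (e 0))] :
    Sig (fun e => ∀ i, InCode i (t e) → R e i) :=
  have : Fn fun e : Fin (n + 1) → M => t (fun i => e i.succ) := ht.subst _
  Sig.congr (inferInstance : Sig fun e => ∀ i, i < t e → InCode i (t e) → R e i) fun _ =>
    ⟨fun h i hi => h i hi.lt hi, fun h i _ hi => h i hi⟩

instance Pi1.ex_pair
    [Pi1 (fun e : Fin (n + 2) → M => R₂ (fun i => e i.succ.succ) (e (Fin.succ 0)) (e 0))] :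
    Pi1 (fun e => ∃ i j, t e = SOA.pair i j ∧ R₂ e i j) :=
  have : Fn fun e : Fin (n + 1) → M => t (fun i => e i.succ) := ht.subst _
  have : Fn fun e : Fin (n + 2) → M => t (fun i => e i.succ.succ) := ht.subst _
  Pi1.congr (inferInstance : Pi1 fun e => ∃ i, i < t e + 1 ∧ ∃ j, j < t e + 1 ∧
      t e = SOA.pair i j ∧ R₂ e i j) fun _ =>
    ⟨fun ⟨i, _, j, _, h⟩ => ⟨i, j, h⟩, fun ⟨i, j, h⟩ => ⟨i, lt_succ_iff.2 (h.1 ▸ left_le_pair _ _),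
      j, lt_succ_iff.2 (h.1 ▸ right_le_pair _ _), h⟩⟩

theorem FinApp.lt {f i j : M} (h : FinApp f i j) : i < f ∧ j < f :=
  ⟨(left_le_pair _ _).trans_lt (InCode.lt h), (right_le_pair _ _).trans_lt (InCode.lt h)⟩

instance Sig.finApp : Sig (fun e => FinApp (s e) (t e) (u e)) := by unfold FinApp; infer_instance

instance Pi1.finApp : Pi1 (fun e => FinApp (s e) (t e) (u e)) := by unfold FinApp; infer_instance

instance Sig.ball_finApp
    [Sig (fun e : Fin (n + 2) → M => R₂ (fun i => e i.succ.succ) (e (Fin.succ 0)) (e 0))] :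
    Sig (fun e => ∀ i j, FinApp (t e) i j → R₂ e i j) :=
  have : Fn fun e : Fin (n + 1) → M => t (fun i => e i.succ) := ht.subst _
  have : Fn fun e : Fin (n + 2) → M => t (fun i => e i.succ.succ) := ht.subst _
  Sig.congr (inferInstance : Sig fun e => ∀ i, i < t e → ∀ j, j < t e → FinApp (t e) i j → R₂ e i j)
    fun _ => ⟨fun h i j hi => h i hi.lt.1 j hi.lt.2 hi, fun h i _ j _ hi => h i j hi⟩

instance Sig.ball_finApp_right
    [Sig (fun e : Fin (n + 1) → M => R (fun i => e i.succ) (e 0))] :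
    Sig (fun e => ∀ j, FinApp (t e) (s e) j → R e j) :=
  have : Fn fun e : Fin (n + 1) → M => t (fun i => e i.succ) := ht.subst _
  have : Fn fun e : Fin (n + 1) → M => s (fun i => e i.succ) := hs.subst _
  Sig.congr (inferInstance : Sig fun e => ∀ j, j < t e → FinApp (t e) (s e) j → R e j)
    fun _ => ⟨fun h j hi => h j hi.lt.2 hi, fun h j _ hi => h j hi⟩

instance Sig.isFinSet : Sig (fun e => IsFinSet (t e)) :=
  have : Sig (fun e : Fin 1 → M => IsFinSet (e 0)) := by unfold IsFinSet; infer_instance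
  Sig.comp1 t IsFinSet

end

theorem dvd_of_dvd_add {a x y : M} (h : a ∣ x + y) (hx : a ∣ x) : a ∣ y := by
  obtain ⟨u, hu⟩ := h; obtain ⟨v, rfl⟩ := hx
  rcases eq_or_ne a 0 with rfl | ha
  · simp at hu; simp [hu]
  rcases le_total v u with h | h
  · obtain ⟨w, rfl⟩ := le_iff_exists_add'.1 h
    rw [mul_add] at hu
    exact ⟨w, add_left_cancel hu⟩
  · obtain ⟨w, rfl⟩ := le_iff_exists_add'.1 h
    rw [mul_add, add_assoc] at hu
    have : a * w + y = 0 := by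
      have : a * u + (a * w + y) = a * u + 0 := by rw [hu, add_zero]
      exact add_left_cancel this
    rw [add_eq_zero] at this
    simp [this.2]

theorem dvd_of_dvd_mul {m i x : M} (h : m * (i + 1) + 1 ∣ x * m) : m * (i + 1) + 1 ∣ x := by
  refine dvd_of_dvd_add (x := x * m * (i + 1)) ?_ (h.mul_right _)
  exact ⟨x, by ring⟩

/-- The moduli `m · (i + 1) + 1` are pairwise coprime when `m` is divisible by all differences
of the indices. -/
theorem dvd_of_dvd_mul_modulus {m i j n d : M} (hd : d ∣ m) (hij : j = i + d ∨ i = j + d)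
    (h : m * (i + 1) + 1 ∣ n * (m * (j + 1) + 1)) : m * (i + 1) + 1 ∣ n := by
  have key : m * (i + 1) + 1 ∣ n * m * d := by
    rcases hij with rfl | rfl
    · refine dvd_of_dvd_add (x := n * (m * (i + 1) + 1)) ?_ (Dvd.intro_left _ rfl)
      convert h using 1; ring
    · refine dvd_of_dvd_add (x := n * (m * (j + 1) + 1)) ?_ h
      exact ⟨n, by ring⟩
  obtain ⟨q, rfl⟩ := hd
  refine dvd_of_dvd_mul (dvd_of_dvd_mul (?_ : _ ∣ n * (d * q) * (d * q)))
  convert key.mul_right q using 1; ring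

theorem exists_common_multiple (k : M) : ∃ m : M, m ≠ 0 ∧ ∀ d, d < k → d + 1 ∣ m := by
  refine sigma_induction (fun k : M => ∃ m : M, m ≠ 0 ∧ ∀ d, d < k → ∃ q, m = (d + 1) * q) ?_ ?_ k
  · exact ⟨1, one_ne_zero, fun d hd => (not_lt_zero hd).elim⟩
  · rintro k ⟨m, hm, h⟩
    refine ⟨(k + 1) * m, mul_ne_zero (hM.out.succ_ne_zero k) hm, fun d hd => ?_⟩
    rcases (lt_succ_iff.1 hd).lt_or_eq with hd | rfl
    · exact Dvd.dvd.mul_left (h d hd) (k + 1)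
    · exact ⟨m, rfl⟩

/-- Bounded comprehension for decidable predicates: finite sets have codes. -/
theorem exists_code (P : M → Prop) [hS : Sig (fun e : Fin 1 → M => P (e 0))]
    [hP : Pi1 (fun e : Fin 1 → M => P (e 0))] (k : M) : ∃ c, ∀ i, InCode i c ↔ i < k ∧ P i := by
  obtain ⟨m, hm, hmd⟩ := exists_common_multiple k
  have hS' := hS.at1
  have hP' := hP.at1
  have key : ∀ j, ∃ n : M, ∀ i, i < k →
      ((∃ q, q < n + 1 ∧ n = (m * (i + 1) + 1) * q) ↔ i < j ∧ P i) := by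
    have hdvd : ∀ n p : M, (∃ q, q < n + 1 ∧ n = (m * (p + 1) + 1) * q) ↔ m * (p + 1) + 1 ∣ n := by
      refine fun n p => ⟨fun ⟨q, _, hq⟩ => ⟨q, hq⟩, fun ⟨q, hq⟩ => ⟨q, lt_succ_iff.2 ?_, hq⟩⟩
      rw [hq, add_mul, one_mul]; exact self_le_add_left _ _
    refine sigma_induction (fun j => ∃ n : M, ∀ i, i < k →
      ((∃ q, q < n + 1 ∧ n = (m * (i + 1) + 1) * q) ↔ i < j ∧ P i)) ⟨1, fun i _ => ?_⟩ ?_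
    · rw [hdvd]
      refine ⟨fun h => ?_, fun h => (not_lt_zero h.1).elim⟩
      have h1 : m * (i + 1) + 1 = 0 + 1 := by
          obtain ⟨q, hq⟩ := h
          rcases Arith.eq_zero_or_succ q with rfl | ⟨r, rfl⟩
          · rw [mul_zero] at hq; exact (one_ne_zero hq).elim
          · rw [mul_add, mul_one, ← add_assoc] at hq
            have h3 := hM.out.succ_inj ((m * (i + 1) + 1) * r + m * (i + 1)) 0
              (by rw [zero_add]; exact hq.symm)
            rw [(add_eq_zero.1 h3).2, zero_add]
      have h2 : m * (i + 1) = 0 := hM.out.succ_inj _ _ h1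
      rcases mul_eq_zero.1 h2 with h | h
      · exact (hm h).elim
      · exact (hM.out.succ_ne_zero _ h).elim
    · rintro j ⟨n, hn⟩
      simp only [hdvd] at hn ⊢
      by_cases hj : j < k ∧ P j
      · refine ⟨n * (m * (j + 1) + 1), fun i hi => ?_⟩
        rcases lt_trichotomy i j with hij | rfl | hij
        · have : m * (i + 1) + 1 ∣ n * (m * (j + 1) + 1) ↔ m * (i + 1) + 1 ∣ n := by
            refine ⟨fun h => ?_, fun h => h.mul_right _⟩
            obtain ⟨d, rfl⟩ := (Arith.lt_iff _ _).1 hij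
            refine dvd_of_dvd_mul_modulus (hmd d ?_) (.inl rfl) h
            refine lt_of_lt_of_le (lt_succ_self' d) ((self_le_add_left _ _).trans hj.1.le)
          rw [this, hn i hi]
          have := hij.trans (lt_succ_self' j)
          tauto
        · exact ⟨fun _ => ⟨lt_succ_self' i, hj.2⟩, fun _ => Dvd.intro_left _ rfl⟩
        · have : m * (i + 1) + 1 ∣ n * (m * (j + 1) + 1) ↔ m * (i + 1) + 1 ∣ n := by
            refine ⟨fun h => ?_, fun h => h.mul_right _⟩
            obtain ⟨d, rfl⟩ := (Arith.lt_iff _ _).1 hij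
            refine dvd_of_dvd_mul_modulus (hmd d ?_) (.inr rfl) h
            refine lt_of_lt_of_le (lt_succ_self' d) ((self_le_add_left _ _).trans hi.le)
          rw [this, hn i hi]
          have h1 := not_lt.2 hij.le
          have h2 : ¬ i < j + 1 := fun h => not_le.2 hij (lt_succ_iff.1 h)
          tauto
      · refine ⟨n, fun i hi => ?_⟩
        rw [hn i hi, lt_succ_iff, le_iff_lt_or_eq']
        refine ⟨fun h => ⟨.inl h.1, h.2⟩, fun h => ⟨h.1.resolve_right ?_, h.2⟩⟩
        rintro rfl
        exact hj ⟨hi, h.2⟩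
  obtain ⟨n, hn⟩ := key k
  refine ⟨pair (pair k m) n, fun i => ⟨?_, fun ⟨hi, hPi⟩ => ?_⟩⟩
  · rintro ⟨k', m', n', h, hi, q, hq⟩
    simp only [pair_inj] at h
    obtain ⟨⟨rfl, rfl⟩, rfl⟩ := h
    refine (hn i hi).1 ⟨q, lt_succ_iff.2 ?_, hq⟩
    rw [hq, add_mul, one_mul]; exact self_le_add_left _ _
  · obtain ⟨q, _, hq⟩ := (hn i hi).2 ⟨hi, hPi⟩
    exact ⟨k, m, n, rfl, hi, q, hq⟩

/-- Bounded `Δ⁰₁`-classes are finite sets. -/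
theorem exists_finSet (P : M → Prop) [hS : Sig (fun e : Fin 1 → M => P (e 0))]
    [hP : Pi1 (fun e : Fin 1 → M => P (e 0))] (k : M) (hk : ∀ i, P i → i < k) :
    ∃ c, IsFinSet c ∧ ∀ i, InCode i c ↔ P i := by
  obtain ⟨c, hc⟩ := exists_code P k
  obtain ⟨d, hd, hmin⟩ := exists_least_pi (fun d => ∀ i, InCode i d ↔ InCode i c) (a := c)
    fun i => Iff.rfl
  refine ⟨d, fun c' hc' h => hmin c' hc' fun i => (h i).trans (hd i), fun i => ?_⟩
  rw [hd, hc]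
  exact ⟨fun h => h.2, fun h => ⟨hk i h, h⟩⟩

theorem exists_erase (A i : M) : ∃ B, IsFinSet B ∧ ∀ y, InCode y B ↔ InCode y A ∧ y ≠ i :=
  exists_finSet (fun y => InCode y A ∧ y ≠ i) A fun _ h => h.1.lt

theorem exists_union (A B : M) : ∃ C, IsFinSet C ∧ ∀ y, InCode y C ↔ InCode y A ∨ InCode y B := by
  refine exists_finSet (fun y => InCode y A ∨ InCode y B) (A + B) fun y h => ?_
  rcases h with h | h
  exacts [h.lt.trans_le (self_le_add_right _ _), h.lt.trans_le (self_le_add_left _ _)]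

theorem IsFinSet.ext {c d : M} (hc : IsFinSet c) (hd : IsFinSet d)
    (h : ∀ i, InCode i c ↔ InCode i d) : c = d := by
  rcases lt_trichotomy c d with h1 | h1 | h1
  · exact (hd c h1 h).elim
  · exact h1
  · exact (hc d h1 fun i => (h i).symm).elim

/-- `Σ⁰₁`-collection. -/
theorem exists_bound (R : M → M → Prop) [hR : Sig (fun e : Fin 2 → M => R (e 0) (e 1))] (k : M)
    (h : ∀ i, i < k → ∃ j, R i j) : ∃ B, ∀ i, i < k → ∃ j, j < B ∧ R i j := by
  have h1 := hR.at2
  have : ∀ n, ∃ B, ∀ i, i < n → i < k → ∃ j, j < B ∧ R i j :=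
    sigma_induction (fun n => ∃ B, ∀ i, i < n → i < k → ∃ j, j < B ∧ R i j)
      ⟨0, fun i hi => (not_lt_zero hi).elim⟩ fun n ⟨B, hB⟩ => by
        by_cases hn : n < k
        · obtain ⟨j, hj⟩ := h n hn
          refine ⟨B + j + 1, fun i hi hik => ?_⟩
          rcases (lt_succ_iff.1 hi).lt_or_eq with hi | rfl
          · obtain ⟨j', h2, h3⟩ := hB i hi hik
            exact ⟨j', h2.trans (lt_succ_iff.2 (self_le_add_right _ _)), h3⟩
          · exact ⟨j, lt_succ_iff.2 (self_le_add_left _ _), hj⟩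
        · refine ⟨B, fun i hi hik => hB i ?_ hik⟩
          refine (lt_succ_iff.1 hi).lt_of_ne ?_
          rintro rfl; exact hn hik
  obtain ⟨B, hB⟩ := this k
  exact ⟨B, fun i hi => hB i hi hi⟩

/-- Finite functions with a `Σ⁰₁`-definition have codes. -/
theorem exists_finFun (R : M → M → Prop) [hR : Sig (fun e : Fin 2 → M => R (e 0) (e 1))] (k : M)
    (h : ∀ i, i < k → ∃ j, R i j) (hu : ∀ i j j', i < k → R i j → R i j' → j = j') :
    ∃ c, IsFinSet c ∧ (∀ z, InCode z c → ∃ i j, z = pair i j) ∧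
      ∀ i j, FinApp c i j ↔ i < k ∧ R i j := by
  obtain ⟨B, hB⟩ := exists_bound R k h
  have h1 := hR.at2
  have hP : Pi1 fun e : Fin 1 → M => ∃ i j, e 0 = pair i j ∧ i < k ∧ R i j :=
    Pi1.congr (inferInstance : Pi1 fun e : Fin 1 → M => ∃ i j, e 0 = pair i j ∧ i < k ∧
      ∀ j', R i j' → j' = j) fun e => by
        refine exists_congr fun i => exists_congr fun j => and_congr_right fun _ =>
          and_congr_right fun hi => ⟨fun h' => ?_, fun h' j' hj' => hu i _ _ hi hj' h'⟩
        obtain ⟨j', hj'⟩ := h i hi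
        rwa [← h' j' hj']
  obtain ⟨c, hc, hc'⟩ := exists_finSet (fun z => ∃ i j, z = pair i j ∧ i < k ∧ R i j)
    (pair k B) (by
      rintro _ ⟨i, j, rfl, hi, hj⟩
      obtain ⟨j', h3, h4⟩ := hB i hi
      rw [hu i j j' hi hj h4]
      exact pair_lt_of_add_lt (add_lt_add hi h3))
  refine ⟨c, hc, fun z hz => ?_, fun i j => ?_⟩
  · obtain ⟨i, j, h, -⟩ := (hc' z).1 hz
    exact ⟨i, j, h⟩
  · unfold FinApp
    rw [hc']
    constructor
    · rintro ⟨i', j', h, hi⟩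
      obtain ⟨rfl, rfl⟩ := pair_inj.1 h
      exact hi
    · exact fun h => ⟨i, j, rfl, h⟩

/-- Iteration along the numbers of a definable step `F` that can always be continued on `D`. -/
theorem exists_iterate (D : M → Prop) (F : M → M → Prop) [hD : Sig (fun e : Fin 1 → M => D (e 0))]
    [hF : Sig (fun e : Fin 2 → M => F (e 0) (e 1))] (x₀ : M) (h₀ : D x₀)
    (hs : ∀ x, D x → ∃ y, F x y ∧ D y) (hu : ∀ x y y', F x y → F x y' → y = y') :
    ∃ g : M → M, Fn (fun e : Fin 1 → M => g (e 0)) ∧ g 0 = x₀ ∧ (∀ n, F (g n) (g (n + 1))) ∧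
      ∀ n, D (g n) := by
  let S : M → M → M → Prop := fun n s x => (∀ i, i < n + 1 → ∃ y, FinApp s i y) ∧
    (∀ i y, FinApp s i y → ∀ y', FinApp s i y' → y = y') ∧ FinApp s 0 x₀ ∧
    (∀ i, i < n → ∃ y z, FinApp s i y ∧ FinApp s (i + 1) z ∧ F y z) ∧ FinApp s n x
  have hF' := hF.at2
  have hD' := hD.at1
  have hS : Sig fun e : Fin 3 → M => S (e 0) (e 1) (e 2) := by
    unfold S; infer_instance
  have hS' := hS.at3
  have hex : ∀ n, ∃ s x, S n s x ∧ D x := by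
    refine sigma_induction (fun n => ∃ s x, S n s x ∧ D x) ?_ ?_
    · obtain ⟨c, hc, -, hc'⟩ := exists_finFun (fun i j => j = x₀) 1 (fun i _ => ⟨x₀, rfl⟩)
        (by rintro i j j' - rfl rfl; rfl)
      refine ⟨c, x₀, ⟨fun i hi => ⟨x₀, (hc' _ _).2 ⟨by simpa using hi, rfl⟩⟩, ?_, ?_, ?_, ?_⟩, h₀⟩
      · intro i y h1 y' h2
        rw [((hc' _ _).1 h1).2, ((hc' _ _).1 h2).2]
      · exact (hc' _ _).2 ⟨one_pos, rfl⟩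
      · exact fun i hi => (not_lt_zero hi).elim
      · exact (hc' _ _).2 ⟨one_pos, rfl⟩
    · rintro n ⟨s, x, ⟨h1, h2, h3, h4, h5⟩, hx⟩
      obtain ⟨y, hy, hDy⟩ := hs x hx
      obtain ⟨c, hc, -, hc'⟩ := exists_finFun
        (fun i j => (i < n + 1 ∧ FinApp s i j) ∨ (i = n + 1 ∧ j = y)) (n + 1 + 1)
        (fun i hi => by
          rcases (lt_succ_iff.1 hi).lt_or_eq with hi | hi
          · obtain ⟨y, hy⟩ := h1 i hi
            exact ⟨y, .inl ⟨hi, hy⟩⟩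
          · exact ⟨y, .inr ⟨hi, rfl⟩⟩)
        (by
          rintro i j j' - (h | h) (h' | h')
          · exact h2 _ _ h.2 _ h'.2
          · exact (h.1.ne h'.1).elim
          · exact (h'.1.ne h.1).elim
          · rw [h.2, h'.2])
      have hlt : ∀ i j, i < n + 1 → (FinApp c i j ↔ FinApp s i j) := fun i j hi => by
        rw [hc']
        have h6 := hi.trans (lt_succ_self' _)
        have h7 := hi.ne
        tauto
      have hn1 : FinApp c (n + 1) y := (hc' _ _).2 ⟨lt_succ_self' _, .inr ⟨rfl, rfl⟩⟩
      refine ⟨c, y, ⟨fun i hi => ?_, fun i y h y' h' => ?_, ?_, fun i hi => ?_, hn1⟩, hDy⟩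
      · rcases (lt_succ_iff.1 hi).lt_or_eq with hi | rfl
        · obtain ⟨y, hy⟩ := h1 i hi
          exact ⟨y, (hlt _ _ hi).2 hy⟩
        · exact ⟨y, hn1⟩
      · rcases (hc' _ _).1 h with ⟨-, h | h⟩ <;> rcases (hc' _ _).1 h' with ⟨-, h' | h'⟩
        · exact h2 _ _ h.2 _ h'.2
        · exact (h.1.ne h'.1).elim
        · exact (h'.1.ne h.1).elim
        · rw [h.2, h'.2]
      · exact (hlt _ _ (lt_succ_iff.2 zero_le)).2 h3
      · rcases (lt_succ_iff.1 hi).lt_or_eq with hi | rfl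
        · obtain ⟨y, z, h6, h7, h8⟩ := h4 i hi
          exact ⟨y, z, (hlt _ _ (hi.trans (lt_succ_self' _))).2 h6,
            (hlt _ _ (Order.add_one_le_iff.2 hi |> lt_succ_iff.2)).2 h7, h8⟩
        · exact ⟨x, y, (hlt _ _ (lt_succ_self' _)).2 h5, hn1, hy⟩
  have huniq : ∀ n s x s' x', S n s x → S n s' x' → x = x' := by
    rintro n s x s' x' ⟨-, h2, h3, h4, h5⟩ ⟨-, h2', h3', h4', h5'⟩
    have : ∀ i, i ≤ n → ∃ y, FinApp s i y ∧ FinApp s' i y := by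
      refine sigma_induction (fun i => i ≤ n → ∃ y, FinApp s i y ∧ FinApp s' i y)
        (fun _ => ⟨x₀, h3, h3'⟩) fun i ih hi => ?_
      have hi' : i < n := Order.add_one_le_iff.1 hi
      obtain ⟨y, hy, hy'⟩ := ih hi'.le
      obtain ⟨y1, z, a, b, c⟩ := h4 i hi'
      obtain ⟨y1', z', a', b', c'⟩ := h4' i hi'
      obtain rfl := h2 _ _ a _ hy
      obtain rfl := h2' _ _ a' _ hy'
      obtain rfl := hu _ _ _ c c'
      exact ⟨z, b, b'⟩
    obtain ⟨y, hy, hy'⟩ := this n le_rfl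
    rw [h2 _ _ h5 _ hy, h2' _ _ h5' _ hy']
  choose s g hg hDg using hex
  refine ⟨g, ⟨?_⟩, ?_, fun n => ?_, hDg⟩
  · refine Sig.congr (inferInstance : Sig fun e : Fin 2 → M => ∃ s x, S (e 1) s x ∧ e 0 = x)
      fun e => ⟨?_, fun h => ⟨s (e 1), g (e 1), hg _, h⟩⟩
    rintro ⟨s', x, h, h'⟩
    rw [h']
    exact huniq _ _ _ _ _ h (hg _)
  · obtain ⟨-, h2, h3, h4, h5⟩ := hg 0
    exact h2 _ _ h5 _ h3
  · obtain ⟨h1, h2, h3, h4, h5⟩ := hg (n + 1)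
    obtain ⟨y, z, a, b, c⟩ := h4 n (lt_succ_self' _)
    have : g n = y := huniq n _ _ (s (n + 1)) _ (hg n)
      ⟨fun i hi => h1 i (hi.trans (lt_succ_self' _)), h2, h3,
        fun i hi => h4 i (hi.trans (lt_succ_self' _)), a⟩
    rw [this, h2 _ _ h5 _ b]
    exact c

end Codes

/-! ### Linear orders and enumerations of finite suborders -/

section Orders

variable {M : Type*} [L2Structure M] [hM : Fact (IsModelRCA0 M)] {n : ℕ}

theorem pair_mem_iff {R : M → M → Prop} {x y : M} :
    pair x y ∈ {z : M | ∃ x y, z = pair x y ∧ R x y} ↔ R x y := by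
  constructor
  · rintro ⟨x', y', h, hR⟩
    obtain ⟨rfl, rfl⟩ := pair_inj.1 h
    exact hR
  · exact fun h => ⟨x, y, rfl, h⟩

omit hM in
/-- On the right, all universal quantifiers are bounded, so that the relation is `Σ⁰₁` for
internal `X`. -/
theorem isFinEmbedding_seg_iff (X : Order M) {k f : M} : IsFinEmbedding (seg k) X f ↔ IsFinSet f ∧
    (∀ z, InCode z f → ∃ i j : M, z = pair i j) ∧ (∀ i j, FinApp f i j → i < k ∧ j ∈ X.fld) ∧
    (∀ i, i < k → ∃ j, FinApp f i j) ∧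
    (∀ i j, FinApp f i j → ∀ i' j', FinApp f i' j' → (i = i' → j = j') ∧ (i < i' → X.lt j j')) := by
  constructor
  · rintro ⟨h1, h2, h3⟩
    refine ⟨h1, h2, h3.mem, fun i hi => (h3.exists_unique i hi).exists, fun i j hij i' j' hij' =>
      ⟨?_, fun h => h3.lt_of_lt _ _ _ _ hij hij' ⟨h, (h3.mem _ _ hij').1⟩⟩⟩
    rintro rfl
    exact (h3.exists_unique i (h3.mem _ _ hij).1).unique hij hij'
  · rintro ⟨h1, h2, h3, h4, h5⟩
    refine ⟨h1, h2, h3, fun i hi => ?_, fun i i' j j' hij hij' h => (h5 _ _ hij _ _ hij').2 h.1⟩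
    obtain ⟨j, hj⟩ := h4 i hi
    exact ⟨j, hj, fun j' hj' => (h5 _ _ hj' _ _ hj).1 rfl⟩

section
variable (X : Order M) [hX : Fact X.IsInternal] (s t u : (Fin n → M) → M) [ht : Fn t] [hs : Fn s]
  [hu : Fn u]

instance : Fact (IsSet X.fld) := ⟨hX.out.1⟩

instance Sig.order_lt : Sig (fun e => X.lt (s e) (t e)) :=
  have : Fact (IsSet {z : M | ∃ x y, z = pair x y ∧ X.lt x y}) := ⟨hX.out.2⟩
  (inferInstance : Sig fun e => pair (s e) (t e) ∈ {z : M | ∃ x y, z = pair x y ∧ X.lt x y}).congr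
    fun _ => pair_mem_iff

instance Pi1.order_lt : Pi1 (fun e => X.lt (s e) (t e)) :=
  have : Fact (IsSet {z : M | ∃ x y, z = pair x y ∧ X.lt x y}) := ⟨hX.out.2⟩
  (inferInstance : Pi1 fun e => pair (s e) (t e) ∈ {z : M | ∃ x y, z = pair x y ∧ X.lt x y}).congr
    fun _ => pair_mem_iff

instance Sig.isFinEmbedding : Sig (fun e => IsFinEmbedding (seg (s e)) X (t e)) :=
  have : Sig (fun e : Fin 2 → M => IsFinEmbedding (seg (e 0)) X (e 1)) := by
    simp only [isFinEmbedding_seg_iff]; infer_instance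
  Sig.comp2 s t fun x y => IsFinEmbedding (seg x) X y

instance Sig.isEnum : Sig (fun e => IsEnum X (s e) (t e) (u e)) :=
  have : Sig (fun e : Fin 3 → M => IsEnum X (e 0) (e 1) (e 2)) :=
    (inferInstance : Sig fun e : Fin 3 → M => IsFinSet (e 0) ∧ IsFinEmbedding (seg (e 1)) X (e 2) ∧
      (∀ x, InCode x (e 0) → ∃ i, FinApp (e 2) i x) ∧
      ∀ i x, FinApp (e 2) i x → InCode x (e 0)).congr fun e => by
        refine and_congr_right fun _ => and_congr_right fun _ => ⟨fun h x => ⟨h.1 x, ?_⟩,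
          fun h => ⟨fun x => (h x).1, fun i x hx => (h x).2 ⟨i, hx⟩⟩⟩
        rintro ⟨i, hi⟩
        exact h.2 i x hi
  Sig.comp3 s t u (IsEnum X)

end

theorem isSet_pairs (R : M → M → Prop) [hS : Sig (fun e : Fin 2 → M => R (e 0) (e 1))]
    [hP : Pi1 (fun e : Fin 2 → M => R (e 0) (e 1))] : IsSet {z : M | ∃ x y, z = pair x y ∧ R x y} :=
  have := hS.at2; have := hP.at2
  isSet_of_delta _

theorem seg_isLinear (k : M) : (seg k).IsLinear where
  lt_mem x y h := ⟨h.1.trans h.2, h.2⟩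
  irrefl x h := h.1.ne rfl
  trans x y z h h' := ⟨h.1.trans h'.1, h'.2⟩
  total x hx y hy := by
    rcases lt_trichotomy x y with h | h | h
    exacts [.inl ⟨h, hy⟩, .inr (.inl h), .inr (.inr ⟨h, hx⟩)]

theorem seg_isInternal (k : M) : (seg k).IsInternal :=
  ⟨isSet_of_delta (· < k), isSet_pairs fun x y => x < y ∧ y < k⟩

instance (k : M) : Fact (seg k).IsInternal := ⟨seg_isInternal k⟩

omit [L2Structure M] hM in
theorem Order.IsLinear.asymm {X : Order M} (hX : X.IsLinear) {x y : M} (h : X.lt x y) :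
    ¬ X.lt y x := fun h' => hX.irrefl _ (hX.trans _ _ _ h h')

namespace IsEmbedding

variable {X Y : Order M} {R : M → M → Prop} (h : IsEmbedding X Y R) {x x' y y' : M}
include h

omit [L2Structure M] hM in
theorem eq_of_eq (hx : R x y) (hx' : R x y') : y = y' :=
  (h.exists_unique x (h.mem _ _ hx).1).unique hx hx'

omit [L2Structure M] hM in
theorem lt_iff (hX : X.IsLinear) (hY : Y.IsLinear) (hx : R x y) (hx' : R x' y') :
    X.lt x x' ↔ Y.lt y y' := by
  refine ⟨h.lt_of_lt _ _ _ _ hx hx', fun hlt => ?_⟩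
  rcases hX.total x (h.mem _ _ hx).1 x' (h.mem _ _ hx').1 with h1 | rfl | h1
  · exact h1
  · rw [h.eq_of_eq hx hx'] at hlt
    exact (hY.irrefl _ hlt).elim
  · exact (hY.asymm hlt (h.lt_of_lt _ _ _ _ hx' hx h1)).elim

omit [L2Structure M] hM in
theorem inj (hX : X.IsLinear) (hY : Y.IsLinear) (hx : R x y) (hx' : R x' y) : x = x' := by
  rcases hX.total x (h.mem _ _ hx).1 x' (h.mem _ _ hx').1 with h1 | h1 | h1
  · exact (hY.irrefl _ (h.lt_of_lt _ _ _ _ hx hx' h1)).elim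
  · exact h1
  · exact (hY.irrefl _ (h.lt_of_lt _ _ _ _ hx' hx h1)).elim

end IsEmbedding

/-- Embeddings with finite domain and `Σ⁰₁`-definition are coded. -/
theorem exists_embedding (X : Order M) (k : M) (R : M → M → Prop)
    [hR : Sig (fun e : Fin 2 → M => R (e 0) (e 1))] (htot : ∀ i, i < k → ∃ j, R i j)
    (hu : ∀ i j j', i < k → R i j → R i j' → j = j') (hmem : ∀ i j, i < k → R i j → j ∈ X.fld)
    (hlt : ∀ i i' j j', i < i' → i' < k → R i j → R i' j' → X.lt j j') :
    ∃ f, IsFinEmbedding (seg k) X f ∧ ∀ i j, FinApp f i j ↔ i < k ∧ R i j := by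
  obtain ⟨f, h1, h2, h3⟩ := exists_finFun R k htot hu
  refine ⟨f, (isFinEmbedding_seg_iff X).2 ⟨h1, h2, fun i j h => ?_, fun i hi => ?_,
    fun i j h i' j' h' => ?_⟩, h3⟩
  · rw [h3] at h; exact ⟨h.1, hmem _ _ h.1 h.2⟩
  · obtain ⟨j, hj⟩ := htot i hi
    exact ⟨j, (h3 _ _).2 ⟨hi, hj⟩⟩
  · rw [h3] at h h'
    refine ⟨?_, fun hi => hlt _ _ _ _ hi h'.1 h.2 h'.2⟩
    rintro rfl
    exact hu _ _ _ h.1 h.2 h'.2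

theorem IsFinEmbedding.code_ext {X Y X' Y' : Order M} {f g : M} (hf : IsFinEmbedding X Y f)
    (hg : IsFinEmbedding X' Y' g) (h : ∀ i j, FinApp f i j ↔ FinApp g i j) : f = g := by
  refine hf.1.ext hg.1 fun z => ⟨fun hz => ?_, fun hz => ?_⟩
  · obtain ⟨i, j, rfl⟩ := hf.2.1 z hz
    exact (h i j).1 hz
  · obtain ⟨i, j, rfl⟩ := hg.2.1 z hz
    exact (h i j).2 hz

/-- Every finite subset of an internal linear order has an increasing enumeration. -/
theorem exists_enum {X : Order M} (hX : X.IsLinear) (hXi : X.IsInternal) {a : M} (ha : IsFinSet a)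
    (haX : ∀ x, InCode x a → x ∈ X.fld) : ∃ k e, IsEnum X a k e := by
  have : Fact X.IsInternal := ⟨hXi⟩
  have key : ∀ t, ∃ k e, IsFinEmbedding (seg k) X e ∧
      (∀ x, InCode x a → x < t → ∃ i, FinApp e i x) ∧
      (∀ i x, FinApp e i x → x < t ∧ InCode x a) := by
    refine sigma_induction (fun t => ∃ k e, IsFinEmbedding (seg k) X e ∧
      (∀ x, InCode x a → x < t → ∃ i, FinApp e i x) ∧
      (∀ i x, FinApp e i x → x < t ∧ InCode x a)) ?_ ?_
    · obtain ⟨f, hf, hf'⟩ := exists_embedding X 0 (fun i j => i = j)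
        (fun i hi => (not_lt_zero hi).elim) (fun i _ _ hi => (not_lt_zero hi).elim)
        (fun i _ hi => (not_lt_zero hi).elim) (fun i _ _ _ _ hi => (not_lt_zero hi).elim)
      exact ⟨0, f, hf, fun x _ hx => (not_lt_zero hx).elim, fun i x h =>
        (not_lt_zero ((hf' _ _).1 h).1).elim⟩
    · rintro t ⟨k, e, he, h1, h2⟩
      by_cases hta : InCode t a
      swap
      · refine ⟨k, e, he, fun x hx hxt => h1 x hx ((lt_succ_iff.1 hxt).lt_of_ne ?_),
          fun i x h => ⟨(h2 i x h).1.trans (lt_succ_self' t), (h2 i x h).2⟩⟩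
        rintro rfl; exact hta hx
      have hE := he.2.2
      obtain ⟨p, hp, hpmin⟩ := exists_least_pi (fun p => ¬ ∃ x, FinApp e p x ∧ X.lt x t) (a := k)
        (by rintro ⟨x, hx, -⟩; exact lt_irrefl k (hE.mem _ _ hx).1)
      have hpk : p ≤ k := by
        by_contra h
        exact hpmin k (not_le.1 h) (by rintro ⟨x, hx, -⟩; exact lt_irrefl k (hE.mem _ _ hx).1)
      have hlow : ∀ i x, i < p → FinApp e i x → X.lt x t := fun i x hi hx => by
        have := hpmin i hi
        push Not at this
        obtain ⟨x', hx', h'⟩ := this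
        rwa [hE.eq_of_eq hx hx']
      have hhigh : ∀ i x, p ≤ i → FinApp e i x → X.lt t x := fun i x hi hx => by
        have hpk' : p < k := hi.trans_lt (hE.mem _ _ hx).1
        obtain ⟨y, hy⟩ := (hE.exists_unique p hpk').exists
        have hty : X.lt t y := by
          rcases hX.total t (haX _ hta) y (hE.mem _ _ hy).2 with h | h | h
          · exact h
          · exact ((h2 _ _ hy).1.ne h.symm).elim
          · exact (hp ⟨y, hy, h⟩).elim
        rcases hi.lt_or_eq with hi | rfl
        · exact hX.trans _ _ _ hty (hE.lt_of_lt _ _ _ _ hy hx ⟨hi, (hE.mem _ _ hx).1⟩)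
        · rwa [hE.eq_of_eq hx hy]
      obtain ⟨f, hf, hf'⟩ := exists_embedding X (k + 1) (fun i j => (i < p ∧ FinApp e i j) ∨
        (i = p ∧ j = t) ∨ ∃ i', i = i' + 1 ∧ p ≤ i' ∧ FinApp e i' j)
        (fun i hi => by
          rcases lt_trichotomy i p with h | h | h
          · obtain ⟨j, hj⟩ := (hE.exists_unique i (h.trans_le hpk)).exists
            exact ⟨j, .inl ⟨h, hj⟩⟩
          · exact ⟨t, .inr (.inl ⟨h, rfl⟩)⟩
          · rcases Arith.eq_zero_or_succ i with rfl | ⟨i', rfl⟩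
            · exact (not_lt_zero h).elim
            · obtain ⟨j, hj⟩ := (hE.exists_unique i' (lt_of_add_lt_add_right hi)).exists
              exact ⟨j, .inr (.inr ⟨i', rfl, lt_succ_iff.1 h, hj⟩)⟩)
        (by
          rintro i j j' - (⟨h, h'⟩ | ⟨rfl, rfl⟩ | ⟨i', rfl, h, h'⟩)
            (⟨k, k'⟩ | ⟨k1, k'⟩ | ⟨i'', k1, k, k'⟩)
          · exact hE.eq_of_eq h' k'
          · exact (h.ne k1).elim
          · rw [k1] at h
            exact (not_le.2 h (k.trans (lt_succ_self' _).le)).elim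
          · exact (lt_irrefl _ k).elim
          · exact k'.symm
          · rw [k1] at k
            exact (not_le.2 (lt_succ_self' _) k).elim
          · exact (not_le.2 (k.trans_le h) (lt_succ_self' i').le).elim
          · rw [← k1] at h
            exact (not_le.2 (lt_succ_self' _) h).elim
          · rw [add_right_cancel k1] at h'
            exact hE.eq_of_eq h' k')
        (by
          rintro i j - (⟨h, h'⟩ | ⟨rfl, rfl⟩ | ⟨i', rfl, h, h'⟩)
          exacts [(hE.mem _ _ h').2, haX _ hta, (hE.mem _ _ h').2])
        (by
          rintro i i' j j' hii - (⟨h, h'⟩ | ⟨rfl, rfl⟩ | ⟨i, rfl, h, h'⟩)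
            (⟨k, k'⟩ | ⟨rfl, rfl⟩ | ⟨i'', rfl, k, k'⟩)
          · exact hE.lt_of_lt _ _ _ _ h' k' ⟨hii, (hE.mem _ _ k').1⟩
          · exact hlow _ _ h h'
          · exact hX.trans _ _ _ (hlow _ _ h h') (hhigh _ _ k k')
          · exact (lt_asymm hii k).elim
          · exact (lt_irrefl _ hii).elim
          · exact hhigh _ _ k k'
          · exact (not_le.2 (hii.trans k) (h.trans (lt_succ_self' _).le)).elim
          · exact (not_le.2 hii (h.trans (lt_succ_self' _).le)).elim
          · exact hE.lt_of_lt _ _ _ _ h' k' ⟨lt_of_add_lt_add_right hii, (hE.mem _ _ k').1⟩)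
      refine ⟨k + 1, f, hf, fun x hx hxt => ?_, fun i x h => ?_⟩
      · rcases (lt_succ_iff.1 hxt).lt_or_eq with h | rfl
        · obtain ⟨i, hi⟩ := h1 x hx h
          have hik := (hE.mem _ _ hi).1
          rcases lt_or_ge i p with hip | hip
          · exact ⟨i, (hf' _ _).2 ⟨hik.trans (lt_succ_self' k), .inl ⟨hip, hi⟩⟩⟩
          · exact ⟨i + 1, (hf' _ _).2
              ⟨(add_lt_add_iff_right 1).2 hik, .inr (.inr ⟨i, rfl, hip, hi⟩)⟩⟩
        · exact ⟨p, (hf' _ _).2 ⟨lt_succ_iff.2 hpk, .inr (.inl ⟨rfl, rfl⟩)⟩⟩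
      · rcases (hf' _ _).1 h with ⟨-, ⟨-, h'⟩ | ⟨-, rfl⟩ | ⟨i', -, -, h'⟩⟩
        · exact ⟨(h2 _ _ h').1.trans (lt_succ_self' t), (h2 _ _ h').2⟩
        · exact ⟨lt_succ_self' _, hta⟩
        · exact ⟨(h2 _ _ h').1.trans (lt_succ_self' t), (h2 _ _ h').2⟩
  obtain ⟨k, e, he, h1, h2⟩ := key a
  exact ⟨k, e, ha, he, fun x => ⟨fun hx => h1 x hx hx.lt, fun ⟨i, hi⟩ => (h2 i x hi).2⟩⟩

/-- An inclusion of finite suborders induces a morphism between their cardinalities. -/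
theorem exists_inclusion {X : Order M} (hX : X.IsLinear) {a b k k' e e' : M}
    (he : IsEnum X a k e) (he' : IsEnum X b k' e') (hab : ∀ x, InCode x a → InCode x b) :
    ∃ f, IsMorphism k k' f ∧ (∀ i j x, FinApp f i j → FinApp e' j x → FinApp e i x) ∧
      (∀ i j x, FinApp e i x → FinApp e' j x → FinApp f i j) := by
  have hE := he.2.1.2.2
  have hE' := he'.2.1.2.2
  obtain ⟨f, hf, hf'⟩ := exists_embedding (seg k') k (fun i j => ∃ x, FinApp e i x ∧ FinApp e' j x)
    (fun i hi => by
      obtain ⟨x, hx⟩ := (hE.exists_unique i hi).exists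
      obtain ⟨j, hj⟩ := (he'.2.2 x).1 (hab x ((he.2.2 x).2 ⟨i, hx⟩))
      exact ⟨j, x, hx, hj⟩)
    (by
      rintro i j j' - ⟨x, h1, h2⟩ ⟨x', h1', h2'⟩
      rw [hE.eq_of_eq h1 h1'] at h2
      exact hE'.inj (seg_isLinear _) hX h2 h2')
    (by
      rintro i j - ⟨x, h1, h2⟩
      exact (hE'.mem _ _ h2).1)
    (by
      rintro i i' j j' hi hk ⟨x, h1, h2⟩ ⟨x', h1', h2'⟩
      rw [hE'.lt_iff (seg_isLinear _) hX h2 h2']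
      exact hE.lt_of_lt _ _ _ _ h1 h1' ⟨hi, hk⟩)
  refine ⟨f, hf, fun i j x h h' => ?_, fun i j x h h' => (hf' _ _).2 ⟨(hE.mem _ _ h).1, x, h, h'⟩⟩
  obtain ⟨-, y, h1, h2⟩ := (hf' _ _).1 h
  rwa [hE'.eq_of_eq h' h2]

theorem IsMorphism.le_apply {k k' f : M} (hf : IsMorphism k k' f) {i j : M} (h : FinApp f i j) :
    i ≤ j := by
  have := pi_induction (fun i => ∀ j, FinApp f i j → i ≤ j) (fun j _ => zero_le)
    (fun i ih j hj => ?_)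
  · exact this i j h
  · have hi := (hf.2.2.mem _ _ hj).1
    obtain ⟨j', hj'⟩ := (hf.2.2.exists_unique i ((lt_succ_self' i).trans hi)).exists
    exact Order.add_one_le_iff.2 ((ih j' hj').trans_lt
      (hf.2.2.lt_of_lt _ _ _ _ hj' hj ⟨lt_succ_self' i, hi⟩).1)

theorem IsMorphism.le {k k' f : M} (hf : IsMorphism k k' f) : k ≤ k' := by
  rcases Arith.eq_zero_or_succ k with rfl | ⟨i, rfl⟩
  · exact zero_le
  · obtain ⟨j, hj⟩ := (hf.2.2.exists_unique i (lt_succ_self' i)).exists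
    exact Order.add_one_le_iff.2 ((hf.le_apply hj).trans_lt (hf.2.2.mem _ _ hj).2)

theorem IsEnum.unique {X : Order M} (hX : X.IsLinear) {a k k' e e' : M}
    (he : IsEnum X a k e) (he' : IsEnum X a k' e') : k = k' ∧ e = e' := by
  have aux : ∀ {k k' e e' i j x : M}, IsEnum X a k e → IsEnum X a k' e' → FinApp e i x →
      FinApp e' j x → k ≤ k' ∧ i ≤ j := by
    intro k k' e e' i j x he he' hi hj
    obtain ⟨f, hf, -, h2⟩ := exists_inclusion hX he he' fun _ => id
    exact ⟨hf.le, hf.le_apply (h2 i j x hi hj)⟩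
  have aux' : ∀ {k k' e e' i x : M}, IsEnum X a k e → IsEnum X a k' e' → FinApp e i x →
      FinApp e' i x := by
    intro k k' e e' i x he he' hi
    obtain ⟨j, hj⟩ := (he'.2.2 x).1 ((he.2.2 x).2 ⟨i, hi⟩)
    rwa [le_antisymm (aux he he' hi hj).2 (aux he' he hj hi).2]
  refine ⟨le_antisymm ?_ ?_, he.2.1.code_ext he'.2.1 fun i x => ⟨aux' he he', aux' he' he⟩⟩
  · obtain ⟨f, hf, -⟩ := exists_inclusion hX he he' fun _ => id
    exact hf.le
  · obtain ⟨f, hf, -⟩ := exists_inclusion hX he' he fun _ => id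
    exact hf.le

/-- A descending sequence in a linear order is unbounded as a sequence of numbers. -/
theorem exists_le_of_descending {X : Order M} (hX : X.IsLinear) (hXi : X.IsInternal) (g : M → M)
    [hg : Fn (fun e : Fin 1 → M => g (e 0))] (hgX : ∀ n, g n ∈ X.fld)
    (hlt : ∀ n, X.lt (g (n + 1)) (g n)) (n₀ B : M) : ∃ n, n₀ ≤ n ∧ B ≤ g n := by
  by_contra hcon
  push Not at hcon
  have : Fact X.IsInternal := ⟨hXi⟩
  have := hg.at1
  obtain ⟨a, ha, ha'⟩ := exists_finSet (fun x => x < B ∧ x ∈ X.fld) B fun i h => h.1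
  obtain ⟨k, e, he⟩ := exists_enum hX hXi ha fun x hx => ((ha' x).1 hx).2
  have hE := he.2.1.2.2
  have hin : ∀ n, ∃ i, FinApp e i (g (n₀ + n)) := fun n =>
    (he.2.2 _).1 ((ha' _).2 ⟨hcon _ (self_le_add_right _ _), hgX _⟩)
  have key : ∀ n, ∃ i, FinApp e i (g (n₀ + n)) ∧ i + n ≤ k := by
    refine sigma_induction (fun n => ∃ i, FinApp e i (g (n₀ + n)) ∧ i + n ≤ k) ?_ ?_
    · obtain ⟨i, hi⟩ := hin 0
      exact ⟨i, hi, by rw [add_zero]; exact (hE.mem _ _ hi).1.le⟩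
    · rintro n ⟨i, hi, hik⟩
      obtain ⟨j, hj⟩ := hin (n + 1)
      refine ⟨j, hj, ?_⟩
      have : (seg k).lt j i := by
        rw [hE.lt_iff (seg_isLinear _) hX hj hi, ← add_assoc]
        exact hlt _
      have h2 : j + 1 ≤ i := Order.add_one_le_iff.2 this.1
      calc j + (n + 1) = j + 1 + n := by ring
        _ ≤ i + n := by gcongr
        _ ≤ k := hik
  obtain ⟨i, -, hi⟩ := key (k + 1)
  exact not_lt.2 ((self_le_add_left (k + 1) i).trans hi) (lt_succ_self' k)

/-- Composition of finite embeddings. -/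
theorem exists_comp {X : Order M} {n m f g : M} (hf : IsMorphism n m f)
    (hg : IsFinEmbedding (seg m) X g) : ∃ h, IsFinEmbedding (seg n) X h ∧
      ∀ i l, FinApp h i l ↔ ∃ j, FinApp f i j ∧ FinApp g j l := by
  have hF := hf.2.2
  have hG := hg.2.2
  obtain ⟨h, hh, hh'⟩ := exists_embedding X n (fun i l => ∃ j, FinApp f i j ∧ FinApp g j l)
    (fun i hi => by
      obtain ⟨j, hj⟩ := (hF.exists_unique i hi).exists
      obtain ⟨l, hl⟩ := (hG.exists_unique j (hF.mem _ _ hj).2).exists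
      exact ⟨l, j, hj, hl⟩)
    (by
      rintro i l l' - ⟨j, h1, h2⟩ ⟨j', h1', h2'⟩
      rw [hF.eq_of_eq h1 h1'] at h2
      exact hG.eq_of_eq h2 h2')
    (by
      rintro i l - ⟨j, h1, h2⟩
      exact (hG.mem _ _ h2).2)
    (by
      rintro i i' l l' hi hn ⟨j, h1, h2⟩ ⟨j', h1', h2'⟩
      exact hG.lt_of_lt _ _ _ _ h2 h2' (hF.lt_of_lt _ _ _ _ h1 h1' ⟨hi, hn⟩))
  refine ⟨h, hh, fun i l => ?_⟩
  rw [hh']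
  refine ⟨fun h => h.2, fun h => ⟨?_, h⟩⟩
  obtain ⟨j, h1, -⟩ := h
  exact (hF.mem _ _ h1).1

end Orders

/-! ### A quadratic normal dilator -/

section Quadratic

variable {M : Type*} [L2Structure M] [hM : Fact (IsModelRCA0 M)] {n : ℕ}

theorem exists_pair_iff {R : M → M → Prop} {x y : M} :
    (∃ x' y', pair x y = pair x' y' ∧ R x' y') ↔ R x y := by
  constructor
  · rintro ⟨x', y', h, hR⟩
    obtain ⟨rfl, rfl⟩ := pair_inj.1 h
    exact hR
  · exact fun h => ⟨x, y, rfl, h⟩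

theorem exists_dbl (x y : M) : ∃ c, IsFinSet c ∧ ∀ i, InCode i c ↔ i = x ∨ i = y :=
  exists_finSet _ (x + y + 1) (by
    rintro i (rfl | rfl)
    exacts [lt_succ_iff.2 (self_le_add_right _ _), lt_succ_iff.2 (self_le_add_left _ _)])

/-- The canonical code of the set `{x, y}`. -/
noncomputable def dbl (x y : M) : M := (exists_dbl x y).choose

theorem isFinSet_dbl (x y : M) : IsFinSet (dbl x y) := (exists_dbl x y).choose_spec.1
@[simp] theorem inCode_dbl {x y i : M} : InCode i (dbl x y) ↔ i = x ∨ i = y :=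
  (exists_dbl x y).choose_spec.2 i

theorem eq_dbl_iff {c x y : M} : c = dbl x y ↔
    IsFinSet c ∧ InCode x c ∧ InCode y c ∧ ∀ i, InCode i c → i = x ∨ i = y := by
  constructor
  · rintro rfl
    exact ⟨isFinSet_dbl x y, by simp, by simp, by simp⟩
  · rintro ⟨h1, h2, h3, h4⟩
    refine h1.ext (isFinSet_dbl x y) fun i => ?_
    rw [inCode_dbl]
    refine ⟨h4 i, ?_⟩
    rintro (rfl | rfl) <;> assumption

/-- The element of `D^T(X)` that is given by `y ≤ x` in `X`, where `T` is the quadratic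
dilator defined below. -/
noncomputable def quad (x y : M) : M :=
  open Classical in pair (dbl x y) (if x = y then pair 0 0 else pair 1 0)

section
variable (s t : (Fin n → M) → M) [Fn s] [Fn t]

instance Fn.dbl : Fn (fun e => dbl (s e) (t e)) :=
  have : Fn (fun e : Fin 2 → M => SOA.dbl (e 0) (e 1)) :=
    ⟨by simp only [eq_dbl_iff]; infer_instance⟩
  Fn.comp2 s t SOA.dbl

instance Fn.quad : Fn (fun e => quad (s e) (t e)) :=
  have : Fn (fun e : Fin 2 → M => SOA.quad (e 0) (e 1)) := ⟨
    (inferInstance : Sig fun e : Fin 3 → M =>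
      (e (Fin.succ 0) = e (Fin.succ 1) ∧
        e 0 = SOA.pair (SOA.dbl (e (Fin.succ 0)) (e (Fin.succ 1))) (SOA.pair 0 0)) ∨
      (e (Fin.succ 0) ≠ e (Fin.succ 1) ∧
        e 0 = SOA.pair (SOA.dbl (e (Fin.succ 0)) (e (Fin.succ 1))) (SOA.pair 1 0))).congr
        fun e => by
      unfold SOA.quad
      by_cases h : e 1 = e 2 <;> simp [h]⟩
  Fn.comp2 s t SOA.quad
end

/-- The order on pairs `(x, y)` with `y ≤ x`: compare the first components; for equal first
component `x`, the pair `(x, x)` comes first, followed by the pairs `(x, y)` with `y < x`. -/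
def QuadLt (lt : M → M → Prop) (x y x' y' : M) : Prop :=
  lt x x' ∨ x = x' ∧ y' ≠ x' ∧ (y = x ∨ lt y y')

/-- The normal dilator with `T(n) = {(i, j) | j ≤ i < n}`. Its values are quadratic. -/
def quadDilator (M : Type*) [L2Structure M] [Fact (IsModelRCA0 M)] : NormalData M where
  objSet := {z | ∃ n σ, z = pair n σ ∧ ∃ i j, σ = pair i j ∧ j ≤ i ∧ i < n}
  ltSet := {z | ∃ n w, z = pair n w ∧ ∃ σ τ, w = pair σ τ ∧ ∃ i j, σ = pair i j ∧ j ≤ i ∧ i < n ∧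
    ∃ i' j', τ = pair i' j' ∧ j' ≤ i' ∧ i' < n ∧ QuadLt (· < ·) i j i' j'}
  mapSet := {z | ∃ p w, z = pair p w ∧ ∃ n m, p = pair n m ∧ ∃ f v, w = pair f v ∧
    ∃ σ τ, v = pair σ τ ∧ ∃ i j, σ = pair i j ∧ j ≤ i ∧ i < n ∧
      ∃ i' j', τ = pair i' j' ∧ i' < m ∧ FinApp f i i' ∧ FinApp f j j'}
  suppSet := {z | ∃ n w, z = pair n w ∧ ∃ σ a, w = pair σ a ∧ ∃ i j, σ = pair i j ∧ j ≤ i ∧ i < n ∧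
    a = dbl i j}
  muSet := {z | ∃ n w, z = pair n w ∧ ∃ i σ, w = pair i σ ∧ i < n ∧ σ = pair i i}

local notation "Q" => quadDilator M

theorem quad_fld {n σ : M} : σ ∈ ((Q).obj n).fld ↔ ∃ i j, σ = pair i j ∧ j ≤ i ∧ i < n :=
  exists_pair_iff
theorem quad_lt {n σ τ : M} : ((Q).obj n).lt σ τ ↔ ∃ i j, σ = pair i j ∧ j ≤ i ∧ i < n ∧
    ∃ i' j', τ = pair i' j' ∧ j' ≤ i' ∧ i' < n ∧ QuadLt (· < ·) i j i' j' := by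
  refine exists_pair_iff.trans exists_pair_iff
theorem quad_map {n m f σ τ : M} : (Q).Map n m f σ τ ↔ ∃ i j, σ = pair i j ∧ j ≤ i ∧ i < n ∧
      ∃ i' j', τ = pair i' j' ∧ i' < m ∧ FinApp f i i' ∧ FinApp f j j' :=
  exists_pair_iff.trans (exists_pair_iff.trans (exists_pair_iff.trans exists_pair_iff))
theorem quad_supp {n σ a : M} : (Q).Supp n σ a ↔ ∃ i j, σ = pair i j ∧ j ≤ i ∧ i < n ∧
    a = dbl i j := exists_pair_iff.trans exists_pair_iff
theorem quad_mu {n i σ : M} : (Q).Mu n i σ ↔ i < n ∧ σ = pair i i :=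
  exists_pair_iff.trans exists_pair_iff

theorem quad_fld_pair {n i j : M} : pair i j ∈ ((Q).obj n).fld ↔ j ≤ i ∧ i < n :=
  quad_fld.trans exists_pair_iff
theorem quad_lt_pair {n i j i' j' : M} : ((Q).obj n).lt (pair i j) (pair i' j') ↔
    j ≤ i ∧ i < n ∧ j' ≤ i' ∧ i' < n ∧ QuadLt (· < ·) i j i' j' := by
  rw [quad_lt, exists_pair_iff (R := fun i j => j ≤ i ∧ i < n ∧
    ∃ i₁ j₁, pair i' j' = pair i₁ j₁ ∧ j₁ ≤ i₁ ∧ i₁ < n ∧ QuadLt (· < ·) i j i₁ j₁)]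
  refine and_congr_right fun _ => and_congr_right fun _ => exists_pair_iff
theorem quad_map_pair {n m f i j i' j' : M} : (Q).Map n m f (pair i j) (pair i' j') ↔
    j ≤ i ∧ i < n ∧ i' < m ∧ FinApp f i i' ∧ FinApp f j j' := by
  rw [quad_map, exists_pair_iff (R := fun i j => j ≤ i ∧ i < n ∧
    ∃ i₁ j₁, pair i' j' = pair i₁ j₁ ∧ i₁ < m ∧ FinApp f i i₁ ∧ FinApp f j j₁)]
  refine and_congr_right fun _ => and_congr_right fun _ => exists_pair_iff
theorem quad_supp_pair {n i j a : M} : (Q).Supp n (pair i j) a ↔ j ≤ i ∧ i < n ∧ a = dbl i j :=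
  quad_supp.trans exists_pair_iff

theorem quad_isLinear (n : M) : ((Q).obj n).IsLinear where
  lt_mem x y h := by
    obtain ⟨i, j, rfl, h1, h2, i', j', rfl, h3, h4, -⟩ := quad_lt.1 h
    exact ⟨quad_fld_pair.2 ⟨h1, h2⟩, quad_fld_pair.2 ⟨h3, h4⟩⟩
  irrefl x h := by
    obtain ⟨i, j, rfl, h1, h2, i', j', h, h3, h4, h5⟩ := quad_lt.1 h
    obtain ⟨rfl, rfl⟩ := pair_inj.1 h
    unfold QuadLt at h5
    grind
  trans x y z h h' := by
    obtain ⟨i, j, rfl, h1, h2, i', j', rfl, h3, h4, h5⟩ := quad_lt.1 h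
    obtain ⟨i₁, j₁, h, -, -, i₂, j₂, rfl, k3, k4, k5⟩ := quad_lt.1 h'
    obtain ⟨rfl, rfl⟩ := pair_inj.1 h
    refine quad_lt_pair.2 ⟨h1, h2, k3, k4, ?_⟩
    unfold QuadLt at h5 k5 ⊢
    grind
  total x hx y hy := by
    obtain ⟨i, j, rfl, h1, h2⟩ := quad_fld.1 hx
    obtain ⟨i', j', rfl, h1', h2'⟩ := quad_fld.1 hy
    simp only [quad_lt_pair, pair_inj]
    unfold QuadLt
    grind

theorem quad_isPraeDilator : (Q).IsPraeDilator where
  isSet_obj := by dsimp only [quadDilator]; exact isSet_of_delta _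
  isSet_lt := by dsimp only [quadDilator, QuadLt]; exact isSet_of_delta _
  isSet_map := by dsimp only [quadDilator]; exact isSet_of_delta _
  isSet_supp := by dsimp only [quadDilator]; exact isSet_of_delta _
  isFunctor :=
    { linear := quad_isLinear
      embedding := fun n m f hf => by
        have hE := hf.2.2
        refine ⟨fun σ τ h => ?_, fun σ hσ => ?_, fun σ σ' τ τ' h h' hlt => ?_⟩
        · obtain ⟨i, j, rfl, h1, h2, i', j', rfl, h3, h4, h5⟩ := quad_map.1 h
          refine ⟨quad_fld_pair.2 ⟨h1, h2⟩, quad_fld_pair.2 ⟨?_, h3⟩⟩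
          rcases h1.lt_or_eq with h1 | rfl
          · exact (hE.lt_of_lt _ _ _ _ h5 h4 ⟨h1, h2⟩).1.le
          · exact (hE.eq_of_eq h5 h4).le
        · obtain ⟨i, j, rfl, h1, h2⟩ := quad_fld.1 hσ
          obtain ⟨i', hi⟩ := (hE.exists_unique i h2).exists
          obtain ⟨j', hj⟩ := (hE.exists_unique j (h1.trans_lt h2)).exists
          refine ⟨pair i' j', quad_map_pair.2 ⟨h1, h2, (hE.mem _ _ hi).2, hi, hj⟩, fun τ hτ => ?_⟩
          obtain ⟨i₁, j₁, h, -, -, i', j', rfl, -, h4, h5⟩ := quad_map.1 hτ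
          obtain ⟨rfl, rfl⟩ := pair_inj.1 h
          rw [hE.eq_of_eq h4 hi, hE.eq_of_eq h5 hj]
        · obtain ⟨i, j, rfl, h1, h2, i', j', rfl, h3, h4, h5⟩ := quad_map.1 h
          obtain ⟨k, l, rfl, h1', h2', k', l', rfl, h3', h4', h5'⟩ := quad_map.1 h'
          have hmono : ∀ {a b a' b'}, FinApp f a a' → FinApp f b b' → a < b → a' < b' :=
            fun ha hb hab => (hE.lt_of_lt _ _ _ _ ha hb ⟨hab, (hE.mem _ _ hb).1⟩).1
          have hinj : ∀ {a b a' b'}, FinApp f a a' → FinApp f b b' → (a = b ↔ a' = b') := by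
            intro a b a' b' ha hb
            constructor
            · rintro rfl; exact hE.eq_of_eq ha hb
            · rintro rfl; exact hE.inj (seg_isLinear _) (seg_isLinear _) ha hb
          replace hlt := quad_lt_pair.1 hlt
          refine quad_lt_pair.2 ?_
          have hle : ∀ {a b a' b'}, FinApp f a a' → FinApp f b b' → a ≤ b → a' ≤ b' := by
            intro a b a' b' ha hb hab
            rcases hab.lt_or_eq with hab | hab
            · exact (hmono ha hb hab).le
            · exact ((hinj ha hb).1 hab).le
          refine ⟨hle h5 h4 h1, h3, hle h5' h4' h1', h3', ?_⟩
          rcases hlt.2.2.2.2 with h | ⟨h, hh, h''⟩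
          · exact .inl (hmono h4 h4' h)
          · refine .inr ⟨(hinj h4 h4').1 h, fun h => hh ((hinj h5' h4').2 h), ?_⟩
            exact h''.imp (hinj h5 h4).1 (hmono h5 h5')
      map_id := fun n f hf hid σ hσ => by
        obtain ⟨i, j, rfl, h1, h2⟩ := quad_fld.1 hσ
        exact quad_map_pair.2 ⟨h1, h2, h2, hid i h2, hid j (h1.trans_lt h2)⟩
      map_comp := fun n m k f g h hf hg hh hcomp σ τ ρ hστ hτρ => by
        obtain ⟨i, j, rfl, h1, h2, i', j', rfl, h3, h4, h5⟩ := quad_map.1 hστ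
        obtain ⟨i₁, j₁, e, -, -, i'', j'', rfl, h3', h4', h5'⟩ := quad_map.1 hτρ
        obtain ⟨rfl, rfl⟩ := pair_inj.1 e
        exact quad_map_pair.2 ⟨h1, h2, h3', hcomp _ _ _ h4 h4', hcomp _ _ _ h5 h5'⟩ }
  supp_exists_unique n σ hσ := by
    obtain ⟨i, j, rfl, h1, h2⟩ := quad_fld.1 hσ
    exact ⟨dbl i j, quad_supp_pair.2 ⟨h1, h2, rfl⟩, fun a ha => (quad_supp_pair.1 ha).2.2⟩
  supp_finite n σ hσ a ha := by
    obtain ⟨i, j, rfl, h1, h2, rfl⟩ := quad_supp.1 ha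
    refine ⟨isFinSet_dbl _ _, fun l hl => ?_⟩
    rcases inCode_dbl.1 hl with rfl | rfl
    exacts [h2, h1.trans_lt h2]
  supp_natural n m f hf σ τ a b hστ ha hb l := by
    have hE := hf.2.2
    obtain ⟨i, j, rfl, h1, h2, i', j', rfl, h3, h4, h5⟩ := quad_map.1 hστ
    obtain ⟨-, -, rfl⟩ := quad_supp_pair.1 ha
    obtain ⟨-, -, rfl⟩ := quad_supp_pair.1 hb
    simp only [inCode_dbl]
    constructor
    · rintro (rfl | rfl)
      exacts [⟨i, .inl rfl, h4⟩, ⟨j, .inr rfl, h5⟩]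
    · rintro ⟨_, rfl | rfl, h⟩
      exacts [.inl (hE.eq_of_eq h h4), .inr (hE.eq_of_eq h h5)]
  supp_condition n σ hσ a ha := by
    obtain ⟨i, j, rfl, h1, h2, rfl⟩ := quad_supp.1 ha
    obtain ⟨k, e, he⟩ := exists_enum (seg_isLinear n) (seg_isInternal n) (isFinSet_dbl i j)
      (fun x hx => by
        rcases inCode_dbl.1 hx with rfl | rfl
        exacts [h2, h1.trans_lt h2])
    have hE := he.2.1.2.2
    obtain ⟨i', hi⟩ := (he.2.2 i).1 (by simp)
    obtain ⟨j', hj⟩ := (he.2.2 j).1 (by simp)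
    have hle : j' ≤ i' := by
      by_contra h
      exact not_lt.2 h1 (hE.lt_of_lt _ _ _ _ hi hj ⟨not_le.1 h, (hE.mem _ _ hj).1⟩).1
    have hik := (hE.mem _ _ hi).1
    exact ⟨k, e, he, pair i' j', quad_fld_pair.2 ⟨hle, hik⟩,
      quad_map_pair.2 ⟨hle, hik, h2, hi, hj⟩⟩

theorem quad_isNormalPraeDilator : (Q).IsNormalPraeDilator where
  isPraeDilator := quad_isPraeDilator
  isSet_mu := by dsimp only [quadDilator]; exact isSet_of_delta _
  mu_embedding n := by
    refine ⟨fun i σ h => ?_,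
      fun i hi => ⟨pair i i, quad_mu.2 ⟨hi, rfl⟩, fun σ h => (quad_mu.1 h).2⟩,
      fun i j σ τ h h' hij => ?_⟩
    · obtain ⟨h1, rfl⟩ := quad_mu.1 h
      exact ⟨h1, quad_fld_pair.2 ⟨le_rfl, h1⟩⟩
    · obtain ⟨h1, rfl⟩ := quad_mu.1 h
      obtain ⟨h2, rfl⟩ := quad_mu.1 h'
      exact quad_lt_pair.2 ⟨le_rfl, h1, le_rfl, h2, .inl hij.1⟩
  mu_natural n m f hf i j σ τ hij h h' := by
    obtain ⟨h1, rfl⟩ := quad_mu.1 h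
    obtain ⟨h2, rfl⟩ := quad_mu.1 h'
    exact quad_map_pair.2 ⟨le_rfl, h1, h2, hij, hij⟩
  mu_lt_iff n m hm σ hσ τ a h ha := by
    obtain ⟨h1, rfl⟩ := quad_mu.1 h
    obtain ⟨i, j, rfl, h3, h4, rfl⟩ := quad_supp.1 ha
    rw [quad_lt_pair]
    simp only [inCode_dbl]
    constructor
    · rintro ⟨-, -, -, -, h | ⟨-, h, -⟩⟩
      · rintro l (rfl | rfl)
        exacts [h, h3.trans_lt h]
      · exact (h rfl).elim
    · exact fun h => ⟨h3, h4, le_rfl, h1, .inl (h i (.inl rfl))⟩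

end Quadratic

section WellOrders

variable {M : Type*} [L2Structure M] [hM : Fact (IsModelRCA0 M)] {n : ℕ}

/-! ### Well-foundedness and definable functions -/

/-- Total and single-valued `Σ⁰₁`-relations are graphs of definable functions. -/
theorem exists_fn (R : M → M → Prop) [hR : Sig (fun e : Fin 2 → M => R (e 0) (e 1))]
    (htot : ∀ n, ∃ x, R n x) (hu : ∀ n x x', R n x → R n x' → x = x') :
    ∃ G : M → M, Fn (fun e : Fin 1 → M => G (e 0)) ∧ ∀ n, R n (G n) := by
  have := hR.at2
  choose G hG using htot
  refine ⟨G, ⟨?_⟩, hG⟩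
  exact (inferInstance : Sig fun e : Fin 2 → M => R (e (Fin.succ 0)) (e 0)).congr fun e =>
    ⟨fun h => hu _ _ _ h (hG _), fun h => by rw [h]; exact hG _⟩

/-- Well-foundedness, in terms of definable functions. -/
theorem isWellFounded_iff {X : Order M} : X.IsWellFounded ↔
    ¬ ∃ G : M → M, Fn (fun e : Fin 1 → M => G (e 0)) ∧ (∀ n, G n ∈ X.fld) ∧
      ∀ n, X.lt (G (n + 1)) (G n) := by
  refine not_congr ⟨?_, ?_⟩
  · rintro ⟨g, hg, h1, h2, h3⟩
    have := Fact.mk hg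
    obtain ⟨G, hG, hG'⟩ := exists_fn (fun n x => pair n x ∈ g) (fun n => (h1 n).exists)
      fun n _ _ => (h1 n).unique
    exact ⟨G, hG, fun n => h2 n _ (hG' n), fun n => h3 n _ _ (hG' n) (hG' (n + 1))⟩
  · rintro ⟨G, hG, h1, h2⟩
    have := hG.at1
    have key : ∀ n x, pair n x ∈ {z : M | ∃ n x, z = pair n x ∧ x = G n} ↔ x = G n :=
      fun n x => pair_mem_iff
    refine ⟨_, isSet_pairs fun n x => x = G n,
      fun n => ⟨G n, (key _ _).2 rfl, fun y => (key _ _).1⟩,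
      fun n x h => ?_, fun n x y h h' => ?_⟩
    · rw [key] at h; exact h ▸ h1 n
    · rw [key] at h h'; rw [h, h']; exact h2 n

/-- A weakly descending sequence that never becomes constant has a strictly descending
subsequence. -/
theorem not_isWellFounded_of_weakly_descending {X : Order M} (hX : X.IsLinear) (hXi : X.IsInternal)
    (x : M → M) [hx : Fn (fun e : Fin 1 → M => x (e 0))] (hxX : ∀ n, x n ∈ X.fld)
    (hle : ∀ n, x (n + 1) = x n ∨ X.lt (x (n + 1)) (x n))
    (hinf : ∀ n, ∃ m, n ≤ m ∧ X.lt (x (m + 1)) (x m)) : ¬ X.IsWellFounded := by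
  have : Fact X.IsInternal := ⟨hXi⟩
  have := hx.at1
  have hanti : ∀ n d, x (n + d) = x n ∨ X.lt (x (n + d)) (x n) := by
    intro n
    refine sigma_induction (fun d => x (n + d) = x n ∨ X.lt (x (n + d)) (x n))
      (by simp) fun d ih => ?_
    have := hle (n + d)
    rw [← add_assoc]
    rcases this with h | h
    · rwa [h]
    · rcases ih with h' | h'
      · rw [h'] at h; exact .inr h
      · exact .inr (hX.trans _ _ _ h h')
  let F : M → M → Prop := fun n n' => ∃ m, n ≤ m ∧ n' = m + 1 ∧ X.lt (x (m + 1)) (x m) ∧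
      ∀ l, l < m → n ≤ l → ¬ X.lt (x (l + 1)) (x l)
  have hF : Sig fun e : Fin 2 → M => F (e 0) (e 1) := by unfold F; infer_instance
  obtain ⟨g, hg, -, hg', -⟩ := exists_iterate (fun n : M => n = n) F 0 rfl
    (by
      intro n _
      obtain ⟨m, hm⟩ := hinf n
      obtain ⟨m, hm, hmin⟩ := exists_least (fun m => n ≤ m ∧ X.lt (x (m + 1)) (x m)) hm
      refine ⟨m + 1, ⟨m, hm.1, rfl, hm.2, fun l hl hnl h => hmin l hl ⟨hnl, h⟩⟩, rfl⟩)
    (by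
      rintro n y y' ⟨m, h1, rfl, h2, h3⟩ ⟨m', h1', rfl, h2', h3'⟩
      rcases lt_trichotomy m m' with h | h | h
      · exact (h3' _ h h1 h2).elim
      · rw [h]
      · exact (h3 _ h h1' h2').elim)
  rw [isWellFounded_iff, not_not]
  have := hg.at1
  refine ⟨fun n => x (g n), inferInstance, fun n => hxX _, fun n => ?_⟩
  obtain ⟨m, h1, h2, h3, -⟩ := hg' n
  obtain ⟨d, rfl⟩ := le_iff_exists_add'.1 h1
  show X.lt (x (g (n + 1))) (x (g n))
  rw [h2]
  rcases hanti (g n) d with h | h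
  · rwa [h] at h3
  · exact hX.trans _ _ _ h3 h

/-! ### The order `D^T(X)` for the quadratic dilator -/

local notation "Q" => quadDilator M

theorem one_lt_two' : (1 : M) < 1 + 1 := lt_succ_self' 1

theorem lt_two_iff {i : M} : i < 1 + 1 ↔ i = 0 ∨ i = 1 := by
  rw [lt_succ_iff, le_iff_lt_or_eq']
  simp

/-- The enumeration of the set `{y, x}` that underlies an element of `D^T(X)`. -/
theorem exists_enum_quad {X : Order M} (hX : X.IsLinear) {x y : M} (hx : x ∈ X.fld)
    (hy : y = x ∨ X.lt y x) : ∃ k e i j, IsEnum X (dbl x y) k e ∧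
      quad x y = pair (dbl x y) (pair i j) ∧ j ≤ i ∧ (∀ l, l < k ↔ l = i ∨ l = j) ∧
      FinApp e i x ∧ FinApp e j y := by
  rcases hy with rfl | hy
  · obtain ⟨e, he, he'⟩ := exists_embedding X 1 (fun _ z => z = y) (fun _ _ => ⟨y, rfl⟩)
      (by rintro _ _ _ - rfl rfl; rfl) (by rintro _ _ - rfl; exact hx)
      (by
        rintro i i' _ _ hi hi' - -
        rw [Order.lt_one_iff] at hi'
        exact (not_lt_zero (hi' ▸ hi)).elim)
    have he0 : FinApp e 0 y := (he' _ _).2 ⟨one_pos, rfl⟩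
    refine ⟨1, e, 0, 0, ⟨isFinSet_dbl _ _, he, fun z => ?_⟩, by simp [quad], le_rfl, by simp,
      he0, he0⟩
    simp only [inCode_dbl, or_self, he']
    exact ⟨fun h => ⟨0, one_pos, h⟩, fun ⟨i, h⟩ => h.2⟩
  · have hne : x ≠ y := by rintro rfl; exact hX.irrefl _ hy
    obtain ⟨e, he, he'⟩ := exists_embedding X (1 + 1) (fun i z => (i = 0 ∧ z = y) ∨ (i = 1 ∧ z = x))
      (fun i hi => by
        rcases lt_two_iff.1 hi with h | h
        exacts [⟨y, .inl ⟨h, rfl⟩⟩, ⟨x, .inr ⟨h, rfl⟩⟩])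
      (by
        rintro i j j' - (⟨rfl, rfl⟩ | ⟨rfl, rfl⟩) (⟨h, rfl⟩ | ⟨h, rfl⟩)
        · rfl
        · exact (zero_ne_one h).elim
        · exact (zero_ne_one h.symm).elim
        · rfl)
      (by
        rintro i j - (⟨rfl, rfl⟩ | ⟨rfl, rfl⟩)
        exacts [(hX.lt_mem _ _ hy).1, hx])
      (by
        rintro i i' j j' hi - (⟨rfl, rfl⟩ | ⟨rfl, rfl⟩) (⟨rfl, rfl⟩ | ⟨rfl, rfl⟩)
        · exact (lt_irrefl _ hi).elim
        · exact hy
        · exact (not_lt_zero hi).elim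
        · exact (lt_irrefl _ hi).elim)
    have he0 : FinApp e 0 y := (he' _ _).2 ⟨zero_lt_one.trans one_lt_two', .inl ⟨rfl, rfl⟩⟩
    have he1 : FinApp e 1 x := (he' _ _).2 ⟨one_lt_two', .inr ⟨rfl, rfl⟩⟩
    refine ⟨1 + 1, e, 1, 0, ⟨isFinSet_dbl _ _, he, fun z => ?_⟩, by simp [quad, hne], zero_le,
      fun l => lt_two_iff.trans or_comm, he1, he0⟩
    rw [inCode_dbl]
    constructor
    · rintro (rfl | rfl)
      exacts [⟨1, he1⟩, ⟨0, he0⟩]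
    · rintro ⟨i, hi⟩
      rcases (he' _ _).1 hi with ⟨-, ⟨-, h⟩ | ⟨-, h⟩⟩
      exacts [.inr h, .inl h]

/-- The elements of `D^T(X)` correspond to pairs `y ≤ x` in `X`. -/
theorem quad_dMem_iff {X : Order M} (hX : X.IsLinear) {z : M} :
    (Q).DMem X z ↔ ∃ x y, x ∈ X.fld ∧ (y = x ∨ X.lt y x) ∧ z = quad x y := by
  constructor
  · rintro ⟨a, σ, k, e, c, rfl, he, hσ, hc, hck⟩
    have hE := he.2.1.2.2
    obtain ⟨i, j, rfl, h1, h2, rfl⟩ := quad_supp.1 hc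
    simp only [inCode_dbl] at hck
    rcases Arith.eq_zero_or_succ i with rfl | ⟨i, rfl⟩
    · obtain rfl : j = 0 := by simpa using h1
      obtain ⟨x, hx⟩ := (hE.exists_unique 0 h2).exists
      refine ⟨x, x, (hE.mem _ _ hx).2, .inl rfl, ?_⟩
      rw [show quad x x = pair (dbl x x) (pair 0 0) by simp [quad]]
      congr 1
      refine he.1.ext (isFinSet_dbl _ _) fun z => ?_
      rw [he.2.2, inCode_dbl, or_self]
      constructor
      · rintro ⟨l, hl⟩
        obtain rfl : l = 0 := by simpa using (hck l).2 (hE.mem _ _ hl).1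
        exact hE.eq_of_eq hl hx
      · rintro rfl; exact ⟨0, hx⟩
    · have hk0 : 0 < k := zero_le.trans_lt h2
      obtain rfl : j = 0 := by
        rcases (hck 0).2 hk0 with h | h
        · exact (hM.out.succ_ne_zero i h.symm).elim
        · exact h.symm
      have h1k : 1 < k + 0 → i + 1 = 1 := fun h => by
        rcases (hck 1).2 (by simpa using h) with h | h
        · exact h.symm
        · exact (one_ne_zero h).elim
      have hi1 : i + 1 = 1 := by
        refine h1k (lt_of_le_of_lt ?_ (h2.trans_eq (add_zero k).symm))
        exact self_le_add_left _ _
      have h2' : 1 < k := hi1 ▸ h2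
      simp only [hi1] at hck ⊢
      obtain ⟨x, hx⟩ := (hE.exists_unique 1 h2').exists
      obtain ⟨y, hy⟩ := (hE.exists_unique 0 hk0).exists
      have hyx := hE.lt_of_lt _ _ _ _ hy hx ⟨zero_lt_one, h2'⟩
      have hne : x ≠ y := by rintro rfl; exact hX.irrefl _ hyx
      refine ⟨x, y, (hE.mem _ _ hx).2, .inr hyx, ?_⟩
      rw [show quad x y = pair (dbl x y) (pair 1 0) by simp [quad, hne]]
      congr 1
      refine he.1.ext (isFinSet_dbl _ _) fun z => ?_
      rw [he.2.2, inCode_dbl]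
      constructor
      · rintro ⟨l, hl⟩
        rcases (hck l).2 (hE.mem _ _ hl).1 with rfl | rfl
        exacts [.inl (hE.eq_of_eq hl hx), .inr (hE.eq_of_eq hl hy)]
      · rintro (rfl | rfl)
        exacts [⟨1, hx⟩, ⟨0, hy⟩]
  · rintro ⟨x, y, hx, hy, rfl⟩
    obtain ⟨k, e, i, j, he, h1, h2, h3, -⟩ := exists_enum_quad hX hx hy
    have hik : i < k := (h3 i).2 (.inl rfl)
    exact ⟨dbl x y, pair i j, k, e, dbl i j, h1, he, quad_fld_pair.2 ⟨h2, hik⟩,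
      quad_supp_pair.2 ⟨h2, hik, rfl⟩, fun l => by rw [inCode_dbl, h3]⟩

/-- The order `QuadLt` is preserved and reflected by increasing enumerations. -/
theorem IsEnum.quadLt_iff {X : Order M} (hX : X.IsLinear) {b k e p q p' q' x y x' y' : M}
    (he : IsEnum X b k e) (hp : FinApp e p x) (hq : FinApp e q y) (hp' : FinApp e p' x')
    (hq' : FinApp e q' y') : QuadLt (· < ·) p q p' q' ↔ QuadLt X.lt x y x' y' := by
  have hE := he.2.1.2.2
  have hlt : ∀ {i j x y}, FinApp e i x → FinApp e j y → (i < j ↔ X.lt x y) := fun hi hj => by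
    rw [← hE.lt_iff (seg_isLinear _) hX hi hj]
    exact ⟨fun h => ⟨h, (hE.mem _ _ hj).1⟩, fun h => h.1⟩
  have heq : ∀ {i j x y}, FinApp e i x → FinApp e j y → (i = j ↔ x = y) := by
    intro i j x y hi hj
    constructor
    · rintro rfl; exact hE.eq_of_eq hi hj
    · rintro rfl; exact hE.inj (seg_isLinear _) hX hi hj
  unfold QuadLt
  beta_reduce
  rw [hlt hp hp', heq hp hp', ne_eq, heq hq' hp', heq hq hp, hlt hq hq']

/-- On the elements `quad x y`, the order of `D^T(X)` is the order `QuadLt` induced by `X`. -/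
theorem quad_dLt_iff {X : Order M} (hX : X.IsLinear) (hXi : X.IsInternal) {x y x' y' : M}
    (hx : x ∈ X.fld) (hy : y = x ∨ X.lt y x) (hx' : x' ∈ X.fld) (hy' : y' = x' ∨ X.lt y' x') :
    (Q).DLt X (quad x y) (quad x' y') ↔ QuadLt X.lt x y x' y' := by
  obtain ⟨k₀, e₀, i, j, he₀, hq, hji, hk₀, hi, hj⟩ := exists_enum_quad hX hx hy
  obtain ⟨k₁, e₁, i', j', he₁, hq', hji', hk₁, hi', hj'⟩ := exists_enum_quad hX hx' hy'
  constructor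
  · rintro ⟨-, -, a₀, σ₀, l₀, d₀, a₁, σ₁, l₁, d₁, b, k, e, f₀, f₁, τ₀, τ₁, h1, he₀', h2, he₁', he,
      hb, hf₀, hf₀', hf₁, hf₁', hm₀, hm₁, hlt⟩
    rw [hq] at h1; rw [hq'] at h2
    obtain ⟨rfl, rfl⟩ := pair_inj.1 h1
    obtain ⟨rfl, rfl⟩ := pair_inj.1 h2
    obtain ⟨rfl, rfl⟩ := he₀.unique hX he₀'
    obtain ⟨rfl, rfl⟩ := he₁.unique hX he₁'
    have hE := he.2.1.2.2
    have aux : ∀ {k₀ e₀ f₀ i x p : M}, IsMorphism k₀ k f₀ →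
        (∀ i j x, FinApp f₀ i j → FinApp e j x → FinApp e₀ i x) →
        (∀ x', FinApp e₀ i x' → x' = x) → FinApp f₀ i p → FinApp e p x := by
      intro k₀ e₀ f₀ i x p hf hf' hu hp
      obtain ⟨x', hx'⟩ := (hE.exists_unique p (hf.2.2.mem _ _ hp).2).exists
      rwa [← hu x' (hf' _ _ _ hp hx')]
    obtain ⟨_, _, e, -, -, p, q, rfl, -, hp, hq⟩ := quad_map.1 hm₀
    obtain ⟨rfl, rfl⟩ := pair_inj.1 e
    obtain ⟨_, _, e, -, -, p', q', rfl, -, hp', hq'⟩ := quad_map.1 hm₁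
    obtain ⟨rfl, rfl⟩ := pair_inj.1 e
    have hu₀ := he₀.2.1.2.2
    have hu₁ := he₁.2.1.2.2
    rw [← he.quadLt_iff hX
      (aux hf₀ hf₀' (fun _ h => hu₀.eq_of_eq h hi) hp)
      (aux hf₀ hf₀' (fun _ h => hu₀.eq_of_eq h hj) hq)
      (aux hf₁ hf₁' (fun _ h => hu₁.eq_of_eq h hi') hp')
      (aux hf₁ hf₁' (fun _ h => hu₁.eq_of_eq h hj') hq')]
    exact (quad_lt_pair.1 hlt).2.2.2.2
  · intro h
    refine ⟨(quad_dMem_iff hX).2 ⟨x, y, hx, hy, rfl⟩, (quad_dMem_iff hX).2 ⟨x', y', hx', hy', rfl⟩,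
      ?_⟩
    have hmem : ∀ {x y}, x ∈ X.fld → y = x ∨ X.lt y x → y ∈ X.fld := by
      rintro x y hx (rfl | h)
      exacts [hx, (hX.lt_mem _ _ h).1]
    obtain ⟨b, hb, hb'⟩ := exists_union (dbl x y) (dbl x' y')
    obtain ⟨k, e, he⟩ := exists_enum hX hXi hb fun z hz => by
      rcases (hb' z).1 hz with h | h <;> rcases inCode_dbl.1 h with rfl | rfl
      exacts [hx, hmem hx hy, hx', hmem hx' hy']
    obtain ⟨f₀, hf₀, hf₀', hf₀''⟩ := exists_inclusion hX he₀ he fun z hz => (hb' z).2 (.inl hz)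
    obtain ⟨f₁, hf₁, hf₁', hf₁''⟩ := exists_inclusion hX he₁ he fun z hz => (hb' z).2 (.inr hz)
    obtain ⟨p, hp⟩ := (he.2.2 x).1 ((hb' _).2 (.inl (by simp)))
    obtain ⟨q, hq₁⟩ := (he.2.2 y).1 ((hb' _).2 (.inl (by simp)))
    obtain ⟨p', hp'⟩ := (he.2.2 x').1 ((hb' _).2 (.inr (by simp)))
    obtain ⟨q', hq₁'⟩ := (he.2.2 y').1 ((hb' _).2 (.inr (by simp)))
    have hE := he.2.1.2.2
    have m₀ : (Q).Map k₀ k f₀ (pair i j) (pair p q) := quad_map_pair.2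
      ⟨hji, (hk₀ i).2 (.inl rfl), (hE.mem _ _ hp).1, hf₀'' _ _ _ hi hp, hf₀'' _ _ _ hj hq₁⟩
    have m₁ : (Q).Map k₁ k f₁ (pair i' j') (pair p' q') := quad_map_pair.2
      ⟨hji', (hk₁ i').2 (.inl rfl), (hE.mem _ _ hp').1, hf₁'' _ _ _ hi' hp', hf₁'' _ _ _ hj' hq₁'⟩
    have hv₀ := ((quad_isPraeDilator.isFunctor.embedding _ _ _ hf₀).mem _ _ m₀).2
    have hv₁ := ((quad_isPraeDilator.isFunctor.embedding _ _ _ hf₁).mem _ _ m₁).2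
    have hv₀ := quad_fld_pair.1 hv₀
    have hv₁ := quad_fld_pair.1 hv₁
    exact ⟨_, _, _, _, _, _, _, _, b, k, e, f₀, f₁, pair p q, pair p' q', hq, he₀, hq', he₁, he,
      hb', hf₀, hf₀', hf₁, hf₁', m₀, m₁,
      quad_lt_pair.2 ⟨hv₀.1, hv₀.2, hv₁.1, hv₁.2, (he.quadLt_iff hX hp hq₁ hp' hq₁').2 h⟩⟩

theorem quad_inj {X : Order M} (hX : X.IsLinear) {x y x' y' : M}
    (hy : y = x ∨ X.lt y x) (hy' : y' = x' ∨ X.lt y' x') (h : quad x y = quad x' y') :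
    x = x' ∧ y = y' := by
  have hd : dbl x y = dbl x' y' := (pair_inj.1 h).1
  have h1 : ∀ z, z = x ∨ z = y ↔ z = x' ∨ z = y' := fun z => by rw [← inCode_dbl, hd, inCode_dbl]
  have hasymm : X.lt x x' → X.lt x' x → False := fun h h' => hX.asymm h h'
  have hir := hX.irrefl x
  have h2 := (h1 x).1 (.inl rfl)
  have h3 := (h1 y).1 (.inr rfl)
  have h4 := (h1 x').2 (.inl rfl)
  have h5 := (h1 y').2 (.inr rfl)
  grind

/-- In a descending sequence of pairs `(x, y)` the component `x` is weakly descending. If it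
descends infinitely often, then a subsequence of it is descending. Otherwise `x` is eventually
constant, and from there on the component `y` descends. -/
theorem quad_preservesWellOrders : (Q).PreservesWellOrders := by
  intro X hXi hX hwf
  have : Fact X.IsInternal := ⟨hXi⟩
  rw [isWellFounded_iff]
  rintro ⟨G, hG, hGm, hGlt⟩
  have hG' := hG.at1
  choose x y hx hy hxy using fun n => (quad_dMem_iff hX).1 (hGm n)
  have hlt : ∀ n, QuadLt X.lt (x (n + 1)) (y (n + 1)) (x n) (y n) := fun n => by
    have := hGlt n
    rw [hxy, hxy n] at this
    exact (quad_dLt_iff hX hXi (hx _) (hy _) (hx _) (hy _)).1 this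
  have hxF : Fn (fun e : Fin 1 → M => x (e 0)) := ⟨by
    refine (inferInstance : Sig fun e : Fin 2 → M => ∃ w, G (e (Fin.succ 0)) = quad (e 0) w ∧
      (w = e 0 ∨ X.lt w (e 0))).congr fun e => ⟨?_, fun h => ⟨y (e 1), ?_⟩⟩
    · rintro ⟨w, h, h'⟩
      rw [hxy] at h
      exact (quad_inj hX (hy _) h' h).1.symm
    · rw [h]; exact ⟨hxy _, hy _⟩⟩
  have hyF : Fn (fun e : Fin 1 → M => y (e 0)) := ⟨by
    refine (inferInstance : Sig fun e : Fin 2 → M => ∃ w, G (e (Fin.succ 0)) = quad w (e 0) ∧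
      (e 0 = w ∨ X.lt (e 0) w)).congr fun e => ⟨?_, fun h => ⟨x (e 1), ?_⟩⟩
    · rintro ⟨w, h, h'⟩
      rw [hxy] at h
      exact (quad_inj hX (hy _) h' h).2.symm
    · rw [h]; exact ⟨hxy _, hy _⟩⟩
  have hle : ∀ n, x (n + 1) = x n ∨ X.lt (x (n + 1)) (x n) := fun n => by
    rcases hlt n with h | h
    exacts [.inr h, .inl h.1]
  by_cases hinf : ∀ n, ∃ m, n ≤ m ∧ X.lt (x (m + 1)) (x m)
  · exact not_isWellFounded_of_weakly_descending hX hXi x hx hle hinf hwf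
  push Not at hinf
  obtain ⟨n₀, hn₀⟩ := hinf
  have hdesc : ∀ m, n₀ ≤ m → X.lt (y (m + 1)) (y m) := fun m hm => by
    obtain ⟨h1, h2, h3⟩ := (hlt m).resolve_left (hn₀ m hm)
    refine h3.resolve_left fun h4 => ?_
    obtain ⟨-, h2', -⟩ := (hlt (m + 1)).resolve_left (hn₀ (m + 1) (hm.trans (lt_succ_self' m).le))
    exact h2' h4
  have := hyF.at1
  refine isWellFounded_iff.1 hwf ⟨fun m => y (n₀ + m), inferInstance, fun m => ?_, fun m => ?_⟩
  · rcases hy (n₀ + m) with h | h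
    · show y (n₀ + m) ∈ X.fld
      rw [h]; exact hx _
    · exact (hX.lt_mem _ _ h).1
  · show X.lt (y (n₀ + (m + 1))) (y (n₀ + m))
    rw [← add_assoc]
    exact hdesc _ (self_le_add_right _ _)

theorem quad_isNormalDilator : (Q).IsNormalDilator :=
  ⟨quad_isNormalPraeDilator, quad_preservesWellOrders⟩

end WellOrders

/-! ### Upper derivatives of the quadratic dilator -/

section PraeDilatorLemmas

variable {M : Type*} [L2Structure M] [hM : Fact (IsModelRCA0 M)]

theorem PraeDilatorData.IsPraeDilator.obj_isInternal {S : PraeDilatorData M} (hS : S.IsPraeDilator)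
    (n : M) : (S.obj n).IsInternal := by
  have := Fact.mk hS.isSet_obj
  have := Fact.mk hS.isSet_lt
  exact ⟨isSet_of_delta fun σ => pair n σ ∈ S.objSet,
    isSet_pairs fun σ τ => pair n (pair σ τ) ∈ S.ltSet⟩

/-- The range of a morphism is a finite set, enumerated by that morphism. -/
theorem exists_range {n m g : M} (hg : IsMorphism n m g) : ∃ A, IsEnum (seg m) A n g := by
  obtain ⟨A, hA, hA'⟩ := exists_finSet (fun y => ∃ i, i < g ∧ FinApp g i y) g
    (by rintro y ⟨i, -, h⟩; exact h.lt.2)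
  exact ⟨A, hA, hg, fun y => (hA' y).trans ⟨fun ⟨i, _, h⟩ => ⟨i, h⟩, fun ⟨i, h⟩ => ⟨i, h.lt.1, h⟩⟩⟩

omit hM in
/-- A value `S(f)(σ)` lies below `μ(i)` if the range of `f` does: its support is contained in that
range. -/
theorem NormalData.IsNormalPraeDilator.map_lt_mu {S : NormalData M} (hS : S.IsNormalPraeDilator)
    {n m f σ τ i s : M} (hf : IsMorphism n m f) (hστ : S.Map n m f σ τ) (hi : i < m)
    (hfi : ∀ j l, FinApp f j l → l < i) (hs : S.Mu m i s) : (S.obj m).lt τ s := by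
  have hP := hS.isPraeDilator
  have hmem := (hP.isFunctor.embedding n m f hf).mem _ _ hστ
  obtain ⟨a, ha, -⟩ := hP.supp_exists_unique n σ hmem.1
  obtain ⟨b, hb, -⟩ := hP.supp_exists_unique m τ hmem.2
  rw [hS.mu_lt_iff m i hi τ hmem.2 s b hs hb]
  intro j hj
  obtain ⟨l, -, hl⟩ := (hP.supp_natural n m f hf σ τ a b hστ ha hb j).1 hj
  exact hfi _ _ hl

end PraeDilatorLemmas

namespace NormalData.IsUpperDerivative

variable {M : Type*} [L2Structure M] [hM : Fact (IsModelRCA0 M)] {S : NormalData M} {ξ : Set M}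
  (h : (quadDilator M).IsUpperDerivative S ξ)
include h

theorem isLinear (n : M) : (S.obj n).IsLinear := h.normal.isPraeDilator.isFunctor.linear n

theorem obj_isInternal (n : M) : (S.obj n).IsInternal := h.normal.isPraeDilator.obj_isInternal n

/-- The embedding `ξ_N` provides a product `w = ξ(u, v) ∈ S(N)` for any `v ≤ u` in `S(N)`. -/
theorem exists_prod {N u v : M} (hu : u ∈ (S.obj N).fld) (hv : v = u ∨ (S.obj N).lt v u) :
    ∃ w, pair N (pair (quad u v) w) ∈ ξ ∧ w ∈ (S.obj N).fld := by
  have hE := h.natTrans.embedding N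
  obtain ⟨w, hw⟩ := (hE.exists_unique (quad u v)
    ((quad_dMem_iff (h.isLinear N)).2 ⟨u, v, hu, hv, rfl⟩)).exists
  exact ⟨w, hw, (hE.mem _ _ hw).2⟩

theorem prod_unique {N z w w' : M} (hw : pair N (pair z w) ∈ ξ) (hw' : pair N (pair z w') ∈ ξ) :
    w = w' := (h.natTrans.embedding N).eq_of_eq hw hw'

theorem prod_lt {N u v w u' v' w' : M} (hu : u ∈ (S.obj N).fld)
    (hv : v = u ∨ (S.obj N).lt v u) (hu' : u' ∈ (S.obj N).fld)
    (hv' : v' = u' ∨ (S.obj N).lt v' u') (hw : pair N (pair (quad u v) w) ∈ ξ)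
    (hw' : pair N (pair (quad u' v') w') ∈ ξ) (hlt : QuadLt (S.obj N).lt u v u' v') :
    (S.obj N).lt w w' :=
  (h.natTrans.embedding N).lt_of_lt _ _ _ _ hw hw'
    ((quad_dLt_iff (h.isLinear N) (h.obj_isInternal N) hu hv hu' hv').2 hlt)

theorem mu_mem {N i s : M} (hs : S.Mu N i s) : i < N ∧ s ∈ (S.obj N).fld :=
  (h.normal.mu_embedding N).mem _ _ hs

/-- The condition `ξ ∘ μ^{T ∘ S} = μ^S` says that `ξ(μ(i), μ(i)) = μ(i)`. -/
theorem prod_mu {N i s : M} (hs : S.Mu N i s) : pair N (pair (quad s s) s) ∈ ξ := by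
  refine h.comp_mu N i _ s (h.mu_mem hs).1 ⟨s, hs, dbl s s, pair 0 0, by simp [quad],
    isFinSet_dbl _ _, fun y => by simp, quad_mu.2 ⟨one_pos, rfl⟩⟩ hs

/-- `μ(i) < ξ(μ(i), v)` for `v < μ(i)`. -/
theorem mu_lt_prod {N i s v w : M} (hs : S.Mu N i s) (hv : (S.obj N).lt v s)
    (hw : pair N (pair (quad s v) w) ∈ ξ) : (S.obj N).lt s w := by
  have hsm := (h.mu_mem hs).2
  refine h.prod_lt hsm (.inl rfl) hsm (.inr hv) (h.prod_mu hs) hw (.inr ⟨rfl, ?_, .inl rfl⟩)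
  rintro rfl; exact (h.isLinear N).irrefl _ hv

/-- Naturality of `ξ`: the map `S(f)` sends `ξ(u, v)` to `ξ(S(f)(u), S(f)(v))`. -/
theorem prod_natural {n m f u v w u' v' w' : M} (hf : IsMorphism n m f)
    (hv : (S.obj n).lt v u) (hu' : S.Map n m f u u') (hv' : S.Map n m f v v')
    (hw : pair n (pair (quad u v) w) ∈ ξ) (hw' : pair m (pair (quad u' v') w') ∈ ξ) :
    S.Map n m f w w' := by
  have hE := h.normal.isPraeDilator.isFunctor.embedding n m f hf
  have hvu' : (S.obj m).lt v' u' := hE.lt_of_lt _ _ _ _ hv' hu' hv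
  have hne : u ≠ v := by rintro rfl; exact (h.isLinear n).irrefl _ hv
  have hne' : u' ≠ v' := by rintro rfl; exact (h.isLinear m).irrefl _ hvu'
  refine h.natTrans.natural n m f hf _ _ _ _ ⟨(quad_dMem_iff (h.isLinear n)).2
    ⟨u, v, (hE.mem _ _ hu').1, .inr hv, rfl⟩, dbl u v, pair 1 0, dbl u' v', by simp [quad, hne],
    by simp [quad, hne'], isFinSet_dbl _ _, fun y => ?_⟩ hw hw'
  simp only [inCode_dbl]
  constructor
  · rintro (rfl | rfl)
    exacts [⟨u, .inl rfl, hu'⟩, ⟨v, .inr rfl, hv'⟩]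
  · rintro ⟨_, rfl | rfl, h⟩
    exacts [.inl (hE.eq_of_eq h hu'), .inr (hE.eq_of_eq h hv')]

/-- `f` codes the inclusion of `k` into larger numbers. -/
def _root_.SOA.IsIncl (k f : M) : Prop := IsFinSet f ∧ (∀ z, InCode z f → ∃ i j, z = pair i j) ∧
  (∀ i j, FinApp f i j → i < k ∧ j = i) ∧ ∀ i, i < k → FinApp f i i

omit h in
theorem _root_.SOA.exists_isIncl (k : M) : ∃ f, IsIncl k f ∧ ∀ m, k ≤ m → IsMorphism k m f := by
  obtain ⟨f, hf, hf'⟩ := exists_embedding (seg k) k (fun i j => j = i) (fun i _ => ⟨i, rfl⟩)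
    (by rintro i j j' - rfl rfl; rfl) (by rintro i j hi rfl; exact hi)
    (by rintro i i' j j' hi hi' rfl rfl; exact ⟨hi, hi'⟩)
  refine ⟨f, ⟨hf.1, hf.2.1, fun i j => (hf' i j).1, fun i hi => (hf' i i).2 ⟨hi, rfl⟩⟩,
    fun m hm => (isFinEmbedding_seg_iff _).2 ⟨hf.1, hf.2.1, fun i j hij => ?_, fun i hi => ?_,
      fun i j hij i' j' hij' => ?_⟩⟩
  · obtain ⟨h1, rfl⟩ := (hf' _ _).1 hij
    exact ⟨h1, h1.trans_le hm⟩
  · exact ⟨i, (hf' i i).2 ⟨hi, rfl⟩⟩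
  · obtain ⟨h1, rfl⟩ := (hf' _ _).1 hij
    obtain ⟨h1', rfl⟩ := (hf' _ _).1 hij'
    exact ⟨id, fun hlt => ⟨hlt, h1'.trans_le hm⟩⟩

omit h in
theorem _root_.SOA.IsIncl.isMorphism {k f m : M} (hf : IsIncl k f) (hm : k ≤ m) :
    IsMorphism k m f := by
  obtain ⟨g, hg, hg'⟩ := exists_isIncl k
  have : f = g := hf.1.ext hg.1 fun z => ⟨fun hz => ?_, fun hz => ?_⟩
  · exact this ▸ hg' m hm
  · obtain ⟨i, j, rfl⟩ := hf.2.1 z hz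
    obtain ⟨hi, rfl⟩ := hf.2.2.1 i j hz
    exact hg.2.2.2 _ hi
  · obtain ⟨i, j, rfl⟩ := hg.2.1 z hz
    obtain ⟨hi, rfl⟩ := hg.2.2.1 i j hz
    exact hf.2.2.2 _ hi

/-- The relation `σ' = ξ(μ(t + 1), S(ι)(σ))` between `σ ∈ S(t + 1)` and `σ' ∈ S(t + 2)`, where
`ι : t + 1 → t + 2` is the inclusion. -/
def Step (S : NormalData M) (ξ : Set M) (t σ σ' : M) : Prop :=
  ∃ f u v, IsIncl (t + 1) f ∧ S.Map (t + 1) (t + 1 + 1) f σ v ∧ S.Mu (t + 1 + 1) (t + 1) u ∧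
    pair (t + 1 + 1) (pair (quad u v) σ') ∈ ξ

theorem step_exists {t σ : M} (hσ : σ ∈ (S.obj (t + 1)).fld) :
    ∃ σ', Step S ξ t σ σ' ∧ σ' ∈ (S.obj (t + 1 + 1)).fld := by
  obtain ⟨f, hf, hf'⟩ := exists_isIncl (t + 1)
  have hf' := hf' (t + 1 + 1) (lt_succ_self' _).le
  obtain ⟨v, hv⟩ := ((h.normal.isPraeDilator.isFunctor.embedding _ _ _ hf').exists_unique σ
    hσ).exists
  obtain ⟨u, hu⟩ := ((h.normal.mu_embedding (t + 1 + 1)).exists_unique (t + 1)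
    (lt_succ_self' _)).exists
  have hvu := h.normal.map_lt_mu hf' hv (lt_succ_self' _)
    (fun j l hjl => by rw [(hf.2.2.1 _ _ hjl).2]; exact (hf.2.2.1 _ _ hjl).1) hu
  obtain ⟨w, hw, hw'⟩ := h.exists_prod (h.mu_mem hu).2 (.inr hvu)
  exact ⟨w, ⟨f, u, v, hf, hv, hu, hw⟩, hw'⟩

theorem step_unique {t σ σ' σ'' : M} (h' : Step S ξ t σ σ') (h'' : Step S ξ t σ σ'') :
    σ' = σ'' := by
  obtain ⟨f, u, v, hf, hv, hu, hw⟩ := h'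
  obtain ⟨g, u', v', hg, hv', hu', hw'⟩ := h''
  have hfg : f = g := (hf.isMorphism (lt_succ_self' (t + 1)).le).code_ext
    (hg.isMorphism (lt_succ_self' (t + 1)).le) fun i j =>
      ⟨fun h1 => by obtain ⟨h1, rfl⟩ := hf.2.2.1 _ _ h1; exact hg.2.2.2 _ h1,
        fun h1 => by obtain ⟨h1, rfl⟩ := hg.2.2.1 _ _ h1; exact hf.2.2.2 _ h1⟩
  subst hfg
  obtain rfl := (h.normal.mu_embedding (t + 1 + 1)).eq_of_eq hu hu'
  obtain rfl := (h.normal.isPraeDilator.isFunctor.embedding _ _ _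
    (hf.isMorphism (lt_succ_self' (t + 1)).le)).eq_of_eq hv hv'
  exact h.prod_unique hw hw'

/-- A definable sequence `G` with `G(0) = μ_1(0)` and `G(t + 1) = ξ(μ(t + 1), G(t))`, where
`G(t) ∈ S(t + 1)` is identified with its image in `S(t + 2)`. -/
structure _root_.SOA.NormalData.IsTower (S : NormalData M) (ξ : Set M) (G : M → M) : Prop where
  fn : Fn (fun e : Fin 1 → M => G (e 0))
  zero : S.Mu 1 0 (G 0)
  mem : ∀ t, G t ∈ (S.obj (t + 1)).fld
  step : ∀ t, Step S ξ t (G t) (G (t + 1))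

theorem exists_tower : ∃ G, S.IsTower ξ G := by
  have := Fact.mk h.normal.isPraeDilator.isSet_obj
  have := Fact.mk h.normal.isPraeDilator.isSet_map
  have := Fact.mk h.normal.isSet_mu
  have := Fact.mk h.natTrans.isSet
  have hstep : Sig fun e : Fin 3 → M => Step S ξ (e 0) (e 1) (e 2) := by
    unfold Step IsIncl NormalData.Mu PraeDilatorData.Map; infer_instance
  have hstep := hstep.at3
  let F : M → M → Prop := fun x y => ∃ t σ σ', x = pair t σ ∧ y = pair (t + 1) σ' ∧ Step S ξ t σ σ'
  let D : M → Prop := fun x => ∃ t σ, x = pair t σ ∧ pair (t + 1) σ ∈ S.objSet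
  have hF : Sig fun e : Fin 2 → M => F (e 0) (e 1) := by unfold F; infer_instance
  have hD : Sig fun e : Fin 1 → M => D (e 0) := by unfold D; infer_instance
  obtain ⟨u, hu⟩ := ((h.normal.mu_embedding 1).exists_unique 0 (one_pos : (0 : M) < 1)).exists
  have hu' : pair (0 + 1) u ∈ S.objSet := by rw [zero_add]; exact (h.mu_mem hu).2
  obtain ⟨g, hg, hg0, hgs, hgD⟩ := exists_iterate D F (pair 0 u) ⟨0, u, rfl, hu'⟩
    (by
      rintro _ ⟨t, σ, rfl, hσ⟩
      obtain ⟨σ', h1, h2⟩ := h.step_exists hσ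
      exact ⟨_, ⟨t, σ, σ', rfl, rfl, h1⟩, t + 1, σ', rfl, h2⟩)
    (by
      rintro _ _ _ ⟨t, σ, σ', rfl, rfl, h1⟩ ⟨t₁, σ₁, σ'', h2, rfl, h3⟩
      obtain ⟨rfl, rfl⟩ := pair_inj.1 h2
      rw [h.step_unique h1 h3])
  have := hg.at1
  have key : ∀ t, ∃ σ, g t = pair t σ := by
    refine sigma_induction (fun t => ∃ σ, g t = pair t σ) ⟨u, hg0⟩ ?_
    rintro t ⟨σ, hσ⟩
    obtain ⟨t₁, σ₁, σ', h1, h2, -⟩ := hgs t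
    rw [hσ] at h1
    rw [(pair_inj.1 h1).1]
    rw [(pair_inj.1 h1).1] at h2
    exact ⟨σ', h2⟩
  choose G hG using key
  refine ⟨G, ⟨?_⟩, ?_, fun t => ?_, fun t => ?_⟩
  · refine (inferInstance : Sig fun e : Fin 2 → M => g (e (Fin.succ 0)) =
      pair (e (Fin.succ 0)) (e 0)).congr fun e => ?_
    rw [hG, pair_inj]
    exact ⟨fun h => h.2.symm, fun h => ⟨rfl, h.symm⟩⟩
  · rw [hG] at hg0
    rw [(pair_inj.1 hg0).2]
    exact hu
  · obtain ⟨t', σ, h1, h2⟩ := hgD t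
    rw [hG] at h1
    obtain ⟨rfl, rfl⟩ := pair_inj.1 h1
    exact h2
  · obtain ⟨t', σ, σ', h1, h2, h3⟩ := hgs t
    rw [hG] at h1 h2
    obtain ⟨rfl, rfl⟩ := pair_inj.1 h1
    obtain ⟨-, rfl⟩ := pair_inj.1 h2
    exact h3

end NormalData.IsUpperDerivative

/-! ### Comparison of tower elements -/

section Skip

variable {M : Type*} [L2Structure M] [hM : Fact (IsModelRCA0 M)]

/-- The morphism `n → n + 1` whose range omits `p`. -/
theorem exists_skip (n p : M) : ∃ f, IsMorphism n (n + 1) f ∧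
    ∀ j l, FinApp f j l ↔ j < n ∧ (j < p ∧ l = j ∨ p ≤ j ∧ l = j + 1) := by
  refine exists_embedding (seg (n + 1)) n (fun j l => j < p ∧ l = j ∨ p ≤ j ∧ l = j + 1)
    (fun j _ => ?_) ?_ ?_ ?_
  · rcases lt_or_ge j p with h | h
    exacts [⟨j, .inl ⟨h, rfl⟩⟩, ⟨j + 1, .inr ⟨h, rfl⟩⟩]
  · rintro i j j' - (⟨h, rfl⟩ | ⟨h, rfl⟩) (⟨h', rfl⟩ | ⟨h', rfl⟩)
    exacts [rfl, (not_le.2 h h').elim, (not_le.2 h' h).elim, rfl]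
  · rintro i j hi (⟨h, rfl⟩ | ⟨h, rfl⟩)
    exacts [hi.trans (lt_succ_self' n), (add_lt_add_iff_right 1).2 hi]
  · rintro i i' j j' hi hn (⟨h, rfl⟩ | ⟨h, rfl⟩) (⟨h', rfl⟩ | ⟨h', rfl⟩)
    · exact ⟨hi, hn.trans (lt_succ_self' n)⟩
    · exact ⟨hi.trans (lt_succ_self' _), (add_lt_add_iff_right 1).2 hn⟩
    · exact (not_le.2 (hi.trans h') h).elim
    · exact ⟨(add_lt_add_iff_right 1).2 hi, (add_lt_add_iff_right 1).2 hn⟩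

end Skip

namespace NormalData

variable {M : Type*} [L2Structure M] [hM : Fact (IsModelRCA0 M)]

/-- `w ∈ S(N)` is the image of `G(t) ∈ S(t + 1)` under the increasing enumeration of the set
`A ⊆ N` with `t + 1` elements. -/
def TowerAt (S : NormalData M) (G : M → M) (N A w : M) : Prop :=
  ∃ t e, IsEnum (seg N) A (t + 1) e ∧ S.Map (t + 1) N e (G t) w

namespace TowerAt

variable {S : NormalData M} {ξ : Set M} {G : M → M} {N A w : M}

theorem sig (hS : S.IsNormalPraeDilator) (hG : S.IsTower ξ G) (N : M) :
    Sig fun e : Fin 2 → M => S.TowerAt G N (e 0) (e 1) := by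
  have := Fact.mk hS.isPraeDilator.isSet_map
  have := hG.fn.at1
  unfold TowerAt PraeDilatorData.Map
  infer_instance

omit hM in
theorem isFinSet (h : S.TowerAt G N A w) : IsFinSet A := by
  obtain ⟨t, e, he, -⟩ := h
  exact he.1

omit hM in
theorem lt_of_mem (h : S.TowerAt G N A w) {i : M} (hi : InCode i A) : i < N := by
  obtain ⟨t, e, he, -⟩ := h
  obtain ⟨j, hj⟩ := (he.2.2 i).1 hi
  exact (he.2.1.2.2.mem _ _ hj).2

theorem unique (hS : S.IsNormalPraeDilator) {w' : M} (h : S.TowerAt G N A w)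
    (h' : S.TowerAt G N A w') : w = w' := by
  obtain ⟨t, e, he, hw⟩ := h
  obtain ⟨t', e', he', hw'⟩ := h'
  obtain ⟨h1, rfl⟩ := he.unique (seg_isLinear N) he'
  obtain rfl := add_right_cancel h1
  exact (hS.isPraeDilator.isFunctor.embedding _ _ _ he.2.1).eq_of_eq hw hw'

theorem exists_of_nonempty (hS : S.IsNormalPraeDilator) (hG : S.IsTower ξ G) {x : M}
    (hA : IsFinSet A) (hAN : ∀ i, InCode i A → i < N) (hx : InCode x A) :
    ∃ w, S.TowerAt G N A w := by
  obtain ⟨k, e, he⟩ := exists_enum (seg_isLinear N) (seg_isInternal N) hA hAN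
  obtain ⟨i, hi⟩ := (he.2.2 x).1 hx
  rcases Arith.eq_zero_or_succ k with rfl | ⟨t, rfl⟩
  · exact (not_lt_zero (show i < 0 from (he.2.1.2.2.mem _ _ hi).1)).elim
  · obtain ⟨w, hw⟩ := ((hS.isPraeDilator.isFunctor.embedding _ _ _ he.2.1).exists_unique _
      (hG.mem t)).exists
    exact ⟨w, t, e, he, hw⟩

omit hM in
theorem lt_mu (hS : S.IsNormalPraeDilator) (h : S.TowerAt G N A w) {i s : M} (hs : S.Mu N i s)
    (hi : ∀ x, InCode x A → x < i) : (S.obj N).lt w s := by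
  obtain ⟨t, e, he, hw⟩ := h
  exact hS.map_lt_mu he.2.1 hw ((hS.mu_embedding N).mem _ _ hs).1
    (fun j l hjl => hi l ((he.2.2 l).2 ⟨j, hjl⟩)) hs

theorem singleton (hS : S.IsNormalPraeDilator) (hG : S.IsTower ξ G) {i s : M} (hA : IsFinSet A)
    (hAi : ∀ x, InCode x A ↔ x = i) (hs : S.Mu N i s) : S.TowerAt G N A s := by
  have hi : i < N := ((hS.mu_embedding N).mem _ _ hs).1
  obtain ⟨f, hf, hf'⟩ := exists_embedding (seg N) 1 (fun _ b => b = i) (fun _ _ => ⟨i, rfl⟩)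
    (by rintro _ _ _ - rfl rfl; rfl) (by rintro _ _ - rfl; exact hi)
    (fun a a' b b' h1 h2 _ _ => by
      have h3 : a' = 0 := by
        rw [← zero_add (1 : M), lt_succ_iff] at h2
        exact le_antisymm h2 zero_le
      rw [h3] at h1
      exact (not_lt_zero h1).elim)
  have h0 : FinApp f 0 i := (hf' _ _).2 ⟨one_pos, rfl⟩
  refine ⟨0, f, ?_, ?_⟩ <;> rw [zero_add]
  · exact ⟨hA, hf, fun x => (hAi x).trans ⟨fun h => ⟨0, h ▸ h0⟩, fun ⟨j, hj⟩ => ((hf' _ _).1 hj).2⟩⟩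
  · exact hS.mu_natural 1 N f hf 0 i _ _ h0 hG.zero hs

/-- Adding a new largest element `i` to `B` amounts to an application of `ξ(μ(i), ·)`. -/
theorem insert (h : (quadDilator M).IsUpperDerivative S ξ) (hG : S.IsTower ξ G) {B i s : M}
    (hB : S.TowerAt G N B w) (hA : IsFinSet A) (hAB : ∀ x, InCode x A ↔ InCode x B ∨ x = i)
    (hBi : ∀ x, InCode x B → x < i) (hs : S.Mu N i s) :
    ∃ w', pair N (pair (quad s w) w') ∈ ξ ∧ S.TowerAt G N A w' := by
  have hS := h.normal
  have hws := hB.lt_mu hS hs hBi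
  obtain ⟨hi, hsN⟩ := h.mu_mem hs
  obtain ⟨t, e, he, hw⟩ := hB
  have hE := he.2.1.2.2
  obtain ⟨w', hw', -⟩ := h.exists_prod hsN (.inr hws)
  obtain ⟨g, hg, hg'⟩ := exists_embedding (seg N) (t + 1 + 1)
    (fun a b => FinApp e a b ∨ a = t + 1 ∧ b = i)
    (fun a ha => by
      rcases (lt_succ_iff.1 ha).lt_or_eq with ha | rfl
      · obtain ⟨b, hb⟩ := (hE.exists_unique a ha).exists
        exact ⟨b, .inl hb⟩
      · exact ⟨i, .inr ⟨rfl, rfl⟩⟩)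
    (by
      rintro a b b' - (h1 | ⟨rfl, rfl⟩) (h2 | ⟨h2, rfl⟩)
      · exact hE.eq_of_eq h1 h2
      · exact ((hE.mem _ _ h1).1.ne h2).elim
      · exact (lt_irrefl (t + 1) (hE.mem _ _ h2).1).elim
      · rfl)
    (by
      rintro a b - (h1 | ⟨-, rfl⟩)
      exacts [(hE.mem _ _ h1).2, hi])
    (by
      rintro a a' b b' haa - (h1 | ⟨rfl, rfl⟩) (h2 | ⟨rfl, rfl⟩)
      · exact hE.lt_of_lt _ _ _ _ h1 h2 ⟨haa, (hE.mem _ _ h2).1⟩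
      · exact ⟨hBi _ ((he.2.2 _).2 ⟨a, h1⟩), hi⟩
      · exact (lt_asymm haa (hE.mem _ _ h2).1).elim
      · exact (lt_irrefl _ haa).elim)
  have hgi : FinApp g (t + 1) i := (hg' _ _).2 ⟨lt_succ_self' _, .inr ⟨rfl, rfl⟩⟩
  have hge : ∀ a b, FinApp e a b → FinApp g a b := fun a b hab =>
    (hg' _ _).2 ⟨(hE.mem _ _ hab).1.trans (lt_succ_self' _), .inl hab⟩
  obtain ⟨f, u, v, hf, hv, hu, hstep⟩ := hG.step t
  have hfm := hf.isMorphism (lt_succ_self' (t + 1)).le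
  have hF := hS.isPraeDilator.isFunctor.embedding _ _ _ hg
  have hus : S.Map (t + 1 + 1) N g u s := hS.mu_natural _ _ g hg _ _ _ _ hgi hu hs
  have hvu : (S.obj (t + 1 + 1)).lt v u := hS.map_lt_mu hfm hv (lt_succ_self' _)
    (fun j l hjl => by rw [(hf.2.2.1 _ _ hjl).2]; exact (hf.2.2.1 _ _ hjl).1) hu
  have hvw : S.Map (t + 1 + 1) N g v w := by
    obtain ⟨w₁, hw₁⟩ := (hF.exists_unique v
      ((hS.isPraeDilator.isFunctor.embedding _ _ _ hfm).mem _ _ hv).2).exists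
    have h2 := hS.isPraeDilator.isFunctor.map_comp _ _ _ f g e hfm hg he.2.1
      (fun a b l hab hbl => by
        obtain ⟨ha, rfl⟩ := hf.2.2.1 _ _ hab
        obtain ⟨l', hl'⟩ := (hE.exists_unique b ha).exists
        rwa [hg.2.2.eq_of_eq hbl (hge _ _ hl')]) _ _ _ hv hw₁
    rwa [(hS.isPraeDilator.isFunctor.embedding _ _ _ he.2.1).eq_of_eq hw h2]
  refine ⟨w', hw', t + 1, g, ⟨hA, hg, fun x => ?_⟩, h.prod_natural hg hvu hus hvw hstep hw'⟩
  rw [hAB, he.2.2]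
  constructor
  · rintro (⟨a, ha⟩ | rfl)
    exacts [⟨a, hge _ _ ha⟩, ⟨_, hgi⟩]
  · rintro ⟨a, ha⟩
    rcases (hg' _ _).1 ha with ⟨-, h1 | ⟨-, rfl⟩⟩
    exacts [.inl ⟨a, h1⟩, .inr rfl]

/-- An image that is determined by a set with largest element `i` lies above `μ(i)`. -/
theorem mu_le (h : (quadDilator M).IsUpperDerivative S ξ) (hG : S.IsTower ξ G) {i s : M}
    (hA : S.TowerAt G N A w) (hi : InCode i A) (hmax : ∀ x, InCode x A → x ≤ i)
    (hs : S.Mu N i s) : s = w ∨ (S.obj N).lt s w := by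
  have hS := h.normal
  obtain ⟨B, hB, hBA⟩ := exists_erase A i
  have hBi : ∀ x, InCode x B → x < i := fun x hx =>
    (hmax x ((hBA x).1 hx).1).lt_of_ne ((hBA x).1 hx).2
  by_cases hne : ∃ y, InCode y B
  · obtain ⟨y, hy⟩ := hne
    obtain ⟨v, hv⟩ := exists_of_nonempty hS hG hB (fun x hx => hA.lt_of_mem ((hBA x).1 hx).1) hy
    obtain ⟨w', hw', hAw⟩ := hv.insert h hG hA.isFinSet (fun x => by
      rw [hBA]
      by_cases hx : x = i
      · simp [hx, hi]
      · simp [hx]) hBi hs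
    rw [hA.unique hS hAw]
    exact .inr (h.mu_lt_prod hs (hv.lt_mu hS hs hBi) hw')
  · push Not at hne
    refine .inl (unique hS (singleton hS hG hA.isFinSet (fun x => ⟨fun hx => ?_, ?_⟩) hs) hA)
    · by_contra hxi
      exact hne x ((hBA x).2 ⟨hx, hxi⟩)
    · rintro rfl; exact hi

/-- Images of tower elements are compared like the sets that determine them: the set which contains
the largest element of the symmetric difference is bigger. The restriction that the smaller set has
an element below that difference excludes the empty set, to which no tower element belongs. -/
theorem lt_of_diff (h : (quadDilator M).IsUpperDerivative S ξ) (hG : S.IsTower ξ G) {A' w' x x' : M}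
    (hA : S.TowerAt G N A w) (hA' : S.TowerAt G N A' w') (hx : InCode x A) (hxA' : ¬ InCode x A')
    (hx' : InCode x' A') (hlt : x' < x) (hiff : ∀ y, x < y → (InCode y A ↔ InCode y A')) :
    (S.obj N).lt w' w := by
  have hS := h.normal
  have := (TowerAt.sig hS hG N).at2
  have : Fact (S.obj N).IsInternal := ⟨h.obj_isInternal N⟩
  let P : M → Prop := fun d => ∀ A A' w w', S.TowerAt G N A w → S.TowerAt G N A' w' →
    InCode x A → ¬ InCode x A' → InCode x' A' →
    (∀ y, InCode y A → y < x + 1 + d ∧ (x < y → InCode y A')) →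
    (∀ y, InCode y A' → y < x + 1 + d ∧ (x < y → InCode y A)) → (S.obj N).lt w' w
  have hP : Pi1 fun e : Fin 1 → M => P (e 0) := by unfold P; infer_instance
  have hmu : ∀ i, i < N → ∃ s, S.Mu N i s := fun i hi =>
    ((hS.mu_embedding N).exists_unique i hi).exists
  have key : ∀ d, P d := by
    refine pi_induction P ?_ ?_
    · intro A A' w w' hA hA' hx hxA' hx' hAb hAb'
      simp only [add_zero, lt_succ_iff] at hAb hAb'
      obtain ⟨s, hs⟩ := hmu x (hA.lt_of_mem hx)
      have h1 := hA.mu_le h hG hx (fun y hy => (hAb y hy).1) hs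
      have h2 := hA'.lt_mu hS hs fun y hy => (hAb' y hy).1.lt_of_ne (by rintro rfl; exact hxA' hy)
      rcases h1 with rfl | h1
      exacts [h2, (h.isLinear N).trans _ _ _ h2 h1]
    · intro d ih A A' w w' hA hA' hx hxA' hx' hAb hAb'
      simp only [← add_assoc, lt_succ_iff] at hAb hAb'
      have hxd : x < x + 1 + d := (lt_succ_self' x).trans_le (self_le_add_right _ _)
      by_cases hi : InCode (x + 1 + d) A
      swap
      · have hi' : ¬ InCode (x + 1 + d) A' := fun hi' => hi ((hAb' _ hi').2 hxd)
        refine ih A A' w w' hA hA' hx hxA' hx'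
          (fun y hy => ⟨(hAb y hy).1.lt_of_ne ?_, (hAb y hy).2⟩)
          (fun y hy => ⟨(hAb' y hy).1.lt_of_ne ?_, (hAb' y hy).2⟩)
        · rintro rfl; exact hi hy
        · rintro rfl; exact hi' hy
      have hi' := (hAb _ hi).2 hxd
      obtain ⟨s, hs⟩ := hmu _ (hA.lt_of_mem hi)
      have herase : ∀ C v y, S.TowerAt G N C v → InCode (x + 1 + d) C → InCode y C →
          y < x + 1 + d → (∀ z, InCode z C → z ≤ x + 1 + d) → ∃ B u, S.TowerAt G N B u ∧
          (∀ z, InCode z B ↔ InCode z C ∧ z ≠ x + 1 + d) ∧ (S.obj N).lt u s ∧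
          pair N (pair (quad s u) v) ∈ ξ := by
        intro C v y hC hmem hy hyx hmax
        obtain ⟨B, hB, hBC⟩ := exists_erase C (x + 1 + d)
        have hBi : ∀ z, InCode z B → z < x + 1 + d := fun z hz =>
          (hmax z ((hBC z).1 hz).1).lt_of_ne ((hBC z).1 hz).2
        obtain ⟨u, hu⟩ := exists_of_nonempty hS hG hB
          (fun z hz => hC.lt_of_mem ((hBC z).1 hz).1) ((hBC y).2 ⟨hy, hyx.ne⟩)
        obtain ⟨v', hv', hCv⟩ := hu.insert h hG hC.isFinSet (fun z => by
          rw [hBC]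
          by_cases hz : z = x + 1 + d
          · simp [hz, hmem]
          · simp [hz]) hBi hs
        rw [hC.unique hS hCv]
        exact ⟨B, u, hu, hBC, hu.lt_mu hS hs hBi, hv'⟩
      obtain ⟨B, u, hB, hBA, hus, hw⟩ := herase A w x hA hi hx hxd fun y hy => (hAb y hy).1
      obtain ⟨B', u', hB', hBA', hus', hw'⟩ := herase A' w' x' hA' hi' hx' (hlt.trans hxd)
        fun y hy => (hAb' y hy).1
      have huu : (S.obj N).lt u' u := by
        refine ih B B' u u' hB hB' ((hBA _).2 ⟨hx, hxd.ne⟩) (fun hc => hxA' ((hBA' _).1 hc).1)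
          ((hBA' _).2 ⟨hx', (hlt.trans hxd).ne⟩) (fun y hy => ?_) (fun y hy => ?_)
        · obtain ⟨h1, h2⟩ := (hBA y).1 hy
          exact ⟨(hAb y h1).1.lt_of_ne h2, fun h3 => (hBA' y).2 ⟨(hAb y h1).2 h3, h2⟩⟩
        · obtain ⟨h1, h2⟩ := (hBA' y).1 hy
          exact ⟨(hAb' y h1).1.lt_of_ne h2, fun h3 => (hBA y).2 ⟨(hAb' y h1).2 h3, h2⟩⟩
      have hsN := (h.mu_mem hs).2
      refine h.prod_lt hsN (.inr hus') hsN (.inr hus) hw' hw (.inr ⟨rfl, ?_, .inr huu⟩)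
      rintro rfl; exact (h.isLinear N).irrefl _ hus
  have hN : N ≤ x + 1 + N := self_le_add_left _ _
  exact key N A A' w w' hA hA' hx hxA' hx'
    (fun y hy => ⟨(hA.lt_of_mem hy).trans_le hN, fun hxy => (hiff y hxy).1 hy⟩)
    (fun y hy => ⟨(hA'.lt_of_mem hy).trans_le hN, fun hxy => (hiff y hxy).2 hy⟩)

end TowerAt

namespace IsTower

variable {S : NormalData M} {ξ : Set M} {G : M → M}

/-- The element `G(t) ∈ S(t + 1)` has full support, as needed to build elements of `D^S(Y)`. If
`i` was missing, then two morphisms with ranges that differ in `i` and `i + 1` only would send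
`G(t)` to the same element, which `TowerAt.lt_of_diff` excludes. -/
theorem supp_eq (h : (quadDilator M).IsUpperDerivative S ξ) (hG : S.IsTower ξ G) {t c : M}
    (hc : S.Supp (t + 1) (G t) c) (i : M) : InCode i c ↔ i < t + 1 := by
  have hS := h.normal
  have hF := hS.isPraeDilator.isFunctor
  refine ⟨(hS.isPraeDilator.supp_finite _ _ (hG.mem t) c hc).2 i, fun hi => ?_⟩
  by_contra hic
  -- The morphisms that omit `i` and `i + 1` agree on the support of `G(t)`.
  obtain ⟨f₁, hf₁, hf₁'⟩ := exists_skip (t + 1) i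
  obtain ⟨f₂, hf₂, hf₂'⟩ := exists_skip (t + 1) (i + 1)
  have hagree : ∀ j l, InCode j c → (FinApp f₁ j l ↔ FinApp f₂ j l) := fun j l hj => by
    have hji : j ≠ i := by rintro rfl; exact hic hj
    rw [hf₁', hf₂', lt_succ_iff, Order.add_one_le_iff, lt_iff_le_and_ne (a := j),
      lt_iff_le_and_ne (a := i)]
    simp [hji, hji.symm]
  obtain ⟨w₁, hw₁⟩ := ((hF.embedding _ _ _ hf₁).exists_unique _ (hG.mem t)).exists
  obtain ⟨w₂, hw₂⟩ := ((hF.embedding _ _ _ hf₂).exists_unique _ (hG.mem t)).exists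
  have heq : w₁ = w₂ := by
    obtain ⟨k, e, he, τ, hτ, hmap⟩ := hS.isPraeDilator.supp_condition _ _ (hG.mem t) c hc
    obtain ⟨g₁, hg₁, hg₁'⟩ := exists_comp he.2.1 hf₁
    obtain ⟨g₂, hg₂, hg₂'⟩ := exists_comp he.2.1 hf₂
    have hgg : g₁ = g₂ := hg₁.code_ext hg₂ fun a b => by
      rw [hg₁', hg₂']
      exact exists_congr fun j => and_congr_right fun hj => hagree j b ((he.2.2 j).2 ⟨a, hj⟩)
    subst hgg
    have h1 := hF.map_comp _ _ _ e f₁ g₁ he.2.1 hf₁ hg₁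
      (fun a b l hab hbl => (hg₁' _ _).2 ⟨b, hab, hbl⟩) _ _ _ hmap hw₁
    have h2 := hF.map_comp _ _ _ e f₂ g₁ he.2.1 hf₂ hg₂
      (fun a b l hab hbl => (hg₂' _ _).2 ⟨b, hab, hbl⟩) _ _ _ hmap hw₂
    exact (hF.embedding _ _ _ hg₁).eq_of_eq h1 h2
  have hrange : ∀ {p f A : M}, p < t + 1 + 1 → (∀ j l, FinApp f j l ↔
      j < t + 1 ∧ (j < p ∧ l = j ∨ p ≤ j ∧ l = j + 1)) → (∀ y, InCode y A ↔ ∃ j, FinApp f j y) →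
      ∀ y, InCode y A ↔ y < t + 1 + 1 ∧ y ≠ p := by
    intro p f A hp hf hA y
    rw [hA]
    constructor
    · rintro ⟨j, hj⟩
      obtain ⟨h1, ⟨h2, rfl⟩ | ⟨h2, rfl⟩⟩ := (hf _ _).1 hj
      · exact ⟨h1.trans (lt_succ_self' _), h2.ne⟩
      · exact ⟨(add_lt_add_iff_right 1).2 h1, (lt_succ_iff.2 h2).ne'⟩
    · rintro ⟨h1, h2⟩
      rcases lt_or_gt_of_ne h2 with h3 | h3
      · exact ⟨y, (hf _ _).2 ⟨h3.trans_le (lt_succ_iff.1 hp), .inl ⟨h3, rfl⟩⟩⟩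
      · rcases Arith.eq_zero_or_succ y with rfl | ⟨j, rfl⟩
        · exact (not_lt_zero h3).elim
        · exact ⟨j, (hf _ _).2 ⟨(add_lt_add_iff_right 1).1 h1, .inr ⟨lt_succ_iff.1 h3, rfl⟩⟩⟩
  obtain ⟨A₁, hA₁⟩ := exists_range hf₁
  obtain ⟨A₂, hA₂⟩ := exists_range hf₂
  have hi' : i + 1 < t + 1 + 1 := (add_lt_add_iff_right 1).2 hi
  have hA₁' := hrange (hi.trans (lt_succ_self' _)) hf₁' hA₁.2.2
  have hA₂' := hrange hi' hf₂' hA₂.2.2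
  have hlt := TowerAt.lt_of_diff h hG (x := i + 1) (x' := i) ⟨t, f₁, hA₁, hw₁⟩ ⟨t, f₂, hA₂, hw₂⟩
    ((hA₁' _).2 ⟨hi', (lt_succ_self' i).ne'⟩) (fun hc => ((hA₂' _).1 hc).2 rfl)
    ((hA₂' _).2 ⟨hi.trans (lt_succ_self' _), (lt_succ_self' i).ne⟩) (lt_succ_self' i)
    (fun y hy => by
      rw [hA₁', hA₂']
      exact and_congr_right fun _ => iff_of_true ((lt_succ_self' i).trans hy).ne' hy.ne')
  rw [heq] at hlt
  exact (h.isLinear _).irrefl _ hlt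

variable {Y : Order M} {a e t : M}

theorem dMem (h : (quadDilator M).IsUpperDerivative S ξ) (hG : S.IsTower ξ G)
    (he : IsEnum Y a (t + 1) e) : S.DMem Y (pair a (G t)) := by
  obtain ⟨c, hc, -⟩ := h.normal.isPraeDilator.supp_exists_unique _ _ (hG.mem t)
  exact ⟨a, G t, t + 1, e, c, rfl, he, hG.mem t, hc, hG.supp_eq h hc⟩

/-- Elements `⟨a, G(t)⟩` of `D^S(Y)` are compared like the finite sets `a ⊆ Y`. -/
theorem dLt (h : (quadDilator M).IsUpperDerivative S ξ) (hG : S.IsTower ξ G) (hY : Y.IsLinear)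
    (hYi : Y.IsInternal) {a' e' t' x x' : M} (he : IsEnum Y a (t + 1) e)
    (he' : IsEnum Y a' (t' + 1) e') (hx : InCode x a) (hxa' : ¬ InCode x a') (hx' : InCode x' a')
    (hlt : Y.lt x' x) (hiff : ∀ y, Y.lt x y → (InCode y a ↔ InCode y a')) :
    S.DLt Y (pair a' (G t')) (pair a (G t)) := by
  have hF := h.normal.isPraeDilator.isFunctor
  have hmem : ∀ {a k e y : M}, IsEnum Y a k e → InCode y a → y ∈ Y.fld := fun he hy => by
    obtain ⟨i, hi⟩ := (he.2.2 _).1 hy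
    exact (he.2.1.2.2.mem _ _ hi).2
  obtain ⟨b, hb, hb'⟩ := exists_union a' a
  obtain ⟨k, d, hd⟩ := exists_enum hY hYi hb fun y hy => by
    rcases (hb' y).1 hy with hy | hy
    exacts [hmem he' hy, hmem he hy]
  have hD := hd.2.1.2.2
  -- Represent a suborder of `b` by the set of indices of its elements.
  have aux : ∀ {a t e : M}, IsEnum Y a (t + 1) e → (∀ y, InCode y a → InCode y b) →
      ∃ f A τ, IsMorphism (t + 1) k f ∧ (∀ i j x, FinApp f i j → FinApp d j x → FinApp e i x) ∧
        S.Map (t + 1) k f (G t) τ ∧ S.TowerAt G k A τ ∧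
        ∀ j y, FinApp d j y → (InCode j A ↔ InCode y a) := by
    intro a t e he hab
    obtain ⟨f, hf, h1, h2⟩ := exists_inclusion hY he hd hab
    obtain ⟨A, hA⟩ := exists_range hf
    obtain ⟨τ, hτ⟩ := ((hF.embedding _ _ _ hf).exists_unique _ (hG.mem t)).exists
    refine ⟨f, A, τ, hf, h1, hτ, ⟨t, f, hA, hτ⟩, fun j y hjy => ?_⟩
    rw [hA.2.2, he.2.2]
    exact exists_congr fun i => ⟨fun hij => h1 i j y hij hjy, fun hiy => h2 i j y hiy hjy⟩
  obtain ⟨f, A, τ, hf, hfe, hτ, hA, hAa⟩ := aux he fun y hy => (hb' y).2 (.inr hy)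
  obtain ⟨f', A', τ', hf', hfe', hτ', hA', hAa'⟩ := aux he' fun y hy => (hb' y).2 (.inl hy)
  obtain ⟨i, hi⟩ := (hd.2.2 x).1 ((hb' x).2 (.inr hx))
  obtain ⟨i', hi'⟩ := (hd.2.2 x').1 ((hb' x').2 (.inl hx'))
  refine ⟨hG.dMem h he', hG.dMem h he, a', G t', t' + 1, e', a, G t, t + 1, e, b, k, d, f', f, τ',
    τ, rfl, he', rfl, he, hd, hb', hf', hfe', hf, hfe, hτ', hτ, ?_⟩
  refine hA.lt_of_diff h hG hA' ((hAa _ _ hi).2 hx) (fun hc => hxa' ((hAa' _ _ hi).1 hc))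
    ((hAa' _ _ hi').2 hx') ((hD.lt_iff (seg_isLinear k) hY hi' hi).2 hlt).1 fun j hj => ?_
  by_cases hjk : j < k
  · obtain ⟨y, hy⟩ := (hD.exists_unique j hjk).exists
    rw [hAa _ _ hy, hAa' _ _ hy]
    exact hiff y (hD.lt_of_lt _ _ _ _ hi hy ⟨hj, hjk⟩)
  · exact iff_of_false (fun hc => hjk (hA.lt_of_mem hc)) (fun hc => hjk (hA'.lt_of_mem hc))

end IsTower
end NormalData

/-! ### The linear order of approximations to the range of an injection -/

section Selection

variable {M : Type*} [L2Structure M] [hM : Fact (IsModelRCA0 M)]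

/-- The greatest number principle for bounded `Σ⁰₁`-predicates. -/
theorem exists_greatest (P : M → Prop) [hP : Sig (fun e : Fin 1 → M => P (e 0))] {a s : M}
    (has : a ≤ s) (ha : P a) : ∃ m, m ≤ s ∧ P m ∧ ∀ k, m < k → k ≤ s → ¬ P k := by
  have := hP.at1
  obtain ⟨b, hb⟩ := le_iff_exists_add'.1 has
  obtain ⟨d, ⟨m, hm, hPm⟩, hmin⟩ := exists_least (fun d => ∃ m, m + d = s ∧ P m) (a := b)
    ⟨a, hb.symm, ha⟩
  refine ⟨m, hm ▸ self_le_add_right _ _, hPm, fun k hk hks hPk => ?_⟩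
  obtain ⟨c, hc⟩ := (Arith.lt_iff _ _).1 hk
  obtain ⟨d', hd'⟩ := le_iff_exists_add'.1 hks
  have hd : m + d = m + (c + 1 + d') := by
    rw [hm, hd', hc]; ring
  have hd := add_left_cancel hd
  refine hmin d' ?_ ⟨k, ?_, hPk⟩
  · rw [hd, Arith.lt_iff]
    exact ⟨c, by ring⟩
  · exact hd'.symm

end Selection

variable {M : Type*} [L2Structure M] [hM : Fact (IsModelRCA0 M)]

/-- The number `n` looks like a true stage of `f` up to `m`: no value `f(k)` with `n < k ≤ m` is
smaller than `f(n)`. (The definition is used for injective functions.) -/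
def TrueUpTo (f : M → M) (n m : M) : Prop := ∀ k, k < m + 1 → n < k → f n < f k

/-- The number `c` is the least value `f(j)` with `n < j ≤ m`. -/
def IsLeastValue (f : M → M) (n m c : M) : Prop :=
  (∃ j, j < m + 1 ∧ n < j ∧ f j = c) ∧ ∀ j, j < m + 1 → n < j → c ≤ f j

/-- The strict order in which a number `n` lies above the larger numbers `m` up to which it looks
like a true stage, and below the other larger numbers. -/
def StageLt (f : M → M) (m n : M) : Prop := n < m ∧ TrueUpTo f n m ∨ m < n ∧ ¬ TrueUpTo f m n

/-- Pairs `(k, c)` with `c ≤ f(k + 1) + 1`, ordered lexicographically with respect to `StageLt` and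
the usual order of the numbers. -/
def stageOrder (f : M → M) : Order M where
  fld := {z | ∃ k c, z = pair k c ∧ c ≤ f (k + 1) + 1}
  lt z z' := ∃ k c, z = pair k c ∧ ∃ k' c', z' = pair k' c' ∧
    (c ≤ f (k + 1) + 1 ∧ c' ≤ f (k' + 1) + 1) ∧ (StageLt f k k' ∨ k = k' ∧ c < c')

/-- The pair `(k, c)` belongs to the finite set `A_s`: either `k < s` looks like a true stage up to
`s` and `c` is the least later value that is known at `s`, or `k = s` and `c` is the bound
`f(s + 1) + 1` on the next value. -/
def InBranch (f : M → M) (s k c : M) : Prop :=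
  (k < s ∧ TrueUpTo f k s ∧ IsLeastValue f k s c) ∨ k = s ∧ c = f (s + 1) + 1

section StageOrder

variable {f : M → M}

theorem StageLt.irrefl (n : M) : ¬ StageLt f n n := by
  rintro (⟨h, -⟩ | ⟨h, -⟩) <;> exact lt_irrefl _ h

theorem StageLt.total (m n : M) : StageLt f m n ∨ m = n ∨ StageLt f n m := by
  unfold StageLt
  rcases lt_trichotomy m n with h | h | h
  · by_cases ht : TrueUpTo f m n <;> simp [h, ht]
  · simp [h]
  · by_cases ht : TrueUpTo f n m <;> simp [h, ht]

theorem TrueUpTo.mono {n m m' : M} (h : TrueUpTo f n m) (hm : m' ≤ m) : TrueUpTo f n m' :=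
  fun k hk hnk => h k (lt_succ_iff.2 ((lt_succ_iff.1 hk).trans hm)) hnk

theorem TrueUpTo.trans {n m l : M} (h : TrueUpTo f n m) (hnm : n < m) (h' : TrueUpTo f m l) :
    TrueUpTo f n l := by
  intro k hk hnk
  rcases le_or_gt k m with hkm | hkm
  · exact h k (lt_succ_iff.2 hkm) hnk
  · exact (h m (lt_succ_self' m) hnm).trans (h' k hk hkm)

theorem StageLt.trans {a b c : M} (h : StageLt f a b) (h' : StageLt f b c) : StageLt f a c := by
  rcases lt_trichotomy a c with hac | rfl | hac
  · refine .inr ⟨hac, fun ht => ?_⟩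
    rcases h with ⟨h1, h2⟩ | ⟨h1, h2⟩ <;> rcases h' with ⟨k1, k2⟩ | ⟨k1, k2⟩
    · exact lt_asymm hac (k1.trans h1)
    · exact k2 (h2.trans h1 ht)
    · exact h2 (ht.trans hac k2)
    · exact h2 (ht.mono k1.le)
  · rcases h with ⟨h1, h2⟩ | ⟨h1, h2⟩ <;> rcases h' with ⟨k1, k2⟩ | ⟨k1, k2⟩
    · exact (lt_asymm h1 k1).elim
    · exact (k2 h2).elim
    · exact (h2 k2).elim
    · exact (lt_asymm h1 k1).elim
  · refine .inl ⟨hac, ?_⟩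
    rcases h with ⟨h1, h2⟩ | ⟨h1, h2⟩ <;> rcases h' with ⟨k1, k2⟩ | ⟨k1, k2⟩
    · exact k2.trans k1 h2
    · exact (k2 (h2.mono hac.le)).elim
    · exact k2.mono h1.le
    · exact (lt_asymm hac (h1.trans k1)).elim

theorem pair_mem_stageOrder {k c : M} : pair k c ∈ (stageOrder f).fld ↔ c ≤ f (k + 1) + 1 := by
  constructor
  · rintro ⟨k', c', h, hc⟩
    obtain ⟨rfl, rfl⟩ := pair_inj.1 h
    exact hc
  · exact fun h => ⟨k, c, rfl, h⟩

theorem stageOrder_lt {k c k' c' : M} (hc : c ≤ f (k + 1) + 1) (hc' : c' ≤ f (k' + 1) + 1) :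
    (stageOrder f).lt (pair k c) (pair k' c') ↔ StageLt f k k' ∨ k = k' ∧ c < c' := by
  constructor
  · rintro ⟨_, _, h1, _, _, h2, -, h⟩
    obtain ⟨rfl, rfl⟩ := pair_inj.1 h1
    obtain ⟨rfl, rfl⟩ := pair_inj.1 h2
    exact h
  · exact fun h => ⟨k, c, rfl, k', c', rfl, ⟨hc, hc'⟩, h⟩

theorem stageOrder_isLinear (f : M → M) : (stageOrder f).IsLinear where
  lt_mem := by
    rintro _ _ ⟨k, c, rfl, k', c', rfl, ⟨hc, hc'⟩, -⟩
    exact ⟨⟨k, c, rfl, hc⟩, k', c', rfl, hc'⟩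
  irrefl := by
    rintro _ ⟨k, c, rfl, k', c', h, -, hlt⟩
    obtain ⟨rfl, rfl⟩ := pair_inj.1 h
    rcases hlt with h | ⟨-, h⟩
    exacts [StageLt.irrefl _ h, lt_irrefl _ h]
  trans := by
    rintro _ _ _ ⟨k, c, rfl, k', c', rfl, ⟨hc, -⟩, hlt⟩ ⟨k₁, c₁, h, k'', c'', rfl, ⟨-, hc''⟩, hlt'⟩
    obtain ⟨rfl, rfl⟩ := pair_inj.1 h
    rw [stageOrder_lt hc hc'']
    rcases hlt with h1 | ⟨rfl, h1⟩ <;> rcases hlt' with h2 | ⟨rfl, h2⟩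
    exacts [.inl (h1.trans h2), .inl h1, .inl h2, .inr ⟨rfl, h1.trans h2⟩]
  total := by
    rintro _ ⟨k, c, rfl, hc⟩ _ ⟨k', c', rfl, hc'⟩
    rw [stageOrder_lt hc hc', stageOrder_lt hc' hc, pair_inj]
    rcases StageLt.total (f := f) k k' with h | rfl | h
    · exact .inl (.inl h)
    · rcases lt_trichotomy c c' with h | h | h
      exacts [.inl (.inr ⟨rfl, h⟩), .inr (.inl ⟨rfl, h⟩), .inr (.inr (.inr ⟨rfl, h⟩))]
    · exact .inr (.inr (.inl h))

theorem InBranch.le {s k c : M} (h : InBranch f s k c) : k ≤ s := by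
  rcases h with ⟨h, -⟩ | ⟨rfl, -⟩
  exacts [h.le, le_rfl]

theorem InBranch.le_value {s k c : M} (h : InBranch f s k c) : c ≤ f (k + 1) + 1 := by
  rcases h with ⟨h, -, -, h'⟩ | ⟨rfl, rfl⟩
  · exact (h' (k + 1) ((add_lt_add_iff_right 1).2 h) (lt_succ_self' k)).trans (lt_succ_self' _).le
  · exact le_rfl

theorem InBranch.trueUpTo {s k c : M} (h : InBranch f s k c) : TrueUpTo f k s := by
  rcases h with ⟨-, h, -⟩ | ⟨rfl, -⟩
  · exact h
  · exact fun j hj hkj => (not_le.2 hkj (lt_succ_iff.1 hj)).elim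

theorem IsLeastValue.unique {n m c c' : M} (h : IsLeastValue f n m c) (h' : IsLeastValue f n m c') :
    c = c' := by
  obtain ⟨⟨j, hj, hnj, rfl⟩, h2⟩ := h
  obtain ⟨⟨j', hj', hnj', rfl⟩, h2'⟩ := h'
  exact le_antisymm (h2 _ hj' hnj') (h2' _ hj hnj)

theorem InBranch.unique {s k c c' : M} (h : InBranch f s k c) (h' : InBranch f s k c') :
    c = c' := by
  rcases h with ⟨h1, -, h2⟩ | ⟨h1, h2⟩ <;> rcases h' with ⟨k1, -, k2⟩ | ⟨k1, k2⟩
  · exact h2.unique k2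
  · exact (h1.ne k1).elim
  · exact (k1.ne h1).elim
  · rw [h2, k2]

variable [hf : Fn (fun e : Fin 1 → M => f (e 0))]

theorem TrueUpTo.sig : Sig fun e : Fin 2 → M => TrueUpTo f (e 0) (e 1) := by
  have := hf.at1
  unfold TrueUpTo; infer_instance

theorem TrueUpTo.pi : Pi1 fun e : Fin 2 → M => TrueUpTo f (e 0) (e 1) := by
  have := hf.at1
  unfold TrueUpTo; infer_instance

theorem StageLt.sig : Sig fun e : Fin 2 → M => StageLt f (e 0) (e 1) := by
  have := (TrueUpTo.sig (f := f)).at2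
  have := (TrueUpTo.pi (f := f)).at2
  unfold StageLt; infer_instance

theorem StageLt.pi : Pi1 fun e : Fin 2 → M => StageLt f (e 0) (e 1) := by
  have := (TrueUpTo.sig (f := f)).at2
  have := (TrueUpTo.pi (f := f)).at2
  unfold StageLt; infer_instance

theorem InBranch.sig : Sig fun e : Fin 3 → M => InBranch f (e 0) (e 1) (e 2) := by
  have := hf.at1
  have := (TrueUpTo.sig (f := f)).at2
  unfold InBranch IsLeastValue; infer_instance

theorem InBranch.pi : Pi1 fun e : Fin 3 → M => InBranch f (e 0) (e 1) (e 2) := by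
  have := hf.at1
  have := (TrueUpTo.pi (f := f)).at2
  unfold InBranch IsLeastValue; infer_instance

theorem stageOrder_isInternal (f : M → M) [hf : Fn (fun e : Fin 1 → M => f (e 0))] :
    (stageOrder f).IsInternal := by
  have := hf.at1
  have := (StageLt.sig (f := f)).at2
  have := (StageLt.pi (f := f)).at2
  exact ⟨isSet_of_delta fun z => ∃ k c, z = pair k c ∧ c ≤ f (k + 1) + 1,
    isSet_pairs fun z z' => ∃ k c, z = pair k c ∧ ∃ k' c', z' = pair k' c' ∧
      (c ≤ f (k + 1) + 1 ∧ c' ≤ f (k' + 1) + 1) ∧ (StageLt f k k' ∨ k = k' ∧ c < c')⟩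

theorem exists_isLeastValue {n m : M} (h : n < m) : ∃ c, IsLeastValue f n m c := by
  have := hf.at1
  obtain ⟨c, ⟨j, h1, h2, h3⟩, hmin⟩ := exists_least (fun c => ∃ j, j < m + 1 ∧ n < j ∧ f j = c)
    (a := f m) ⟨m, lt_succ_self' m, h, rfl⟩
  refine ⟨c, ⟨j, h1, h2, h3⟩, fun i hi hni => ?_⟩
  by_contra hc
  exact hmin _ (not_le.1 hc) ⟨i, hi, hni, rfl⟩

/-- The sequence of finite sets `A_s ⊆ Y` with `Y = stageOrder f` is strictly descending, when
finite sets are compared by the largest element of the symmetric difference. -/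
theorem exists_branch_diff (hinj : ∀ i j, f i = f j → i = j) (h0 : f 0 = 0) (s : M) :
    ∃ k c c', InBranch f s k c ∧ InBranch f (s + 1) k c' ∧ c' < c ∧
      ∀ k₁ c₁, StageLt f k k₁ → (InBranch f s k₁ c₁ ↔ InBranch f (s + 1) k₁ c₁) := by
  have := hf.at1
  have := (TrueUpTo.sig (f := f)).at2
  have hle : ∀ {n j m : M}, j < m + 1 → n < j → n < m := fun h1 h2 => h2.trans_le (lt_succ_iff.1 h1)
  obtain ⟨k, hks, ⟨hk, hkr⟩, hmax⟩ := exists_greatest (fun k => TrueUpTo f k s ∧ f k < f (s + 1))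
    (zero_le : (0 : M) ≤ s) ⟨fun j _ hj => by
        rw [h0]
        refine pos_iff_ne_zero.2 fun h => hj.ne' (hinj _ _ (h.trans h0.symm)),
      by
        rw [h0]
        refine pos_iff_ne_zero.2 fun h => ?_
        exact (zero_le.trans_lt (lt_succ_self' s)).ne' (hinj _ _ (h.trans h0.symm))⟩
  have hk' : TrueUpTo f k (s + 1) := by
    intro j hj hkj
    rcases (lt_succ_iff.1 hj).lt_or_eq with h | rfl
    exacts [hk j h hkj, hkr]
  -- All values between `k` and `s + 1` exceed `f (s + 1)`, by the maximality of `k`.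
  have hbig : ∀ j, j < s + 1 → k < j → f (s + 1) < f j := by
    intro j hj hkj
    obtain ⟨c, ⟨i, hi, hki, rfl⟩, hc⟩ := exists_isLeastValue (f := f) (hle hj hkj)
    refine lt_of_lt_of_le ?_ (hc j hj hkj)
    by_contra hcon
    refine hmax i hki (lt_succ_iff.1 hi) ⟨fun l hl hil => ?_, ?_⟩
    · exact (hc l hl (hki.trans hil)).lt_of_ne fun h => hil.ne (hinj _ _ h)
    · exact (not_lt.1 hcon).lt_of_ne fun h => hi.ne (hinj _ _ h)
  have hks1 : k < s + 1 := lt_succ_iff.2 hks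
  have hnew : InBranch f (s + 1) k (f (s + 1)) := by
    refine .inl ⟨hks1, hk', ⟨s + 1, lt_succ_self' _, hks1, rfl⟩, fun j hj hkj => ?_⟩
    rcases (lt_succ_iff.1 hj).lt_or_eq with h | rfl
    exacts [(hbig j h hkj).le, le_rfl]
  obtain ⟨c, hc, hrc⟩ : ∃ c, InBranch f s k c ∧ f (s + 1) < c := by
    rcases hks.lt_or_eq with h | rfl
    · obtain ⟨c, hc⟩ := exists_isLeastValue (f := f) h
      refine ⟨c, .inl ⟨h, hk, hc⟩, ?_⟩
      obtain ⟨j, hj, hkj, rfl⟩ := hc.1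
      exact hbig j hj hkj
    · exact ⟨_, .inr ⟨rfl, rfl⟩, lt_succ_self' _⟩
  refine ⟨k, c, f (s + 1), hc, hnew, hrc, fun k₁ c₁ hlt => ?_⟩
  rcases hlt with ⟨hkk, ht⟩ | ⟨hkk, ht⟩
  · have h1 : TrueUpTo f k₁ (s + 1) := ht.trans hkk hk'
    have h2 : TrueUpTo f k₁ s := h1.mono (lt_succ_self' s).le
    have h3 : IsLeastValue f k₁ s c₁ ↔ IsLeastValue f k₁ (s + 1) c₁ := by
      constructor
      · rintro ⟨⟨j, hj, hkj, rfl⟩, hle⟩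
        refine ⟨⟨j, hj.trans (lt_succ_self' _), hkj, rfl⟩, fun i hi hki => ?_⟩
        rcases (lt_succ_iff.1 hi).lt_or_eq with h | rfl
        exacts [hle i h hki, (hle k hks1 hkk).trans hkr.le]
      · rintro ⟨⟨j, hj, hkj, rfl⟩, hle⟩
        refine ⟨⟨j, (lt_succ_iff.1 hj).lt_of_ne ?_, hkj, rfl⟩,
          fun i hi hki => hle i (hi.trans (lt_succ_self' _)) hki⟩
        rintro rfl
        exact not_lt.2 (hle k (hks1.trans (lt_succ_self' _)) hkk) hkr
    have h4 : k₁ < s := hkk.trans_le hks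
    simp only [InBranch, h1, h2, h3, h4, h4.trans (lt_succ_self' s), h4.ne,
      (h4.trans (lt_succ_self' s)).ne, true_and, false_and]
  · refine iff_of_false (fun h => ht ?_) (fun h => ht ?_)
    exacts [hk.mono h.le, hk'.mono h.le]

/-- If `stageOrder f` has a descending sequence, then the range of `f` can be computed from it: the
first components of the sequence are unbounded, and each of them is a true stage `n`, i.e. all later
values of `f` exceed `f(n)`. -/
theorem isSet_range_of_descending (hwf : ¬ (stageOrder f).IsWellFounded) :
    IsSet {v | ∃ j, f j = v} := by
  have := hf.at1
  rw [isWellFounded_iff, not_not] at hwf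
  obtain ⟨g, hg, hgY, hglt⟩ := hwf
  have hY := stageOrder_isLinear f
  have hYi := stageOrder_isInternal f
  have := Fact.mk hYi
  have := hg.at1
  obtain ⟨k, hkfn, hk⟩ := exists_fn (fun n x => ∃ c, g n = pair x c)
    (fun n => by obtain ⟨k, c, h, -⟩ := hgY n; exact ⟨k, c, h⟩)
    (by rintro n x x' ⟨c, h⟩ ⟨c', h'⟩; exact (pair_inj.1 (h.symm.trans h')).1)
  have := hkfn.at1
  have hdesc : ∀ n d, (stageOrder f).lt (g (n + d + 1)) (g n) := fun n =>
    sigma_induction _ (by rw [add_zero]; exact hglt n) fun d ih =>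
      hY.trans _ _ _ (by rw [← add_assoc]; exact hglt _) ih
  have hunb : ∀ n₀ b, ∃ n, n₀ ≤ n ∧ b ≤ k n := by
    intro n₀ b
    by_contra hcon
    push Not at hcon
    obtain ⟨B, hB⟩ := exists_bound (fun i j => j = f (i + 1) + 1) b fun i _ => ⟨_, rfl⟩
    obtain ⟨n, hn, hgn⟩ := exists_le_of_descending hY hYi g hgY hglt n₀ (pair b B)
    obtain ⟨c, hc⟩ := hk n
    have h1 := hgY n
    rw [hc, pair_mem_stageOrder] at h1
    obtain ⟨_, h2, rfl⟩ := hB _ (hcon n hn)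
    rw [hc] at hgn
    exact not_lt.2 hgn (pair_lt_of_add_lt (add_lt_add (hcon n hn) (h1.trans_lt h2)))
  have htrue : ∀ n j, k n < j → f (k n) < f j := by
    intro n j hj
    by_contra hcon
    have hbelow : ∀ d, k (n + d + 1) < j := by
      intro d
      obtain ⟨_, c, h1, _, c', h2, -, hlt⟩ := hdesc n d
      obtain ⟨b, hb⟩ := hk (n + d + 1)
      obtain ⟨b', hb'⟩ := hk n
      rw [hb] at h1
      rw [hb'] at h2
      obtain ⟨rfl, rfl⟩ := pair_inj.1 h1
      obtain ⟨rfl, rfl⟩ := pair_inj.1 h2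
      rcases hlt with (⟨-, ht⟩ | ⟨hlt, -⟩) | ⟨heq, -⟩
      · by_contra hjk
        exact hcon (ht j (lt_succ_iff.2 (not_lt.1 hjk)) hj)
      · exact hlt.trans hj
      · rw [heq]; exact hj
    obtain ⟨m, hm, hjm⟩ := hunb (n + 1) j
    obtain ⟨d, hd⟩ := le_iff_exists_add'.1 hm
    have hd' : m = n + d + 1 := by rw [hd]; ring
    rw [hd'] at hjm
    exact not_lt.2 hjm (hbelow d)
  have hval : ∀ v, ∃ n, v ≤ f (k n) := by
    refine sigma_induction _ ⟨0, zero_le⟩ ?_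
    rintro v ⟨n, hn⟩
    obtain ⟨m, -, hm⟩ := hunb 0 (k n + 1)
    exact ⟨m, Order.add_one_le_iff.2 (hn.trans_lt (htrue n _ (Order.add_one_le_iff.1 hm)))⟩
  have hPi : Pi1 fun e : Fin 1 → M => ∃ j, f j = e 0 :=
    (inferInstance : Pi1 fun e : Fin 1 → M => ∀ n, e 0 < f (k n) → ∃ j, j < k n ∧ f j = e 0).congr
      fun e => by
        constructor
        · intro h
          obtain ⟨n, hn⟩ := hval (e 0 + 1)
          obtain ⟨j, -, hj⟩ := h n (Order.add_one_le_iff.1 hn)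
          exact ⟨j, hj⟩
        · rintro ⟨j, hj⟩ n hn
          refine ⟨j, ?_, hj⟩
          rcases lt_trichotomy j (k n) with h | h | h
          · exact h
          · rw [← hj, h] at hn
            exact (lt_irrefl _ hn).elim
          · rw [← hj] at hn
            exact (lt_asymm hn (htrue n j h)).elim
  exact isSet_of_delta fun v => ∃ j, f j = v

end StageOrder

/-- If the quadratic dilator has an upper derivative that is a dilator, then ranges of injections
exist: the elements `⟨A_s, G(|A_s| - 1)⟩` form a descending sequence in `D^S(Y)` for
`Y = stageOrder f`, which is thus not a well-order. -/
theorem isSet_range {S : NormalData M} {ξ : Set M}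
    (h : (quadDilator M).IsUpperDerivative S ξ) (hwo : S.PreservesWellOrders) (f : M → M)
    [hf : Fn (fun e : Fin 1 → M => f (e 0))] (hinj : ∀ i j, f i = f j → i = j) (h0 : f 0 = 0) :
    IsSet {v | ∃ j, f j = v} := by
  have hY := stageOrder_isLinear f
  have hYi := stageOrder_isInternal f
  refine isSet_range_of_descending fun hwf => ?_
  have hD := hwo _ hYi hY hwf
  rw [isWellFounded_iff] at hD
  refine hD ?_
  obtain ⟨G, hG⟩ := h.exists_tower
  have := Fact.mk hYi
  have := hf.at1
  have := hG.fn.at1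
  have := (InBranch.sig (f := f)).at3
  have := (InBranch.pi (f := f)).at3
  have := (TrueUpTo.pi (f := f)).at2
  -- The relation says that `a` codes the finite set `A_s`; its `Σ⁰₁`-form needs a bound on `k`.
  let C : M → M → Prop := fun s a => IsFinSet a ∧
    (∀ z, InCode z a → ∃ k c, z = pair k c ∧ InBranch f s k c) ∧
    (∀ k, k < s + 1 → TrueUpTo f k s → ∃ c, InBranch f s k c ∧ InCode (pair k c) a)
  have hC : Sig fun e : Fin 2 → M => C (e 0) (e 1) := by unfold C; infer_instance
  have := hC.at2
  have hC' : ∀ {s a}, C s a → ∀ k c, InCode (pair k c) a ↔ InBranch f s k c := by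
    rintro s a ⟨-, h2, h3⟩ k c
    constructor
    · intro hkc
      obtain ⟨_, _, h4, h5⟩ := h2 _ hkc
      obtain ⟨rfl, rfl⟩ := pair_inj.1 h4
      exact h5
    · intro hkc
      obtain ⟨c', h4, h5⟩ := h3 k (lt_succ_iff.2 hkc.le) hkc.trueUpTo
      rwa [hkc.unique h4]
  let R : M → M → Prop := fun s z => ∃ a t e, z = pair a (G t) ∧ C s a ∧
    IsEnum (stageOrder f) a (t + 1) e
  have hR : Sig fun e : Fin 2 → M => R (e 0) (e 1) := by unfold R; infer_instance
  obtain ⟨H, hH, hH'⟩ := exists_fn R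
    (by
      intro s
      obtain ⟨B, hB⟩ := exists_bound (fun i j => j = f (i + 1) + 1) (s + 1) fun i _ => ⟨_, rfl⟩
      obtain ⟨a, ha, ha'⟩ := exists_finSet (fun z => ∃ k c, z = pair k c ∧ InBranch f s k c)
        (pair (s + 1) B) (by
          rintro _ ⟨k, c, rfl, hkc⟩
          have hk := lt_succ_iff.2 hkc.le
          obtain ⟨_, hlt, rfl⟩ := hB k hk
          exact pair_lt_of_add_lt (add_lt_add hk (hkc.le_value.trans_lt hlt)))
      obtain ⟨k, e, he⟩ := exists_enum hY hYi ha fun x hx => by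
        obtain ⟨k, c, rfl, hkc⟩ := (ha' x).1 hx
        exact pair_mem_stageOrder.2 hkc.le_value
      obtain ⟨i, hi⟩ := (he.2.2 _).1 ((ha' _).2 ⟨s, f (s + 1) + 1, rfl, .inr ⟨rfl, rfl⟩⟩)
      rcases Arith.eq_zero_or_succ k with rfl | ⟨t, rfl⟩
      · exact (not_lt_zero (show i < 0 from (he.2.1.2.2.mem _ _ hi).1)).elim
      refine ⟨_, a, t, e, rfl, ⟨ha, fun z hz => (ha' z).1 hz, fun k hk ht => ?_⟩, he⟩
      obtain ⟨c, hc⟩ : ∃ c, InBranch f s k c := by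
        rcases (lt_succ_iff.1 hk).lt_or_eq with hk | rfl
        · obtain ⟨c, hc⟩ := exists_isLeastValue (f := f) hk
          exact ⟨c, .inl ⟨hk, ht, hc⟩⟩
        · exact ⟨_, .inr ⟨rfl, rfl⟩⟩
      exact ⟨c, hc, (ha' _).2 ⟨k, c, rfl, hc⟩⟩)
    (by
      rintro s _ _ ⟨a, t, e, rfl, ha, he⟩ ⟨a', t', e', rfl, ha', he'⟩
      have haa : a = a' := by
        refine ha.1.ext ha'.1 fun z => ⟨fun hz => ?_, fun hz => ?_⟩
        · obtain ⟨k, c, rfl, hkc⟩ := ha.2.1 z hz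
          exact (hC' ha' k c).2 hkc
        · obtain ⟨k, c, rfl, hkc⟩ := ha'.2.1 z hz
          exact (hC' ha k c).2 hkc
      subst haa
      rw [add_right_cancel (he.unique hY he').1])
  refine ⟨H, hH, fun s => ?_, fun s => ?_⟩
  · obtain ⟨a, t, e, h1, -, he⟩ := hH' s
    rw [h1]
    exact hG.dMem h he
  · obtain ⟨a, t, e, h1, ha, he⟩ := hH' s
    obtain ⟨a', t', e', h1', ha', he'⟩ := hH' (s + 1)
    rw [h1, h1']
    obtain ⟨k, c, c', hc, hc', hlt, hiff⟩ := exists_branch_diff hinj h0 s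
    refine hG.dLt h hY hYi he he' ((hC' ha k c).2 hc)
      (fun hcon => hlt.ne (hc'.unique ((hC' ha' k c).1 hcon))) ((hC' ha' k c').2 hc')
      ((stageOrder_lt hc'.le_value hc.le_value).2 (.inr ⟨rfl, hlt⟩)) ?_
    rintro _ ⟨_, _, h2, k₁, c₁, rfl, -, h3⟩
    obtain ⟨rfl, rfl⟩ := pair_inj.1 h2
    rw [hC' ha, hC' ha']
    rcases h3 with h3 | ⟨rfl, h3⟩
    · exact hiff k₁ c₁ h3
    · exact iff_of_false (fun h4 => h3.ne (hc.unique h4))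
        (fun h4 => (hlt.trans h3).ne (hc'.unique h4))

/-! ### Arithmetical comprehension from the existence of ranges -/

section ArithmeticalComprehension

variable {M : Type*} [L2Structure M] [hM : Fact (IsModelRCA0 M)]

theorem add_self_ne_add_self_add_one (a b : M) : a + a ≠ b + b + 1 := by
  rcases le_or_gt a b with h | h
  · exact ((add_le_add h h).trans_lt (lt_succ_self' _)).ne
  · refine ne_of_gt ?_
    calc b + b + 1 = b + (b + 1) := by ring
      _ < a + a := add_lt_add_of_lt_of_le h (Order.add_one_le_iff.2 h)

theorem add_self_inj {a b : M} (h : a + a = b + b) : a = b := by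
  rcases lt_trichotomy a b with h1 | h1 | h1
  · exact ((add_lt_add h1 h1).ne h).elim
  · exact h1
  · exact ((add_lt_add h1 h1).ne h.symm).elim

/-- Every `Σ⁰₁`-class is computable in the range of an injection that maps `0` to `0`. -/
theorem isSet_of_sig
    (hrange : ∀ f : M → M, Fn (fun e : Fin 1 → M => f (e 0)) → (∀ i j, f i = f j → i = j) →
      f 0 = 0 → IsSet {v | ∃ j, f j = v})
    (P : M → Prop) (hP : Sig fun e : Fin 1 → M => P (e 0)) : IsSet {n | P n} := by
  obtain ⟨R, hR, hPR⟩ := sig_iff.1 hP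
  let θ : M → M → Prop := fun n k => R (fun _ => n) k
  have hθ : Bdd fun e : Fin 2 → M => θ (e 0) (e 1) := by
    have := hR.subst_cons (m := 2) (fun _ e => e 0) (fun e => e 1)
    exact this
  have hPθ : ∀ n, P n ↔ ∃ k, θ n k := fun n => hPR fun _ => n
  have hS := (Sig.of_bdd _ (hP := hθ)).at2
  have hQ := (Pi1.of_bdd _ (hP := hθ)).at2
  -- The relation `L n k` says that `k` is the least witness for `P n`.
  let L : M → M → Prop := fun n k => θ n k ∧ ∀ j, j < k → ¬ θ n j
  have hL : Sig fun e : Fin 2 → M => L (e 0) (e 1) := by unfold L; infer_instance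
  have hL' : Pi1 fun e : Fin 2 → M => L (e 0) (e 1) := by unfold L; infer_instance
  have hL := hL.at2
  have hL' := hL'.at2
  have hLu : ∀ {n k k'}, L n k → L n k' → k = k' := by
    rintro n k k' ⟨h1, h2⟩ ⟨h1', h2'⟩
    rcases lt_trichotomy k k' with h | h | h
    exacts [(h2' _ h h1).elim, h, (h2 _ h h1').elim]
  -- The graph of an injection: the even number `2(n + 1)` is a value precisely when `P n` holds,
  -- and arguments that do not code a least witness have odd values.
  let F : M → M → Prop := fun m v => (m = 0 ∧ v = 0) ∨ ∃ p, m = p + 1 ∧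
    ((∃ n k, p = pair n k ∧ L n k ∧ v = (n + 1) + (n + 1)) ∨
      (¬ ∃ n k, p = pair n k ∧ L n k) ∧ v = p + p + 1)
  have hF : Sig fun e : Fin 2 → M => F (e 0) (e 1) := by unfold F; infer_instance
  have hFu : ∀ m v v', F m v → F m v' → v = v' := by
    rintro m v v' (⟨rfl, rfl⟩ | ⟨p, rfl, h⟩) (⟨h', rfl⟩ | ⟨p', h', h''⟩)
    · rfl
    · exact (hM.out.succ_ne_zero _ h'.symm).elim
    · exact (hM.out.succ_ne_zero _ h').elim
    · obtain rfl := add_right_cancel h'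
      rcases h with ⟨n, k, rfl, h1, rfl⟩ | ⟨h1, rfl⟩ <;>
        rcases h'' with ⟨n', k', h2, h3, rfl⟩ | ⟨h3, rfl⟩
      · rw [(pair_inj.1 h2).1]
      · exact (h3 ⟨n, k, rfl, h1⟩).elim
      · exact (h1 ⟨n', k', h2, h3⟩).elim
      · rfl
  have hFt : ∀ m, ∃ v, F m v := by
    intro m
    rcases Arith.eq_zero_or_succ m with rfl | ⟨p, rfl⟩
    · exact ⟨0, .inl ⟨rfl, rfl⟩⟩
    · by_cases h : ∃ n k, p = pair n k ∧ L n k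
      · obtain ⟨n, k, h1, h2⟩ := h
        exact ⟨_, .inr ⟨p, rfl, .inl ⟨n, k, h1, h2, rfl⟩⟩⟩
      · exact ⟨_, .inr ⟨p, rfl, .inr ⟨h, rfl⟩⟩⟩
  have hne : ∀ n : M, (n + 1) + (n + 1) ≠ 0 := fun n h => by
    rw [← add_assoc] at h
    exact hM.out.succ_ne_zero _ h
  have hFi : ∀ m m' v, F m v → F m' v → m = m' := by
    rintro m m' v (⟨rfl, rfl⟩ | ⟨p, rfl, ⟨n, k, rfl, h1, rfl⟩ | ⟨h1, rfl⟩⟩)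
      (⟨rfl, h⟩ | ⟨p', rfl, ⟨n', k', rfl, h1', h⟩ | ⟨h1', h⟩⟩)
    · rfl
    · exact (hne _ h.symm).elim
    · exact (hM.out.succ_ne_zero _ h.symm).elim
    · exact (hne _ h).elim
    · obtain rfl := add_right_cancel (add_self_inj h)
      rw [hLu h1 h1']
    · exact (add_self_ne_add_self_add_one _ _ h).elim
    · exact (hM.out.succ_ne_zero _ h).elim
    · exact (add_self_ne_add_self_add_one _ _ h.symm).elim
    · rw [add_self_inj (add_right_cancel h)]
  obtain ⟨f, hf, hfF⟩ := exists_fn F hFt hFu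
  have hset : Fact (IsSet {v | ∃ j, f j = v}) := ⟨hrange f hf
    (fun i j h => hFi i j _ (hfF i) (h ▸ hfF j)) (hFu 0 _ _ (hfF 0) (.inl ⟨rfl, rfl⟩))⟩
  have hPset : ∀ n, n + 1 + (n + 1) ∈ {v | ∃ j, f j = v} ↔ P n := by
    intro n
    rw [hPθ]
    constructor
    · rintro ⟨j, hj⟩
      rcases hj ▸ hfF j with ⟨-, h⟩ | ⟨p, -, ⟨n', k, -, h1, h⟩ | ⟨-, h⟩⟩
      · exact (hne _ h).elim
      · obtain rfl := add_right_cancel (add_self_inj h)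
        exact ⟨k, h1.1⟩
      · exact (add_self_ne_add_self_add_one _ _ h).elim
    · rintro ⟨k, hk⟩
      have := hS
      obtain ⟨k', h1, h2⟩ := exists_least (fun k => θ n k) hk
      exact ⟨pair n k' + 1, hFu _ _ _ (hfF _) (.inr ⟨_, rfl, .inl ⟨n, k', rfl, ⟨h1, h2⟩, rfl⟩⟩)⟩
  have := isSet_of_delta fun n => n + 1 + (n + 1) ∈ {v | ∃ j, f j = v}
  simpa only [hPset] using this

/-- If all `Σ⁰₁`-classes of numbers are sets, then all `Σ⁰₁`-relations can be defined by bounded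
formulas. The arity is reduced by coding two arguments as a pair. -/
theorem Bdd.of_sig_succ
    (hset : ∀ P : M → Prop, Sig (fun e : Fin 1 → M => P (e 0)) → IsSet {n | P n}) :
    ∀ (n : ℕ) (P : (Fin (n + 1) → M) → Prop), Sig P → Bdd P
  | 0, P, hP => by
    have h1 : ∀ e : Fin 1 → M, (fun _ => e 0) = e := fun e => funext fun i => by
      rw [Subsingleton.elim i 0]
    have := Fact.mk (hset (fun x => P fun _ => x) (hP.congr fun e => by rw [h1]))
    exact (inferInstance : Bdd fun e : Fin 1 → M => e 0 ∈ {x | P fun _ => x}).congr fun e => by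
      rw [Set.mem_ofPred_eq, h1]
  | n + 1, P, hP => by
    let P' : (Fin (n + 1) → M) → Prop := fun e =>
      ∃ x, ∃ y, e 0 = pair x y ∧ P (Fin.cons x (Fin.cons y fun i => e i.succ))
    have hP' : Sig P' := by
      have : Sig fun e : Fin (n + 1 + 1 + 1) → M => P (Fin.cons (e (Fin.succ 0)) (Fin.cons (e 0)
          fun i => e i.succ.succ.succ)) := by
        have := hP.subst (m := n + 1 + 1 + 1)
          (Fin.cons (fun e => e (Fin.succ 0)) (Fin.cons (fun e => e 0)
            fun i e => e i.succ.succ.succ)) (ht := fun i => by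
              refine Fin.cases ?_ (fun i => Fin.cases ?_ (fun i => ?_) i) i <;>
                simp only [Fin.cons_zero, Fin.cons_succ] <;> infer_instance)
        refine this.congr fun e => iff_of_eq (congrArg P (funext fun i => ?_))
        refine Fin.cases ?_ (fun i => Fin.cases ?_ (fun i => ?_) i) i <;> simp
      unfold P'; infer_instance
    have := (Bdd.of_sig_succ hset n P' hP').subst (m := n + 1 + 1)
      (Fin.cons (fun e => pair (e 0) (e (Fin.succ 0))) fun i e => e i.succ.succ) (fun i => by
        refine Fin.cases ?_ (fun i => ?_) i <;>
          simp only [Fin.cons_zero, Fin.cons_succ] <;> infer_instance)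
    refine this.congr fun e => ?_
    have he : (Fin.cons (e 0) (Fin.cons (e (Fin.succ 0)) fun i => e i.succ.succ) :
        Fin (n + 1 + 1) → M) = e := funext fun i => by
      refine Fin.cases ?_ (fun i => Fin.cases ?_ (fun i => ?_) i) i <;> simp
    constructor
    · rintro ⟨x, y, h1, h2⟩
      simp only [Fin.cons_zero, Fin.cons_succ] at h1 h2
      obtain ⟨rfl, rfl⟩ := pair_inj.1 h1
      rwa [he] at h2
    · intro h
      refine ⟨e 0, e (Fin.succ 0), by simp, ?_⟩
      simp only [Fin.cons_succ]
      rwa [he]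

theorem Bdd.of_sig
    (hset : ∀ P : M → Prop, Sig (fun e : Fin 1 → M => P (e 0)) → IsSet {n | P n}) :
    ∀ {n : ℕ} {P : (Fin n → M) → Prop}, Sig P → Bdd P
  | 0, P, hP => ((Bdd.of_sig_succ hset 0 (fun e => P fun i => e i.succ)
      (hP.subst fun i e => e i.succ)).subst (fun _ _ => 0) fun _ => inferInstance).congr fun e => by
        rw [Subsingleton.elim (fun i : Fin 0 => (0 : M)) e]
  | n + 1, P, hP => Bdd.of_sig_succ hset n P hP

/-- If all `Σ⁰₁`-classes are sets, then every arithmetical formula is equivalent to a bounded one,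
as the quantifiers can be absorbed by set parameters one at a time. -/
theorem Formula.bdd_sat
    (hset : ∀ P : M → Prop, Sig (fun e : Fin 1 → M => P (e 0)) → IsSet {n | P n}) {n : ℕ}
    (φ : Formula M n) : Bdd φ.Sat := by
  have hterm : ∀ {n : ℕ} (s : NumTerm M n), TermFn fun e => s.val e := fun s => ⟨s, fun _ => rfl⟩
  have hex : ∀ {n : ℕ} {P : (Fin (n + 1) → M) → Prop}, Bdd P →
      Bdd fun e : Fin n → M => ∃ a, P (Fin.cons a e) := fun {n P} hP =>
    Bdd.of_sig hset ⟨P, hP, fun _ => Iff.rfl⟩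
  have hcons : ∀ {n : ℕ} {P : (Fin (n + 1) → M) → Prop}, Bdd P →
      Bdd fun e : Fin (n + 1) → M => P (Fin.cons (e 0) fun i => e i.succ) := fun {n P} hP =>
    hP.congr fun e => by
      rw [show (Fin.cons (e 0) fun i => e i.succ : Fin (n + 1) → M) = e from Fin.cons_self_tail e]
  induction φ with
  | eq s t => exact ⟨.eq s t, trivial, fun _ => Iff.rfl⟩
  | lt s t => exact ⟨.lt s t, trivial, fun _ => Iff.rfl⟩
  | mem t A => exact ⟨.mem t A, trivial, fun _ => Iff.rfl⟩
  | not φ h => exact Bdd.not φ.Sat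
  | and φ ψ h₁ h₂ => exact Bdd.and φ.Sat ψ.Sat
  | or φ ψ h₁ h₂ => exact Bdd.or φ.Sat ψ.Sat
  | ballLt t φ h =>
    have := hterm t
    have := hcons h
    exact Bdd.ball (fun e => t.val e) (fun e a => φ.Sat (Fin.cons a e))
  | bexLt t φ h =>
    have := hterm t
    have := hcons h
    exact Bdd.bex (fun e => t.val e) (fun e a => φ.Sat (Fin.cons a e))
  | all φ h =>
    have := hex (P := fun e => ¬ φ.Sat e) (Bdd.not φ.Sat)
    exact (Bdd.not fun e => ∃ a, ¬ φ.Sat (Fin.cons a e)).congr fun e => by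
      simp [Formula.Sat]
  | ex φ h => exact hex h

theorem arithmeticalComprehension_of_isSet_range
    (hrange : ∀ f : M → M, Fn (fun e : Fin 1 → M => f (e 0)) → (∀ i j, f i = f j → i = j) →
      f 0 = 0 → IsSet {v | ∃ j, f j = v}) : ArithmeticalComprehension M := by
  intro φ
  have h1 : ∀ e : Fin 1 → M, ![e 0] = e := fun e => funext fun i => by
    rw [Subsingleton.elim i 0]; rfl
  have : Bdd fun e : Fin 1 → M => φ.Sat ![e 0] :=
    (φ.bdd_sat (isSet_of_sig hrange)).congr fun e => by rw [h1]
  exact isSet_of_delta fun n => φ.Sat ![n]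

end ArithmeticalComprehension

end SOA

theorem corollary3p3 (M : Type*) [SOA.L2Structure M] (hM : SOA.IsModelRCA0 M)
    (h : ∀ T : SOA.NormalData M, T.IsNormalDilator →
      ∃ (S : SOA.NormalData M) (ξ : Set M), T.IsUpperDerivative S ξ ∧ S.IsNormalDilator) :
    SOA.ArithmeticalComprehension M := by
  have := Fact.mk hM
  obtain ⟨S, ξ, hS, -, hwo⟩ := h (SOA.quadDilator M) SOA.quad_isNormalDilator
  exact SOA.arithmeticalComprehension_of_isSet_range fun f hf hinj h0 =>
    SOA.isSet_range hS hwo f hinj h0
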